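/- Let $\mathbb S^2\subset\mathbb R^3$ be the unit sphere with surface measure $d\omega$, gradient $\nabla$, divergence $\nabla\cdot$ and Laplace–Beltrami operator $\Delta=\nabla\cdot\nabla$. For a positive function $\phi\in C^2(\mathbb S^2)$ let $\Omega_\phi=\{x\in\mathbb R^3: |x|<\phi(x/|x|)\}$ (with $0\in\Omega_\phi$) and, for $\omega\in\mathbb S^2$, $$ F(\phi)(\omega)=-\nabla\cdot\frac{\nabla\phi}{\phi\sqrt{\phi^2+|\nabla\phi|^2}}+\frac{3}{\sqrt{\phi^2+|\nabla\phi|^2}}-\frac{\sqrt{\phi^2+|\nabla\phi|^2}}{\phi^2}+\int_{\Omega_\phi}\frac{dy}{|\phi(\omega)\omega-y|}. $$ Let $0<\alpha<1$ and, for $R>0$ and $\chi\in C^{2,\alpha}(\mathbb S^2)$ with $\inf_{\mathbb S^2}\chi>-R$, set $\Phi(R,\chi)=R^2\,(F(R+\chi)-F(R))$. **Proposition 1.8 (linearization).** Let $R>0$. For all $\chi\in C^{2,\alpha}(\mathbb S^2)$ with $\inf\chi>-R$ one has $\Phi(R,\chi)\in C^{0,\alpha}(\mathbb S^2)$, and the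 map $\chi\mapsto\Phi(R,\chi)$ from this open subset of $C^{2,\alpha}(\mathbb S^2)$ to $C^{0,\alpha}(\mathbb S^2)$ is Fréchet differentiable at $\chi=0$. Its derivative $D_\chi\Phi(R,0):C^{2,\alpha}(\mathbb S^2)\to C^{0,\alpha}(\mathbb S^2)$ is given, for $u\in C^{2,\alpha}(\mathbb S^2)$ and $\omega\in\mathbb S^2$, by $$ D_\chi\Phi(R,0)[u](\omega)=-\Delta u(\omega)-2u(\omega)+R^3\left(\int_{\mathbb S^2}\frac{u(\omega')}{|\omega-\omega'|}\,d\omega'-\frac{4\pi}{3}u(\omega)\right). $$ This operator commutes with rotations, that is, $D_\chi\Phi(R,0)[u\circ g]=(D_\chi\Phi(R,0)[u])\circ g$ for every linear isometry $g$ of $\mathbb R^3$ and every $u\in C^{2,\alpha}(\mathbb S^2)$. For every $\ell\in\mathbb N_0$ and every spherical harmonic $Y$ of degree $\ell$ (the restriction to $\mathbb S^2$ of a real harmonic homogeneous polynomial of degree $\ell$ on $\mathbb R^3$) one has $Y\in C^{2,\alpha}(\mathbb S^2)$ and $$ D_\chi\Phi(R,0)[Y]=\left(\ell(\ell+1)-2-\frac{4\pi}{3}R^3\left(1-\frac{3}{2\ell+1}\right)\right)Y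 . $$ -/

import Mathlib

open MeasureTheory
open scoped NNReal

noncomputable section

namespace LiquidDrop

/-- Euclidean three-space. -/
abbrev E3 : Type := EuclideanSpace ℝ (Fin 3)

/-- The unit sphere of `E3`. -/
abbrev S2 : Type := Metric.sphere (0 : E3) 1

/-- The surface measure `dω` on the sphere (total mass `4π`). -/
def surf : Measure S2 := (volume : Measure E3).toSphere

/-- The radial projection `x ↦ x / |x|` of a nonzero vector to the sphere. -/
def proj (x : E3) (hx : x ≠ 0) : S2 :=
  ⟨‖x‖⁻¹ • x, by simp [norm_smul, hx]⟩

open Classical in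
/-- The extension `x ↦ f (x / |x|)` of a function on the sphere that is constant along rays
(with value `0` at the origin). -/
def ext {V : Type*} [Zero V] (f : S2 → V) (x : E3) : V :=
  if hx : x ≠ 0 then f (proj x hx) else 0

/-! ### Differential operators on the sphere

The ray-constant extension has no radial derivative, so its Euclidean gradient at a point of the
sphere is the tangential gradient there; for the same reason the Euclidean divergence of
the ray-constant extension of a tangent field is its divergence on the sphere. -/

/-- The gradient `∇f` on the sphere, a tangent field with values in `E3`. -/
def grad (f : S2 → ℝ) (ω : S2) : E3 := gradient (ext f) (ω : E3)

/-- The divergence `∇ · X` on the sphere of a tangent field `X`. -/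
def divg (X : S2 → E3) (ω : S2) : ℝ :=
  ∑ i : Fin 3, (fderiv ℝ (ext X) (ω : E3) (EuclideanSpace.single i 1)) i

/-- The Laplace–Beltrami operator `Δ = ∇ · ∇` on the sphere. -/
def lap (f : S2 → ℝ) : S2 → ℝ := divg (grad f)

/-! ### The functional -/

/-- The star-shaped set `Ω_φ = {x : |x| < φ(x/|x|)}`. -/
def Omega (φ : S2 → ℝ) : Set E3 := {x | x = 0 ∨ ‖x‖ < ext φ x}

/-- `√(φ² + |∇φ|²)`. -/
def slope (φ : S2 → ℝ) (ω : S2) : ℝ := Real.sqrt (φ ω ^ 2 + ‖grad φ ω‖ ^ 2)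

/-- `F(φ) = -∇·(∇φ / (φ √(φ²+|∇φ|²))) + 3/√(φ²+|∇φ|²) - √(φ²+|∇φ|²)/φ²
  + ∫_{Ω_φ} dy / |φ(ω)ω - y|`. -/
def F (φ : S2 → ℝ) (ω : S2) : ℝ :=
  - divg (fun ω' => (φ ω' * slope φ ω')⁻¹ • grad φ ω') ω
    + 3 / slope φ ω - slope φ ω / φ ω ^ 2
    + ∫ y in Omega φ, 1 / ‖φ ω • (ω : E3) - y‖

/-- The function `R² (F(R + χ) - F(R))`. -/
def PhiFun (R : ℝ) (χ : S2 → ℝ) (ω : S2) : ℝ :=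
  R ^ 2 * (F (fun ω' => R + χ ω') ω - F (fun _ => R) ω)

/-! ### Hölder spaces on the sphere -/

/-- `f ∈ C^{k,α}(S²)`: the ray-constant extension is `C^k` away from the origin and its `k`-th
derivative is `α`-Hölder continuous along the sphere. -/
def IsHolder (k : ℕ) (α : ℝ≥0) (f : S2 → ℝ) : Prop :=
  ContDiffOn ℝ k (ext f) {0}ᶜ ∧
    MemHolder α (fun ω : S2 => iteratedFDeriv ℝ k (ext f) (ω : E3))

theorem ne_zero (ω : S2) : (ω : E3) ≠ 0 := ne_zero_of_mem_unit_sphere ω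

theorem ext_coe {V : Type*} [Zero V] (f : S2 → V) (ω : S2) : ext f (ω : E3) = f ω := by
  rw [ext, dif_pos (ne_zero ω)]
  congr 1
  apply Subtype.ext
  simp [proj]

theorem ext_zero : ext (0 : S2 → ℝ) = 0 := by
  funext x; simp [ext]

theorem ext_add (f g : S2 → ℝ) : ext (f + g) = ext f + ext g := by
  funext x; by_cases hx : x = 0 <;> simp [ext, hx]

theorem ext_smul (c : ℝ) (f : S2 → ℝ) : ext (c • f) = c • ext f := by
  funext x; by_cases hx : x = 0 <;> simp [ext, hx]

theorem IsHolder.contDiffAt {k : ℕ} {α : ℝ≥0} {f : S2 → ℝ} (hf : IsHolder k α f) {j : ℕ}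
    (hj : j ≤ k) {x : E3} (hx : x ≠ 0) : ContDiffAt ℝ j (ext f) x :=
  (hf.1.contDiffAt (isOpen_compl_singleton.mem_nhds hx)).of_le (by exact_mod_cast hj)

theorem IsHolder.deriv_add {k : ℕ} {α : ℝ≥0} {f g : S2 → ℝ} (hf : IsHolder k α f)
    (hg : IsHolder k α g) {j : ℕ} (hj : j ≤ k) (ω : S2) :
    iteratedFDeriv ℝ j (ext (f + g)) (ω : E3) =
      iteratedFDeriv ℝ j (ext f) (ω : E3) + iteratedFDeriv ℝ j (ext g) (ω : E3) := by
  rw [ext_add, iteratedFDeriv_add_apply (hf.contDiffAt hj (ne_zero ω))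
    (hg.contDiffAt hj (ne_zero ω))]

theorem IsHolder.deriv_smul {k : ℕ} {α : ℝ≥0} {f : S2 → ℝ} (hf : IsHolder k α f)
    (c : ℝ) {j : ℕ} (hj : j ≤ k) (ω : S2) :
    iteratedFDeriv ℝ j (ext (c • f)) (ω : E3) = c • iteratedFDeriv ℝ j (ext f) (ω : E3) := by
  rw [ext_smul, iteratedFDeriv_const_smul_apply (hf.contDiffAt hj (ne_zero ω))]

theorem IsHolder.zero (k : ℕ) (α : ℝ≥0) : IsHolder k α (0 : S2 → ℝ) := by
  refine ⟨?_, ?_⟩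
  · rw [ext_zero]; exact contDiffOn_const
  · rw [ext_zero]
    have : (fun ω : S2 => iteratedFDeriv ℝ k (0 : E3 → ℝ) (ω : E3)) = 0 := by
      funext ω; simp
    rw [this]; exact memHolder_zero

theorem IsHolder.add {k : ℕ} {α : ℝ≥0} {f g : S2 → ℝ} (hf : IsHolder k α f)
    (hg : IsHolder k α g) : IsHolder k α (f + g) := by
  refine ⟨by rw [ext_add]; exact hf.1.add hg.1, ?_⟩
  have := hf.2.add hg.2
  have h : (fun ω : S2 => iteratedFDeriv ℝ k (ext (f + g)) (ω : E3)) = _ :=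
    funext fun ω =>  hf.deriv_add hg le_rfl ω
  rw [h]
  exact this

theorem IsHolder.smul {k : ℕ} {α : ℝ≥0} {f : S2 → ℝ} (c : ℝ) (hf : IsHolder k α f) :
    IsHolder k α (c • f) := by
  refine ⟨by rw [ext_smul]; exact hf.1.const_smul c, ?_⟩
  have := hf.2.smul (c := c)
  have h : (fun ω : S2 => iteratedFDeriv ℝ k (ext (c • f)) (ω : E3)) = _ :=
    funext fun ω =>  hf.deriv_smul c le_rfl ω
  rw [h]
  exact this

/-- The space `C^{k,α}(S²)`, carrying the Hölder norm (and its topology) defined below. -/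
structure Holder (k : ℕ) (α : ℝ≥0) where
  /-- the underlying function -/
  toFun : S2 → ℝ
  isHolder : IsHolder k α toFun

namespace Holder

variable {k : ℕ} {α : ℝ≥0}

instance : CoeFun (Holder k α) (fun _ => S2 → ℝ) := ⟨toFun⟩

theorem toFun_injective : Function.Injective (toFun : Holder k α → S2 → ℝ) := by
  rintro ⟨f, hf⟩ ⟨g, hg⟩ h
  cases h
  rfl

instance : Zero (Holder k α) := ⟨⟨0, IsHolder.zero k α⟩⟩

instance : Add (Holder k α) := ⟨fun f g => ⟨f.1 + g.1, f.2.add g.2⟩⟩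

instance : SMul ℝ (Holder k α) := ⟨fun c f => ⟨c • f.1, f.2.smul c⟩⟩

instance : Neg (Holder k α) := ⟨fun f => ⟨-f.1, by simpa using f.2.smul (-1)⟩⟩

instance : Sub (Holder k α) :=
  ⟨fun f g => ⟨f.1 - g.1, by simpa [sub_eq_add_neg] using f.2.add (g.2.smul (-1))⟩⟩

instance : SMul ℕ (Holder k α) :=
  ⟨fun n f => ⟨n • f.1, by simpa [Nat.cast_smul_eq_nsmul] using f.2.smul (n : ℝ)⟩⟩

instance : SMul ℤ (Holder k α) :=
  ⟨fun n f => ⟨n • f.1, by simpa [Int.cast_smul_eq_zsmul] using f.2.smul (n : ℝ)⟩⟩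

instance : AddCommGroup (Holder k α) :=
  toFun_injective.addCommGroup _ rfl (fun _ _ => rfl) (fun _ => rfl) (fun _ _ => rfl)
    (fun _ _ => rfl) (fun _ _ => rfl)

/-- Evaluation as an additive map. -/
def toFunHom : Holder k α →+ (S2 → ℝ) where
  toFun := toFun
  map_zero' := rfl
  map_add' _ _ := rfl

instance : Module ℝ (Holder k α) :=
  toFun_injective.module ℝ toFunHom (fun _ _ => rfl)

theorem add_coe (f g : Holder k α) : (f + g).1 = f.1 + g.1 := rfl

theorem smul_coe (c : ℝ) (f : Holder k α) : (c • f).1 = c • f.1 := rfl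

/-- `sup_{S²} |D^j f|`. -/
def supDeriv (j : ℕ) (f : S2 → ℝ) : ℝ := ⨆ ω : S2, ‖iteratedFDeriv ℝ j (ext f) (ω : E3)‖

/-- `‖f‖ = ∑_{j ≤ k} sup |D^j f| + [D^k f]_α`. -/
instance : Norm (Holder k α) where
  norm f := ∑ j ∈ Finset.range (k + 1), supDeriv j f.1 +
    nnHolderNorm α (fun ω : S2 => iteratedFDeriv ℝ k (ext f.1) (ω : E3))

theorem norm_def (f : Holder k α) : ‖f‖ = ∑ j ∈ Finset.range (k + 1), supDeriv j f.1 +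
    nnHolderNorm α (fun ω : S2 => iteratedFDeriv ℝ k (ext f.1) (ω : E3)) := rfl

theorem bdd (f : Holder k α) {j : ℕ} (hj : j ≤ k) :
    BddAbove (Set.range fun ω : S2 => ‖iteratedFDeriv ℝ j (ext f.1) (ω : E3)‖) := by
  have hc : Continuous fun ω : S2 => ‖iteratedFDeriv ℝ j (ext f.1) (ω : E3)‖ := by
    refine continuous_iff_continuousAt.2 fun ω => ContinuousAt.norm ?_
    have h := IsHolder.contDiffAt f.2 hj (ne_zero ω)
    have h2 : ContinuousAt (iteratedFDeriv ℝ j (ext f.1)) (ω : E3) :=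
      (h.iteratedFDeriv_right (m := 0) (i := j) (by simp)).continuousAt
    exact h2.comp continuous_subtype_val.continuousAt
  exact (isCompact_range hc).bddAbove

theorem le_supDeriv (f : Holder k α) {j : ℕ} (hj : j ≤ k) (ω : S2) :
    ‖iteratedFDeriv ℝ j (ext f.1) (ω : E3)‖ ≤ supDeriv j f.1 :=
  le_ciSup (bdd f hj) ω

instance : Nonempty S2 := (NormedSpace.sphere_nonempty.2 zero_le_one).to_subtype

theorem supDeriv_nonneg (j : ℕ) (f : S2 → ℝ) : 0 ≤ supDeriv j f :=
  Real.iSup_nonneg fun _ => norm_nonneg _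

theorem core : NormedSpace.Core ℝ (Holder k α) where
  norm_nonneg f := add_nonneg (Finset.sum_nonneg fun j _ => supDeriv_nonneg j f.1)
    (NNReal.coe_nonneg _)
  norm_smul c f := by
    have h1 : ∀ j ∈ Finset.range (k + 1), supDeriv j (c • f).1 = ‖c‖ * supDeriv j f.1 := by
      intro j hj
      have hj' : j ≤ k := Nat.lt_succ_iff.1 (Finset.mem_range.1 hj)
      simp only [supDeriv, Real.mul_iSup_of_nonneg (norm_nonneg c), ← norm_smul]
      congr 1; funext ω
      exact congrArg norm (IsHolder.deriv_smul f.2 c hj' ω)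
    have h2 : (fun ω : S2 => iteratedFDeriv ℝ k (ext (c • f).1) (ω : E3)) =
        c • fun ω : S2 => iteratedFDeriv ℝ k (ext f.1) (ω : E3) := by
      funext ω; exact IsHolder.deriv_smul f.2 c le_rfl ω
    rw [norm_def, norm_def, Finset.sum_congr rfl h1, h2, MemHolder.nnHolderNorm_smul f.2.2,
      ← Finset.mul_sum]
    simp [mul_add]
  norm_triangle f g := by
    have h1 : ∀ j ∈ Finset.range (k + 1),
        supDeriv j (f + g).1 ≤ supDeriv j f.1 + supDeriv j g.1 := by
      intro j hj
      have hj' : j ≤ k := Nat.lt_succ_iff.1 (Finset.mem_range.1 hj)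
      refine ciSup_le fun ω => ?_
      rw [add_coe, IsHolder.deriv_add f.2 g.2 hj' ω]
      exact (norm_add_le _ _).trans (add_le_add (le_supDeriv f hj' ω) (le_supDeriv g hj' ω))
    have h2 : (fun ω : S2 => iteratedFDeriv ℝ k (ext (f + g).1) (ω : E3)) =
        (fun ω : S2 => iteratedFDeriv ℝ k (ext f.1) (ω : E3)) +
        fun ω : S2 => iteratedFDeriv ℝ k (ext g.1) (ω : E3) := by
      funext ω; exact IsHolder.deriv_add f.2 g.2 le_rfl ω
    have h3 := Finset.sum_le_sum h1
    rw [Finset.sum_add_distrib] at h3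
    have h4 : (nnHolderNorm α (fun ω : S2 => iteratedFDeriv ℝ k (ext (f + g).1) (ω : E3)) : ℝ) ≤
        nnHolderNorm α (fun ω : S2 => iteratedFDeriv ℝ k (ext f.1) (ω : E3)) +
        nnHolderNorm α (fun ω : S2 => iteratedFDeriv ℝ k (ext g.1) (ω : E3)) := by
      rw [h2]; exact_mod_cast MemHolder.nnHolderNorm_add_le f.2.2 g.2.2
    rw [norm_def, norm_def, norm_def]
    linarith
  norm_eq_zero_iff f := by
    constructor
    · intro h
      apply toFun_injective
      funext ω
      have h0 : supDeriv 0 f.1 ≤ ‖f‖ := by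
        rw [norm_def]
        have := Finset.single_le_sum (f := fun j => supDeriv j f.1)
          (fun j _ => supDeriv_nonneg j f.1) (Finset.mem_range.2 (Nat.succ_pos k))
        have h5 := NNReal.coe_nonneg
          (nnHolderNorm α (fun ω : S2 => iteratedFDeriv ℝ k (ext f.1) (ω : E3)))
        linarith
      have h1 := (le_supDeriv f (Nat.zero_le k) ω).trans h0
      rw [h, norm_iteratedFDeriv_zero, ext_coe] at h1
      exact norm_le_zero_iff.1 h1
    · rintro rfl
      have h1 : ∀ j, iteratedFDeriv ℝ j (ext (0 : Holder k α).1) = 0 := by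
        intro j
        have : ext (0 : Holder k α).1 = 0 := ext_zero
        rw [this]; funext x; simp
      simp only [norm_def, supDeriv, h1]
      have : (fun ω : S2 => (0 : E3 → ContinuousMultilinearMap ℝ (fun _ : Fin k => E3) ℝ) ω) =
        0 := rfl
      rw [this]
      simp

instance : NormedAddCommGroup (Holder k α) := NormedAddCommGroup.ofCore core

instance : NormedSpace ℝ (Holder k α) := NormedSpace.ofCore core

end Holder

/-! ### Rotations -/

/-- The action of a linear isometry on the sphere. -/
def rotPoint (g : E3 ≃ₗᵢ[ℝ] E3) (ω : S2) : S2 := ⟨g ω, by simp⟩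

theorem ext_rot (g : E3 ≃ₗᵢ[ℝ] E3) (f : S2 → ℝ) :
    ext (fun ω => f (rotPoint g ω)) = ext f ∘ g := by
  funext x
  by_cases hx : x = 0
  · simp [ext, hx]
  · have hg : g x ≠ 0 := by simpa using hx
    rw [Function.comp, ext, ext, dif_pos hx, dif_pos hg]
    congr 1
    apply Subtype.ext
    simp [rotPoint, proj]

theorem IsHolder.rot {k : ℕ} {α : ℝ≥0} {f : S2 → ℝ} (hf : IsHolder k α f)
    (g : E3 ≃ₗᵢ[ℝ] E3) : IsHolder k α (fun ω => f (rotPoint g ω)) := by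
  refine ⟨?_, ?_⟩
  · rw [ext_rot]
    refine hf.1.comp g.contDiff.contDiffOn fun x hx => ?_
    simpa using hx
  · obtain ⟨C, hC⟩ := hf.2
    have hd : ∀ x, iteratedFDeriv ℝ k (ext f ∘ g) x =
        (iteratedFDeriv ℝ k (ext f) (g x)).compContinuousLinearMap
          fun _ => (g.toContinuousLinearEquiv : E3 →L[ℝ] E3) := by
      intro x
      have := g.toContinuousLinearEquiv.iteratedFDerivWithin_comp_right (ext f)
        (s := Set.univ) uniqueDiffOn_univ (Set.mem_univ _) (x := x) k
      simpa [iteratedFDerivWithin_univ] using this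
    refine ⟨C, fun ω ω' => ?_⟩
    have h := hC (rotPoint g ω) (rotPoint g ω')
    have he : edist (rotPoint g ω) (rotPoint g ω') = edist ω ω' :=
      g.isometry.edist_eq (ω : E3) (ω' : E3)
    rw [he] at h
    refine le_trans ?_ h
    simp only [ext_rot, hd]
    rw [edist_dist, edist_dist]
    refine ENNReal.ofReal_le_ofReal ?_
    rw [dist_eq_norm, dist_eq_norm]
    refine ContinuousMultilinearMap.opNorm_le_bound (norm_nonneg _) fun m => ?_
    refine le_trans (ContinuousMultilinearMap.le_opNorm
      (iteratedFDeriv ℝ k (ext f) (rotPoint g ω : E3) -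
        iteratedFDeriv ℝ k (ext f) (rotPoint g ω' : E3)) (fun i => g (m i))) ?_
    simp

/-- The rotation operator `u ↦ u ∘ g` on `C^{k,α}(S²)`. -/
def rot {k : ℕ} {α : ℝ≥0} (g : E3 ≃ₗᵢ[ℝ] E3) (u : Holder k α) : Holder k α :=
  ⟨fun ω => u (rotPoint g ω), IsHolder.rot u.2 g⟩

/-! ### The map `Φ` and spherical harmonics -/

/-- The open set `O = {(R, χ) : R > 0, inf χ > -R}`. -/
def domO (α : ℝ≥0) : Set (ℝ × Holder 2 α) := {p | 0 < p.1 ∧ -p.1 < ⨅ ω : S2, p.2 ω}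

open Classical in
/-- `Φ(R, χ) = R² (F(R + χ) - F(R))` as an element of `C^{0,α}(S²)`. The value `0` is used where
that function is not in `C^{0,α}(S²)`, which is relevant only outside the domain `O`. -/
def Phi (α : ℝ≥0) (R : ℝ) (χ : Holder 2 α) : Holder 0 α :=
  if h : IsHolder 0 α (PhiFun R χ) then ⟨PhiFun R χ, h⟩ else 0

/-- `D_χ Φ(R, 0)`, the Fréchet derivative of `Φ(R, ·) : C^{2,α}(S²) → C^{0,α}(S²)` at `0`. -/
def DPhi (α : ℝ≥0) (R : ℝ) : Holder 2 α →L[ℝ] Holder 0 α := fderiv ℝ (Phi α R) 0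

/-- `Y` is a spherical harmonic of degree `l`: the restriction to the sphere of a harmonic
homogeneous polynomial of degree `l`. -/
def IsSphericalHarmonic (l : ℕ) (Y : S2 → ℝ) : Prop :=
  ∃ p : MvPolynomial (Fin 3) ℝ, p.IsHomogeneous l ∧
    ∑ i : Fin 3, MvPolynomial.pderiv i (MvPolynomial.pderiv i p) = 0 ∧
    ∀ ω : S2, Y ω = MvPolynomial.eval (fun i => (ω : E3) i) p

end LiquidDrop

end

open LiquidDrop

noncomputable section

namespace LiquidDrop

open Set Filter Topology

open scoped Pointwise

/-! ### The surface measure -/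

/-! `F` is a sum of a local and a nonlocal term, and both are treated by proving a strict
(two-point) derivative of a scalar-valued map and then upgrading it to `C^{0,α}`.

The local term is `localPart (jet φ ω)`, where `localPart` is a `C¹` function of the value, gradient
and Hessian (`local_eq_localPart`). Applied to the jets at `ω` and `ω'`, its strict derivative at
`(R, 0, 0)` bounds the difference of the remainders by a small multiple of the difference of the
jets, which is Hölder in the distance.

For the potential, scaling by `φ ω` gives `φ(ω)² ∫ ∫₀^ψ r² / |ω - rω'| dr dω'` with `ψ = φ / φ(ω)`
(`integral_Omega_eq`). Near `r = 1` the integrand differs from `1 / |ω - ω'|` by at most a constant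
times `√δ |ω - ω'|^(-3/2)` (`abs_radial_sub_inv_le`), which is integrable on the sphere. Hence for
fixed `ω` the potential is strictly differentiable in the sup norm at constants. Regularity in `ω`
then needs no estimate of differentiated kernels. Rotation equivariance `N(gω, v) = N(ω, v ∘ g)`
makes all bounds uniform in `ω`, and with a rotation `g` carrying `ω` to `ω'` and moving every point
by `O(|ω - ω'|)` (`exists_rot`) a difference in `ω` becomes the difference `u ∘ g - u` at one point,
of size `O(‖u‖ |ω - ω'|^α)` (`abs_sub_le_of_equivariant`). The same device puts `Φ(R, χ)` in
`C^{0,α}` on the whole domain.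

For the eigenvalues, let `κ = (1 - 2rt + r²)^(-1/2)`. Invariance of the surface measure allows
integration by parts of angular derivatives, so for a harmonic homogeneous `p` the integral of `p κ`
satisfies an Euler equation in `r`. Regularity at `r = 0` leaves `(2l + 1) ∫ p κ = (1 - r²) ∫ p κ³`
(`integral_poisson`). As `r → 1` the right side is a Poisson integral tending to `4π p(ω)`, and the
left side tends to `2l + 1` times the single layer potential (`singleLayer_polyC`). The case `l = 0`
also supplies the constants `4π` and `4π/3` of the linearization. -/

theorem norm_coe (ω : S2) : ‖(ω : E3)‖ = 1 := norm_eq_of_mem_sphere ω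

theorem norm_smul_coe (r : ℝ) (ω : S2) : ‖r • (ω : E3)‖ = |r| := by
  rw [norm_smul, norm_coe, mul_one, Real.norm_eq_abs]

instance : IsFiniteMeasure surf := by unfold surf; infer_instance

theorem continuous_rotPoint (g : E3 ≃ₗᵢ[ℝ] E3) : Continuous (rotPoint g) :=
  (g.continuous.comp continuous_subtype_val).subtype_mk _

/-- The surface measure of a set is determined by the volume of the cone over it, and cones commute
with linear isometries, which preserve volume. -/
theorem measurePreserving_rotPoint (g : E3 ≃ₗᵢ[ℝ] E3) :
    MeasurePreserving (rotPoint g) surf surf := by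
  refine ⟨(continuous_rotPoint g).measurable, Measure.ext fun s hs => ?_⟩
  rw [Measure.map_apply (continuous_rotPoint g).measurable hs, surf,
    Measure.toSphere_apply' _ ((continuous_rotPoint g).measurable hs),
    Measure.toSphere_apply' _ hs]
  congr 1
  have h : Ioo (0 : ℝ) 1 • ((↑) '' (rotPoint g ⁻¹' s) : Set E3) =
      g ⁻¹' (Ioo (0 : ℝ) 1 • ((↑) '' s)) := by
    ext x
    simp only [Set.mem_smul, Set.mem_image, Set.mem_preimage]
    constructor
    · rintro ⟨r, hr, _, ⟨ω, hω, rfl⟩, rfl⟩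
      exact ⟨r, hr, _, ⟨_, hω, rfl⟩, by simp [rotPoint]⟩
    · rintro ⟨r, hr, _, ⟨ω, hω, rfl⟩, h⟩
      have hrot : rotPoint g (rotPoint g.symm ω) = ω := by
        apply Subtype.ext; simp [rotPoint]
      refine ⟨r, hr, _, ⟨rotPoint g.symm ω, ?_, rfl⟩, ?_⟩
      · rw [hrot]; exact hω
      · apply g.injective; rw [← h]; simp [rotPoint]
  rw [h]
  exact g.measurePreserving.measure_preimage_equiv (f := g.toMeasurableEquiv) _

theorem measurableEmbedding_rotPoint (g : E3 ≃ₗᵢ[ℝ] E3) : MeasurableEmbedding (rotPoint g) := by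
  have hinj : Function.Injective (rotPoint g) := fun x y h => by
    apply Subtype.ext
    exact g.injective (congrArg Subtype.val h)
  exact ((continuous_rotPoint g).isClosedEmbedding hinj).measurableEmbedding

theorem integral_rotPoint (g : E3 ≃ₗᵢ[ℝ] E3) (f : S2 → ℝ) :
    ∫ ω, f (rotPoint g ω) ∂surf = ∫ ω, f ω ∂surf :=
  (measurePreserving_rotPoint g).integral_comp (measurableEmbedding_rotPoint g) f

/-- The cone over a point lies in a line, which is a proper subspace and hence null. -/
theorem surf_singleton (ω : S2) : surf {ω} = 0 := by
  rw [surf, Measure.toSphere_apply' _ (measurableSet_singleton ω)]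
  have h : Ioo (0 : ℝ) 1 • ((↑) '' ({ω} : Set S2) : Set E3) ⊆
      ((ℝ ∙ (ω : E3) : Submodule ℝ E3) : Set E3) := by
    rintro x ⟨r, -, _, ⟨ω', rfl, rfl⟩, rfl⟩
    exact Submodule.smul_mem _ _ (Submodule.mem_span_singleton_self _)
  have h1 : (ℝ ∙ (ω : E3) : Submodule ℝ E3) ≠ ⊤ := by
    intro h
    have h2 := finrank_span_singleton (K := ℝ) (ne_zero ω)
    rw [h, finrank_top] at h2
    simp at h2
  rw [measure_mono_null h (Measure.addHaar_submodule _ _ h1), mul_zero]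

theorem ae_ne (ω : S2) : ∀ᵐ ω' ∂surf, ω' ≠ ω := by
  rw [ae_iff]
  simpa using surf_singleton ω

theorem surf_real_univ : surf.real univ = 4 * Real.pi := by
  rw [surf, Measure.toSphere_real_apply_univ, measureReal_def, EuclideanSpace.volume_ball_fin_three]
  rw [ENNReal.toReal_mul, ENNReal.toReal_ofReal (by positivity)]
  simp
  ring

/-! ### Polar coordinates -/

theorem polar_integrable_iff (f : E3 → ℝ) :
    Integrable f ↔ Integrable (fun p : S2 × Ioi (0 : ℝ) => f ((p.2 : ℝ) • (p.1 : E3)))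
      (surf.prod (Measure.volumeIoiPow 2)) := by
  have h := (volume : Measure E3).measurePreserving_homeomorphUnitSphereProd.symm
    (homeomorphUnitSphereProd E3).toMeasurableEquiv
  have h2 := h.integrable_comp_emb (g := fun x : ({0}ᶜ : Set E3) => f x)
    (homeomorphUnitSphereProd E3).toMeasurableEquiv.symm.measurableEmbedding
  have hd : Module.finrank ℝ E3 - 1 = 2 := by simp
  rw [hd] at h2
  have h3 : Integrable f ↔ Integrable (fun x : ({0}ᶜ : Set E3) => f x)
      (Measure.comap (↑) (volume : Measure E3)) := by
    conv_lhs => rw [← restrict_compl_singleton (μ := (volume : Measure E3)) 0]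
    rw [← IntegrableOn, integrableOn_iff_comap_subtypeVal (measurableSet_singleton _).compl]
    rfl
  rw [h3, ← h2]
  rfl

theorem polar_integral (f : E3 → ℝ) :
    ∫ x, f x = ∫ p : S2 × Ioi (0 : ℝ), f ((p.2 : ℝ) • (p.1 : E3))
      ∂(surf.prod (Measure.volumeIoiPow 2)) := by
  have h := (volume : Measure E3).measurePreserving_homeomorphUnitSphereProd.symm
    (homeomorphUnitSphereProd E3).toMeasurableEquiv
  have h2 := h.integral_comp
    (homeomorphUnitSphereProd E3).toMeasurableEquiv.symm.measurableEmbedding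
    (fun x : ({0}ᶜ : Set E3) => f x)
  have hd : Module.finrank ℝ E3 - 1 = 2 := by simp
  rw [hd] at h2
  have h3 : ∫ x, f x = ∫ x : ({0}ᶜ : Set E3), f x ∂(Measure.comap (↑) (volume : Measure E3)) := by
    rw [integral_subtype_comap (measurableSet_singleton _).compl f, restrict_compl_singleton]
  rw [h3, ← h2]
  rfl

theorem integrable_volumeIoiPow_iff (f : ℝ → ℝ) :
    Integrable (fun r : Ioi (0 : ℝ) => f r) (Measure.volumeIoiPow 2) ↔
      IntegrableOn (fun r => r ^ 2 * f r) (Ioi 0) := by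
  rw [Measure.volumeIoiPow, integrable_withDensity_iff_integrable_smul' (by fun_prop) (by simp),
    integrableOn_iff_comap_subtypeVal measurableSet_Ioi]
  refine integrable_congr (.of_forall fun r => ?_)
  simp [ENNReal.toReal_ofReal (sq_nonneg (r : ℝ))]

theorem integral_volumeIoiPow (f : ℝ → ℝ) :
    ∫ r : Ioi (0 : ℝ), f r ∂(Measure.volumeIoiPow 2) = ∫ r in Ioi (0 : ℝ), r ^ 2 * f r := by
  rw [Measure.volumeIoiPow, integral_withDensity_eq_integral_toReal_smul (by fun_prop) (by simp),
    ← integral_subtype_comap measurableSet_Ioi fun r => r ^ 2 * f r]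
  refine integral_congr_ae (.of_forall fun r => ?_)
  simp [ENNReal.toReal_ofReal (sq_nonneg (r : ℝ))]

theorem integrable_polar {f : E3 → ℝ} (hf : Integrable f) :
    Integrable (fun ω : S2 => ∫ r in Ioi (0 : ℝ), r ^ 2 * f (r • (ω : E3))) surf := by
  have h := ((polar_integrable_iff f).1 hf).integral_prod_left
  refine h.congr (.of_forall fun ω => ?_)
  exact integral_volumeIoiPow fun r => f (r • (ω : E3))

theorem integral_polar {f : E3 → ℝ} (hf : Integrable f) :
    ∫ x, f x = ∫ ω : S2, (∫ r in Ioi (0 : ℝ), r ^ 2 * f (r • (ω : E3))) ∂surf := by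
  rw [polar_integral, integral_prod _ ((polar_integrable_iff f).1 hf)]
  refine integral_congr_ae (.of_forall fun ω => ?_)
  exact integral_volumeIoiPow fun r => f (r • (ω : E3))

theorem ae_integrableOn_polar {f : E3 → ℝ} (hf : Integrable f) :
    ∀ᵐ ω : S2 ∂surf, IntegrableOn (fun r : ℝ => r ^ 2 * f (r • (ω : E3))) (Ioi 0) := by
  filter_upwards [((polar_integrable_iff f).1 hf).prod_right_ae] with ω hω
  exact (integrable_volumeIoiPow_iff fun r => f (r • (ω : E3))).1 hω

/-! ### Integrability of powers of the distance -/

/-- In polar coordinates this is the integrability of `r ^ (2 - s)` at `0`. -/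
theorem integrableOn_ball_norm_rpow {s : ℝ} (hs : s < 3) (ρ : ℝ) :
    IntegrableOn (fun x : E3 => ‖x‖ ^ (-s)) (Metric.ball 0 ρ) := by
  rw [integrableOn_fun_norm_addHaar volume (f := fun r : ℝ => r ^ (-s))]
  have h : IntegrableOn (fun r : ℝ => r ^ (2 - s)) (Ioo 0 ρ) :=
    (intervalIntegral.intervalIntegrable_rpow' (a := 0) (b := ρ)
      (r := 2 - s) (by linarith)).1.mono_set Ioo_subset_Ioc_self
  refine h.congr_fun (fun r hr => ?_) measurableSet_Ioo
  have hd : Module.finrank ℝ E3 - 1 = 2 := by simp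
  simp only [hd, smul_eq_mul]
  rw [sub_eq_add_neg, Real.rpow_add hr.1]
  norm_num

theorem integrableOn_ball_dist_rpow {s : ℝ} (hs : s < 3) (a : E3) (ρ : ℝ) :
    IntegrableOn (fun x : E3 => ‖a - x‖ ^ (-s)) (Metric.ball 0 ρ) := by
  have h := integrableOn_ball_norm_rpow hs (ρ + ‖a‖)
  have h2 : IntegrableOn (fun x : E3 => ‖a - x‖ ^ (-s)) (Metric.ball a (ρ + ‖a‖)) := by
    rw [← integrable_indicator_iff measurableSet_ball] at h ⊢
    have h3 := h.comp_sub_left a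
    refine h3.congr (.of_forall fun x => ?_)
    simp only [indicator, mem_ball_zero_iff, mem_ball_iff_norm, norm_sub_rev a x, sub_zero]
  refine h2.mono_set fun x hx => ?_
  rw [Metric.mem_ball, dist_eq_norm] at hx ⊢
  rw [sub_zero] at hx
  linarith [norm_sub_le x a]

theorem norm_sub_le_two (ω ω' : S2) : ‖(ω : E3) - ω'‖ ≤ 2 := by
  have := norm_sub_le (ω : E3) (ω' : E3)
  rw [norm_coe, norm_coe] at this
  linarith

theorem norm_sub_pos {ω ω' : S2} (h : ω' ≠ ω) : 0 < ‖(ω : E3) - ω'‖ :=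
  norm_pos_iff.2 (sub_ne_zero.2 fun h' => h (Subtype.ext h'.symm))

/-- Deduced from the integrability of `|ω - x| ^ (-5/2)` in space. On the ray through `ω'`, with `d
= |ω - ω'|`, the segment `1 < r ≤ 1 + d` stays within distance `2d` of `ω`, so it contributes at
least `d (2d) ^ (-5/2)`, a constant times `d ^ (-3/2)`. -/
theorem integrable_sphere_dist_rpow (ω : S2) :
    Integrable (fun ω' : S2 => ‖(ω : E3) - ω'‖ ^ (-(3 / 2) : ℝ)) surf := by
  -- Radius `4` contains every segment used, since `r ≤ 1 + d ≤ 3`.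
  have h0 : Integrable ((Metric.ball (0 : E3) 4).indicator
      fun x => ‖(ω : E3) - x‖ ^ (-(5 / 2) : ℝ)) := by
    rw [integrable_indicator_iff measurableSet_ball]
    exact integrableOn_ball_dist_rpow (by norm_num) _ _
  have h1 := (integrable_polar h0).const_mul ((2 : ℝ) ^ (5 / 2 : ℝ))
  refine h1.mono' ?_ ?_
  · have : Measurable (fun ω' : S2 => ‖(ω : E3) - ω'‖) := by fun_prop
    exact (this.pow_const _).aestronglyMeasurable
  filter_upwards [ae_ne ω, ae_integrableOn_polar h0] with ω' hω' hint
  set d := ‖(ω : E3) - ω'‖ with hd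
  have hd0 : 0 < d := norm_sub_pos hω'
  have hd2 : d ≤ 2 := norm_sub_le_two ω ω'
  rw [Real.norm_of_nonneg (by positivity)]
  have h2 : ∫ r in Ioc (1 : ℝ) (1 + d), (2 * d) ^ (-(5 / 2) : ℝ) ≤
      ∫ r in Ioi (0 : ℝ), r ^ 2 * (Metric.ball (0 : E3) 4).indicator
        (fun x => ‖(ω : E3) - x‖ ^ (-(5 / 2) : ℝ)) (r • (ω' : E3)) := by
    have hsub : Ioc (1 : ℝ) (1 + d) ⊆ Ioi 0 := fun r hr => by
      have := hr.1
      simp only [mem_Ioi]; linarith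
    refine le_trans (setIntegral_mono_on_ae (by simp) (hint.mono_set hsub)
      measurableSet_Ioc ?_) (setIntegral_mono_set hint ?_ (Eventually.of_forall hsub))
    -- The convention `0 ^ (-5/2) = 0` would spoil the lower bound where the ray meets `ω`, so these
    -- null parameters are excluded.
    · have hne : ∀ᵐ r : ℝ, r • (ω' : E3) ≠ ω := by
        have : {r : ℝ | ¬ r • (ω' : E3) ≠ ω} ⊆ {1, -1} := by
          intro r hr
          simp only [not_not, mem_ofPred_eq] at hr
          have h := norm_smul_coe r ω'
          rw [hr, norm_coe] at h
          rcases abs_eq (zero_le_one' ℝ) |>.1 h.symm with h | h <;> simp [h]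
        exact measure_mono_null this ((Set.toFinite _).measure_zero _)
      filter_upwards [hne] with r hne hr
      have hr0 : (0 : ℝ) < r := by linarith [hr.1]
      have hball : r • (ω' : E3) ∈ Metric.ball (0 : E3) 4 := by
        rw [mem_ball_zero_iff, norm_smul_coe, abs_of_pos hr0]
        linarith [hr.2]
      rw [indicator_of_mem hball]
      have hle : ‖(ω : E3) - r • (ω' : E3)‖ ≤ 2 * d := by
        have h3 : (ω : E3) - r • (ω' : E3) = ((ω : E3) - ω') + (1 - r) • (ω' : E3) := by
          module
        rw [h3]
        refine (norm_add_le _ _).trans ?_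
        rw [norm_smul_coe, abs_sub_comm, abs_of_nonneg (by linarith [hr.1])]
        linarith [hr.2]
      have hpos : 0 < ‖(ω : E3) - r • (ω' : E3)‖ := norm_pos_iff.2 (sub_ne_zero.2 hne.symm)
      have h4 := Real.rpow_le_rpow_of_nonpos hpos hle (show (-(5 / 2) : ℝ) ≤ 0 by norm_num)
      have h5 : 1 ≤ r ^ 2 := one_le_pow₀ hr.1.le
      have h6 : 0 ≤ ‖(ω : E3) - r • (ω' : E3)‖ ^ (-(5 / 2) : ℝ) := by positivity
      nlinarith
    · refine Eventually.of_forall fun r => ?_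
      simp only [Pi.zero_apply]
      exact mul_nonneg (sq_nonneg _) (indicator_nonneg (fun _ _ => by positivity) _)
  rw [setIntegral_const] at h2
  have h3 : volume.real (Ioc (1 : ℝ) (1 + d)) = d := by
    simp [hd0.le]
  rw [h3, smul_eq_mul] at h2
  have h4 : d ^ (-(3 / 2) : ℝ) = 2 ^ (5 / 2 : ℝ) * (d * (2 * d) ^ (-(5 / 2) : ℝ)) := by
    rw [Real.mul_rpow (by norm_num) hd0.le]
    have e1 : (2 : ℝ) ^ (5 / 2 : ℝ) * 2 ^ (-(5 / 2) : ℝ) = 1 := by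
      rw [← Real.rpow_add (by norm_num)]; norm_num
    have e2 : d * d ^ (-(5 / 2) : ℝ) = d ^ (-(3 / 2) : ℝ) := by
      nth_rewrite 1 [← Real.rpow_one d]
      rw [← Real.rpow_add hd0]; norm_num
    calc d ^ (-(3 / 2) : ℝ) = (2 ^ (5 / 2 : ℝ) * 2 ^ (-(5 / 2) : ℝ)) * (d * d ^ (-(5 / 2) : ℝ)) := by
          rw [e1, e2, one_mul]
      _ = _ := by ring
  rw [h4]
  exact mul_le_mul_of_nonneg_left h2 (by positivity)

theorem inv_le_rpow {d : ℝ} (h0 : 0 < d) (h2 : d ≤ 2) : d⁻¹ ≤ 2 * d ^ (-(3 / 2) : ℝ) := by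
  have h : d ^ (1 / 2 : ℝ) ≤ 2 :=
    calc d ^ (1 / 2 : ℝ) ≤ 2 ^ (1 / 2 : ℝ) := Real.rpow_le_rpow h0.le h2 (by norm_num)
      _ ≤ 2 ^ (1 : ℝ) := Real.rpow_le_rpow_of_exponent_le (by norm_num) (by norm_num)
      _ = 2 := Real.rpow_one 2
  have h3 : d⁻¹ = d ^ (1 / 2 : ℝ) * d ^ (-(3 / 2) : ℝ) := by
    rw [← Real.rpow_add h0, ← Real.rpow_neg_one]; norm_num
  rw [h3]
  exact mul_le_mul_of_nonneg_right h (by positivity)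

theorem integrable_sphere_inv_dist (ω : S2) :
    Integrable (fun ω' : S2 => ‖(ω : E3) - ω'‖⁻¹) surf := by
  refine ((integrable_sphere_dist_rpow ω).const_mul 2).mono' ?_ ?_
  · have : Measurable (fun ω' : S2 => ‖(ω : E3) - ω'‖) := by fun_prop
    exact this.inv.aestronglyMeasurable
  · filter_upwards [ae_ne ω] with ω' hω'
    rw [Real.norm_of_nonneg (by positivity)]
    exact inv_le_rpow (norm_sub_pos hω') (norm_sub_le_two ω ω')

/-! ### Rotations moving one point to another -/

/-- The reflection in the line of `ω` fixes `ω`, and the reflection in the line of `m = ω + ω'`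
takes `ω` to `ω'`; take their product. With `n = m / |m|`, the two reflections of a unit vector
differ by at most `4 |n - ω|`, and `|n - ω| ≤ |ω - ω'|`. This uniform displacement bound converts
Hölder continuity of `u` into Hölder continuity in `ω` of equivariant functionals. -/
theorem exists_rot (ω ω' : S2) : ∃ g : E3 ≃ₗᵢ[ℝ] E3, rotPoint g ω = ω' ∧
    ∀ x : S2, dist (rotPoint g x) x ≤ 4 * dist ω ω' := by
  -- For antipodal points `m` vanishes; the antipodal map serves, and it moves every point by
  -- exactly `2 = |ω - ω'|`.
  by_cases hm : (ω : E3) + ω' = 0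
  · have h' : (ω' : E3) = -ω := (neg_eq_of_add_eq_zero_right hm).symm
    refine ⟨LinearIsometryEquiv.neg ℝ, Subtype.ext (by simp [rotPoint, h']), fun x => ?_⟩
    rw [Subtype.dist_eq, Subtype.dist_eq, dist_eq_norm, dist_eq_norm, h']
    have h1 : ∀ y : S2, ‖(y : E3) - -(y : E3)‖ = 2 := fun y => by
      rw [sub_neg_eq_add, ← two_smul ℝ, norm_smul_coe]; norm_num
    have h2 : ‖((rotPoint (LinearIsometryEquiv.neg ℝ) x : S2) : E3) - x‖ = 2 := by
      rw [norm_sub_rev]; exact h1 x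
    rw [h2, h1]; norm_num
  · set m : E3 := (ω : E3) + ω' with hmdef
    have hm0 : 0 < ‖m‖ := norm_pos_iff.2 hm
    have hin : inner ℝ m (ω : E3) = ‖m‖ ^ 2 / 2 := by
      have e1 : inner ℝ m (ω : E3) = 1 + inner ℝ (ω' : E3) (ω : E3) := by
        rw [hmdef, inner_add_left, real_inner_self_eq_norm_sq, norm_coe]; norm_num
      have e2 := norm_add_sq_real (ω : E3) (ω' : E3)
      rw [norm_coe, norm_coe, real_inner_comm] at e2
      rw [e1, hmdef, e2]; ring
    refine ⟨((ℝ ∙ (ω : E3)).reflection).trans (ℝ ∙ m).reflection, ?_, fun x => ?_⟩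
    · apply Subtype.ext
      have h1 : (ℝ ∙ (ω : E3)).reflection (ω : E3) = ω :=
        Submodule.reflection_mem_subspace_eq_self (Submodule.mem_span_singleton_self _)
      change (ℝ ∙ m).reflection ((ℝ ∙ (ω : E3)).reflection (ω : E3)) = ω'
      rw [h1, Submodule.reflection_singleton_apply, hin]
      have h2 : ‖m‖ ^ 2 / 2 / (‖m‖ : ℝ) ^ 2 = 1 / 2 := by field_simp
      simp only [RCLike.ofReal_real_eq_id, id]
      rw [h2, hmdef]
      module
    · rw [Subtype.dist_eq, Subtype.dist_eq, dist_eq_norm, dist_eq_norm]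
      set y : E3 := (ℝ ∙ (ω : E3)).reflection (x : E3) with hy
      have hyn : ‖y‖ = 1 := by rw [hy, LinearIsometryEquiv.norm_map, norm_coe]
      have hx : (ℝ ∙ (ω : E3)).reflection y = x := Submodule.reflection_reflection _ _
      change ‖(ℝ ∙ m).reflection y - (x : E3)‖ ≤ _
      rw [← hx]
      set n : E3 := ‖m‖⁻¹ • m with hn
      have hnn : ‖n‖ = 1 := by rw [hn, norm_smul, norm_inv, norm_norm]; field_simp
      have e1 : (ℝ ∙ m).reflection y - (ℝ ∙ (ω : E3)).reflection y =
          (2 * inner ℝ n y) • (n - ω) + (2 * inner ℝ (n - ω) y) • (ω : E3) := by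
        rw [Submodule.reflection_singleton_apply, Submodule.reflection_singleton_apply]
        simp only [RCLike.ofReal_real_eq_id, id, norm_coe]
        have e2 : (inner ℝ m y / ‖m‖ ^ 2) • m = inner ℝ n y • n := by
          rw [hn, inner_smul_left, smul_smul]
          congr 1
          simp
          field_simp
        rw [e2, inner_sub_left]
        module
      have e3 : ‖n - ω‖ ≤ ‖(ω : E3) - ω'‖ := by
        have f1 : n - ω = (1 - ‖m‖ / 2) • n - (1 / 2 : ℝ) • ((ω : E3) - ω') := by
          have : (‖m‖ / 2) • n = (1 / 2 : ℝ) • m := by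
            rw [hn, smul_smul]; congr 1; field_simp
          rw [sub_smul, this, hmdef]; module
        have f2 : |1 - ‖m‖ / 2| ≤ ‖(ω : E3) - ω'‖ / 2 := by
          have g1 : m = (2 : ℝ) • (ω : E3) - ((ω : E3) - ω') := by rw [hmdef]; module
          have g2 : ‖m‖ ≤ 2 := by
            refine (norm_add_le _ _).trans ?_
            rw [norm_coe, norm_coe]; norm_num
          have g3 : 2 - ‖(ω : E3) - ω'‖ ≤ ‖m‖ := by
            have := norm_sub_norm_le ((2 : ℝ) • (ω : E3)) ((ω : E3) - ω')
            rw [← g1, norm_smul_coe] at this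
            norm_num at this
            linarith
          rw [abs_le]; constructor <;> linarith
        rw [f1]
        refine (norm_sub_le _ _).trans ?_
        rw [norm_smul _ n, hnn, norm_smul]
        norm_num
        linarith
      rw [e1]
      refine (norm_add_le _ _).trans ?_
      rw [norm_smul, norm_smul, norm_coe]
      have i1 : |inner ℝ n y| ≤ 1 := by
        simpa [hnn, hyn] using abs_real_inner_le_norm n y
      have i2 : |inner ℝ (n - (ω : E3)) y| ≤ ‖n - ω‖ := by
        simpa [hyn] using abs_real_inner_le_norm (n - (ω : E3)) y
      simp only [Real.norm_eq_abs, abs_mul, abs_two]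
      nlinarith [norm_nonneg (n - (ω : E3))]

/-! ### The Newtonian potential of a star-shaped set -/

theorem ext_smul_coe {V : Type*} [Zero V] (f : S2 → V) {r : ℝ} (hr : 0 < r) (ω : S2) :
    ext f (r • (ω : E3)) = f ω := by
  have h : r • (ω : E3) ≠ 0 := smul_ne_zero hr.ne' (ne_zero ω)
  rw [ext, dif_pos h]
  congr 1
  apply Subtype.ext
  simp only [proj, norm_smul_coe, abs_of_pos hr, smul_smul, inv_mul_cancel₀ hr.ne', one_smul]

theorem continuousOn_ext {V : Type*} [Zero V] [TopologicalSpace V] {f : S2 → V}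
    (hf : Continuous f) : ContinuousOn (ext f) {0}ᶜ := by
  rw [continuousOn_iff_continuous_domRestrict]
  have h : ({0}ᶜ : Set E3).domRestrict (ext f) = fun x : ({0}ᶜ : Set E3) => f (proj x x.2) := by
    funext x
    exact dif_pos x.2
  rw [h]
  refine hf.comp (Continuous.subtype_mk ?_ _)
  exact (continuous_subtype_val.norm.inv₀ fun x => norm_ne_zero_iff.2 x.2).smul
    continuous_subtype_val

theorem measurableSet_Omega {φ : S2 → ℝ} (hφ : Continuous φ) : MeasurableSet (Omega φ) := by
  have h : IsOpen ({0}ᶜ ∩ {x : E3 | ‖x‖ < ext φ x}) := by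
    have := ((continuousOn_ext hφ).sub continuous_norm.continuousOn).isOpen_inter_preimage
      isOpen_compl_singleton (isOpen_Ioi (a := (0 : ℝ)))
    convert this using 2
    ext x
    simp
  have h2 : Omega φ = {0} ∪ ({0}ᶜ ∩ {x : E3 | ‖x‖ < ext φ x}) := by
    ext x
    by_cases hx : x = 0 <;> simp [Omega, hx]
  rw [h2]
  exact (measurableSet_singleton _).union h.measurableSet

theorem smul_mem_Omega_iff (φ : S2 → ℝ) {r : ℝ} (hr : 0 < r) (ω : S2) :
    r • (ω : E3) ∈ Omega φ ↔ r < φ ω := by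
  have h : r • (ω : E3) ≠ 0 := smul_ne_zero hr.ne' (ne_zero ω)
  simp only [Omega, mem_ofPred_eq, h, false_or, norm_smul_coe, abs_of_pos hr, ext_smul_coe φ hr]

theorem Omega_subset_ball {φ : S2 → ℝ} {M : ℝ} (hM : 0 < M) (h : ∀ ω, φ ω ≤ M) :
    Omega φ ⊆ Metric.ball 0 M := by
  intro x hx
  rw [mem_ball_zero_iff]
  rcases eq_or_ne x 0 with rfl | hx0
  · simpa using hM
  · rcases hx with hx | hx
    · exact absurd hx hx0
    · rw [ext, dif_pos hx0] at hx
      exact hx.trans_le (h _)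

/-- `∫₀ᵇ r² / |ω - rω'| dr`. -/
def radialKernel (ω ω' : S2) (b : ℝ) : ℝ :=
  ∫ r in (0 : ℝ)..b, r ^ 2 / ‖(ω : E3) - r • (ω' : E3)‖

/-- The potential `∫_{Ω_ψ} dy / |ω - y|` in polar coordinates. -/
def starPotential (ω : S2) (ψ : C(S2, ℝ)) : ℝ := ∫ ω', radialKernel ω ω' (ψ ω') ∂surf

theorem integrable_indicator_Omega (a : E3) (φ : C(S2, ℝ)) :
    Integrable ((Omega φ).indicator fun y => 1 / ‖a - y‖) := by
  rw [integrable_indicator_iff (measurableSet_Omega φ.continuous)]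
  have h := integrableOn_ball_dist_rpow (s := 1) (by norm_num) a (‖φ‖ + 1)
  refine (h.mono_set (Omega_subset_ball (by positivity) fun ω => ?_)).congr
    (.of_forall fun x => ?_)
  · have := (le_abs_self _).trans (φ.norm_coe_le_norm ω)
    linarith
  · simp only [Real.rpow_neg_one, one_div]

/-- Substitute `r ↦ a r`: the measure `r² dr` scales by `a³` and the kernel by `a⁻¹`. -/
theorem integral_ray_Omega {φ : S2 → ℝ} (hφ : ∀ ω, 0 < φ ω) {a : ℝ} (ha : 0 < a) (ω ω' : S2) :
    ∫ r in Ioi (0 : ℝ), r ^ 2 * (Omega φ).indicator (fun y => 1 / ‖a • (ω : E3) - y‖)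
      (r • (ω' : E3)) = a ^ 2 * radialKernel ω ω' (a⁻¹ * φ ω') := by
  have h1 : ∫ r in Ioi (0 : ℝ), r ^ 2 * (Omega φ).indicator (fun y => 1 / ‖a • (ω : E3) - y‖)
      (r • (ω' : E3)) = ∫ r in Ioi (0 : ℝ), (Ioo 0 (φ ω')).indicator
        (fun r => r ^ 2 / ‖a • (ω : E3) - r • (ω' : E3)‖) r := by
    refine setIntegral_congr_fun measurableSet_Ioi fun r (hr : 0 < r) => ?_
    by_cases h : r < φ ω'
    · simp only [indicator_of_mem ((smul_mem_Omega_iff φ hr ω').2 h),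
        indicator_of_mem (show r ∈ Ioo 0 (φ ω') from ⟨hr, h⟩)]
      ring
    · simp only [indicator_of_notMem (fun h' => h ((smul_mem_Omega_iff φ hr ω').1 h')),
        indicator_of_notMem (fun h' : r ∈ Ioo 0 (φ ω') => h h'.2), mul_zero]
  rw [h1, setIntegral_indicator measurableSet_Ioo,
    inter_eq_self_of_subset_right (fun r hr => hr.1), ← integral_Ioc_eq_integral_Ioo,
    ← intervalIntegral.integral_of_le (hφ ω').le, radialKernel]
  have h2 := intervalIntegral.integral_comp_mul_left (a := 0) (b := a⁻¹ * φ ω')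
    (fun r => r ^ 2 / ‖a • (ω : E3) - r • (ω' : E3)‖) ha.ne'
  rw [mul_zero, mul_inv_cancel_left₀ ha.ne', smul_eq_mul, eq_comm, inv_mul_eq_iff_eq_mul₀ ha.ne']
    at h2
  rw [h2, ← intervalIntegral.integral_const_mul, ← intervalIntegral.integral_const_mul]
  refine intervalIntegral.integral_congr fun r _ => ?_
  have h3 : a • (ω : E3) - (a * r) • (ω' : E3) = a • ((ω : E3) - r • (ω' : E3)) := by module
  simp only [h3, norm_smul, Real.norm_of_nonneg ha.le]
  rcases eq_or_ne ‖(ω : E3) - r • (ω' : E3)‖ 0 with h | h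
  · simp [h]
  · field_simp

/-- Normalizing by `φ ω` pins the singularity at the fixed point `ω` of the unit sphere, so the
moving evaluation point `φ(ω)ω` enters only through the scalar `φ ω`. -/
theorem integral_Omega_eq (ω : S2) {φ : C(S2, ℝ)} (hφ : ∀ ω, 0 < φ ω) :
    ∫ y in Omega φ, 1 / ‖φ ω • (ω : E3) - y‖ =
      φ ω ^ 2 * starPotential ω ((φ ω)⁻¹ • φ) := by
  rw [← integral_indicator (measurableSet_Omega φ.continuous),
    integral_polar (integrable_indicator_Omega _ φ), starPotential, ← integral_const_mul]
  refine integral_congr_ae (.of_forall fun ω' => ?_)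
  exact integral_ray_Omega hφ (hφ ω) ω ω'

theorem integrable_radialKernel (ω : S2) {ψ : C(S2, ℝ)} (hψ : ∀ ω, 0 < ψ ω) :
    Integrable (fun ω' => radialKernel ω ω' (ψ ω')) surf := by
  refine (integrable_polar (integrable_indicator_Omega (ω : E3) ψ)).congr (.of_forall fun ω' => ?_)
  have := integral_ray_Omega hψ one_pos ω ω'
  simpa using this

/-- Both `|r - 1|` and `r |ω - ω'| - |r - 1|` are bounded by `|ω - rω'|`; add them. The kernel on a
whole ray is thereby controlled by `1 / |ω - ω'|`. -/
theorem half_mul_dist_le {r : ℝ} (hr : 0 ≤ r) (ω ω' : S2) :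
    r / 2 * ‖(ω : E3) - ω'‖ ≤ ‖(ω : E3) - r • (ω' : E3)‖ := by
  have h1 : r • ((ω : E3) - ω') = ((ω : E3) - r • (ω' : E3)) + (r - 1) • (ω : E3) := by module
  have h2 : |r - 1| ≤ ‖(ω : E3) - r • (ω' : E3)‖ := by
    have := abs_norm_sub_norm_le (r • (ω' : E3)) (ω : E3)
    rwa [norm_smul_coe, norm_coe, abs_of_nonneg hr, norm_sub_rev] at this
  have h3 := norm_add_le ((ω : E3) - r • (ω' : E3)) ((r - 1) • (ω : E3))
  rw [← h1, norm_smul_coe, norm_smul, Real.norm_of_nonneg hr] at h3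
  linarith

theorem norm_sub_smul_pos {ω ω' : S2} (h : ω' ≠ ω) {r : ℝ} (hr : 0 ≤ r) :
    0 < ‖(ω : E3) - r • (ω' : E3)‖ := by
  rcases hr.eq_or_lt with rfl | hr
  · simp [norm_coe]
  · have := half_mul_dist_le hr.le ω ω'
    have h2 := norm_sub_pos h
    exact lt_of_lt_of_le (by positivity) this

theorem intervalIntegrable_radial {ω ω' : S2} (h : ω' ≠ ω) {a b : ℝ} (ha : 0 ≤ a) (hb : 0 ≤ b) :
    IntervalIntegrable (fun r => r ^ 2 / ‖(ω : E3) - r • (ω' : E3)‖) volume a b := by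
  refine ContinuousOn.intervalIntegrable fun r hr => ?_
  have hr0 : 0 ≤ r := (le_min ha hb).trans hr.1
  refine ContinuousAt.continuousWithinAt (ContinuousAt.div (by fun_prop) (by fun_prop) ?_)
  exact (norm_sub_smul_pos h hr0).ne'

theorem radialKernel_sub {ω ω' : S2} (h : ω' ≠ ω) {a b : ℝ} (ha : 0 ≤ a) (hb : 0 ≤ b) :
    radialKernel ω ω' b - radialKernel ω ω' a =
      ∫ r in a..b, r ^ 2 / ‖(ω : E3) - r • (ω' : E3)‖ :=
  intervalIntegral.integral_interval_sub_left (intervalIntegrable_radial h le_rfl hb)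
    (intervalIntegrable_radial h le_rfl ha)

theorem abs_radialKernel_sub_le {ω ω' : S2} (h : ω' ≠ ω) {a b M : ℝ} (ha : 0 ≤ a) (hb : 0 ≤ b)
    (haM : a ≤ M) (hbM : b ≤ M) : |radialKernel ω ω' b - radialKernel ω ω' a| ≤
      2 * M * ‖(ω : E3) - ω'‖⁻¹ * |b - a| := by
  rw [radialKernel_sub h ha hb, ← Real.norm_eq_abs]
  refine intervalIntegral.norm_integral_le_of_norm_le_const fun r hr => ?_
  have hr0 : 0 < r := (le_min ha hb).trans_lt hr.1
  have hrM : r ≤ M := hr.2.trans (max_le haM hbM)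
  have hd := norm_sub_pos h
  rw [Real.norm_of_nonneg (by positivity), div_le_iff₀ (norm_sub_smul_pos h hr0.le)]
  calc r ^ 2 = 2 * r * ‖(ω : E3) - ω'‖⁻¹ * (r / 2 * ‖(ω : E3) - ω'‖) := by field_simp
    _ ≤ 2 * M * ‖(ω : E3) - ω'‖⁻¹ * ‖(ω : E3) - r • (ω' : E3)‖ := by
      have hM : 0 ≤ M := hr0.le.trans hrM
      gcongr
      exact half_mul_dist_le hr0.le ω ω'

/-- The total mass of `1 / |ω - ω'|` on the sphere. -/
def coulombMass (ω : S2) : ℝ := ∫ ω' : S2, ‖(ω : E3) - ω'‖⁻¹ ∂surf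

/-- A bound valid without closeness to the ball. It is used for arbitrary admissible `χ`, where only
membership of `Φ(R, χ)` in `C^{0,α}` is at stake. -/
theorem abs_starPotential_sub_le (ω : S2) {ψ₁ ψ₂ : C(S2, ℝ)} {M : ℝ} (h₁ : ∀ ω, 0 < ψ₁ ω)
    (h₂ : ∀ ω, 0 < ψ₂ ω) (hM₁ : ∀ ω, ψ₁ ω ≤ M) (hM₂ : ∀ ω, ψ₂ ω ≤ M) :
    |starPotential ω ψ₁ - starPotential ω ψ₂| ≤ 2 * M * coulombMass ω * ‖ψ₁ - ψ₂‖ := by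
  rw [starPotential, starPotential, ← integral_sub (integrable_radialKernel ω h₁)
    (integrable_radialKernel ω h₂), ← Real.norm_eq_abs]
  have hint : Integrable (fun ω' : S2 => 2 * M * ‖(ω : E3) - ω'‖⁻¹ * ‖ψ₁ - ψ₂‖) surf :=
    ((integrable_sphere_inv_dist ω).const_mul _).mul_const _
  refine (norm_integral_le_of_norm_le hint ?_).trans_eq ?_
  · filter_upwards [ae_ne ω] with ω' hω'
    refine (abs_radialKernel_sub_le hω' (h₂ ω').le (h₁ ω').le (hM₂ ω') (hM₁ ω')).trans ?_
    have hM : 0 ≤ M := (h₁ ω').le.trans (hM₁ ω')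
    refine mul_le_mul_of_nonneg_left ?_ (by positivity)
    exact (ψ₁ - ψ₂).norm_coe_le_norm ω'
  · rw [integral_mul_const, integral_const_mul, coulombMass]

/-- Here `d = |ω - ω'|` and `D = |ω - rω'|`. The naive bound `|D - d| / (D d) ≤ δ / (D d)` is of
order `d⁻²`, which is not integrable on a surface. Interpolating `|D - d|` between `δ` and `4D`
gives up half of the power of `δ` and leaves `d ^ (-3/2)`, which is integrable. -/
theorem abs_radial_sub_inv_le {r d D δ : ℝ} (hd : 0 < d) (hd2 : d ≤ 2) (hδ : δ ≤ 1 / 2)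
    (hr : |r - 1| ≤ δ) (hD : r / 2 * d ≤ D) (hDd : |D - d| ≤ |r - 1|) :
    |r ^ 2 / D - d⁻¹| ≤ 24 * √δ * d ^ (-(3 / 2) : ℝ) := by
  have hδ0 : 0 ≤ δ := (abs_nonneg _).trans hr
  have hr1 := abs_le.1 (hr.trans hδ)
  have hD4 : d ≤ 4 * D := by nlinarith
  have hD0 : 0 < D := by linarith
  have hδs : δ ≤ √δ := by
    apply Real.le_sqrt_of_sq_le; nlinarith
  have e : d ^ (-(3 / 2) : ℝ) = d⁻¹ * (√d)⁻¹ := by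
    rw [Real.sqrt_eq_rpow, ← Real.rpow_neg_one, ← Real.rpow_neg hd.le, ← Real.rpow_add hd]
    norm_num
  have h1 : |r ^ 2 / D - 1 / D| ≤ 20 * √δ * d ^ (-(3 / 2) : ℝ) := by
    have f1 : |r ^ 2 / D - 1 / D| = |r - 1| * |r + 1| / D := by
      rw [← sub_div, abs_div, abs_of_pos hD0, ← abs_mul]; congr 2; ring
    have f2 : |r + 1| ≤ 5 / 2 := abs_le.2 ⟨by linarith, by linarith⟩
    have f3 : D⁻¹ ≤ 4 * d⁻¹ := by
      rw [inv_le_iff_one_le_mul₀ hD0]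
      calc (1 : ℝ) = d⁻¹ * d := (inv_mul_cancel₀ hd.ne').symm
        _ ≤ d⁻¹ * (4 * D) := by gcongr
        _ = _ := by ring
    rw [f1, div_eq_mul_inv]
    calc |r - 1| * |r + 1| * D⁻¹ ≤ √δ * (5 / 2) * (4 * (2 * d ^ (-(3 / 2) : ℝ))) := by
          gcongr
          · exact hr.trans hδs
          · exact f3.trans (by gcongr; exact inv_le_rpow hd hd2)
      _ = _ := by ring
  have h2 : |1 / D - d⁻¹| ≤ 4 * √δ * d ^ (-(3 / 2) : ℝ) := by
    have f1 : |1 / D - d⁻¹| = |D - d| * (D⁻¹ * d⁻¹) := by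
      have : 1 / D - d⁻¹ = -(D - d) * (D⁻¹ * d⁻¹) := by field_simp; ring
      rw [this, abs_mul, abs_neg, abs_of_pos (show 0 < D⁻¹ * d⁻¹ by positivity)]
    have f2 : |D - d| ≤ √δ * (2 * √D) := by
      -- Together with `|D - d| ≤ δ` this gives the geometric mean bound `|D - d| ≤ √(4 δ D)`.
      have g1 : |D - d| ≤ 4 * D := abs_le.2 ⟨by linarith, by linarith⟩
      have g2 : |D - d| ≤ √(δ * (4 * D)) := by
        apply Real.le_sqrt_of_sq_le
        rw [sq]
        exact mul_le_mul (hDd.trans hr) g1 (abs_nonneg _) hδ0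
      rw [Real.sqrt_mul hδ0, Real.sqrt_mul (by norm_num)] at g2
      have : √(4 : ℝ) = 2 := by
        rw [show (4 : ℝ) = 2 ^ 2 by norm_num]; exact Real.sqrt_sq (by norm_num)
      rwa [this] at g2
    have f3 : √D * D⁻¹ ≤ 2 * (√d)⁻¹ := by
      have g1 : √d ≤ 2 * √D := by
        have := Real.sqrt_le_sqrt hD4
        rw [Real.sqrt_mul (by norm_num), show (4 : ℝ) = 2 ^ 2 by norm_num,
          Real.sqrt_sq (by norm_num)] at this
        exact this
      have g2 : √D * D⁻¹ = (√D)⁻¹ := by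
        have := Real.sqrt_pos.2 hD0
        have h3 := Real.mul_self_sqrt hD0.le
        field_simp
        nlinarith
      rw [g2]
      have := Real.sqrt_pos.2 hD0
      have := Real.sqrt_pos.2 hd
      rw [inv_le_iff_one_le_mul₀ (by positivity)]
      field_simp
      linarith
    rw [f1, e]
    calc |D - d| * (D⁻¹ * d⁻¹) ≤ √δ * (2 * √D) * (D⁻¹ * d⁻¹) := by gcongr
      _ = 2 * √δ * d⁻¹ * (√D * D⁻¹) := by ring
      _ ≤ 2 * √δ * d⁻¹ * (2 * (√d)⁻¹) := by gcongr
      _ = _ := by ring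
  calc |r ^ 2 / D - d⁻¹| ≤ |r ^ 2 / D - 1 / D| + |1 / D - d⁻¹| := abs_sub_le _ _ _
    _ ≤ _ := by linarith

theorem abs_radialKernel_sub_sub_le {ω ω' : S2} (h : ω' ≠ ω) {a b δ : ℝ} (hδ : δ ≤ 1 / 2)
    (ha : |a - 1| ≤ δ) (hb : |b - 1| ≤ δ) :
    |radialKernel ω ω' b - radialKernel ω ω' a - (b - a) * ‖(ω : E3) - ω'‖⁻¹| ≤
      24 * √δ * ‖(ω : E3) - ω'‖ ^ (-(3 / 2) : ℝ) * |b - a| := by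
  have ha' := abs_le.1 ha
  have hb' := abs_le.1 hb
  have ha0 : 0 ≤ a := by linarith
  have hb0 : 0 ≤ b := by linarith
  have e : (b - a) * ‖(ω : E3) - ω'‖⁻¹ = ∫ _ in a..b, ‖(ω : E3) - ω'‖⁻¹ := by simp
  rw [radialKernel_sub h ha0 hb0, e, ← intervalIntegral.integral_sub
    (intervalIntegrable_radial h ha0 hb0) (by simp), ← Real.norm_eq_abs]
  refine intervalIntegral.norm_integral_le_of_norm_le_const fun r hr => ?_
  have hr1 : |r - 1| ≤ δ := by
    have h1 : a ⊓ b < r := hr.1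
    have h2 : r ≤ a ⊔ b := hr.2
    rw [abs_le]
    constructor
    · rcases min_lt_iff.1 h1 with h | h <;> linarith
    · rcases le_max_iff.1 h2 with h | h <;> linarith
  have hr0 : 0 ≤ r := by linarith [(abs_le.1 hr1).1]
  refine abs_radial_sub_inv_le (norm_sub_pos h) (norm_sub_le_two ω ω') hδ hr1
    (half_mul_dist_le hr0 ω ω') ?_
  refine (abs_norm_sub_norm_le _ _).trans_eq ?_
  have : (ω : E3) - r • (ω' : E3) - ((ω : E3) - ω') = (1 - r) • (ω' : E3) := by module
  rw [this, norm_smul_coe, abs_sub_comm]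

theorem integrable_div_dist (ω : S2) (u : C(S2, ℝ)) :
    Integrable (fun ω' : S2 => u ω' / ‖(ω : E3) - ω'‖) surf := by
  simp only [div_eq_mul_inv]
  exact (integrable_sphere_inv_dist ω).bdd_mul u.continuous.aestronglyMeasurable
    (.of_forall fun ω' => u.norm_coe_le_norm ω')

/-- The single layer potential `u ↦ ∫ u(ω') / |ω - ω'| dω'` at the point `ω`. -/
def singleLayer (ω : S2) : C(S2, ℝ) →L[ℝ] ℝ :=
  LinearMap.mkContinuous
    { toFun := fun u => ∫ ω' : S2, u ω' / ‖(ω : E3) - ω'‖ ∂surf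
      map_add' := fun u v => by
        rw [← integral_add (integrable_div_dist ω u) (integrable_div_dist ω v)]
        simp [add_div]
      map_smul' := fun c u => by
        rw [RingHom.id_apply, smul_eq_mul, ← integral_const_mul]
        simp [mul_div_assoc] }
    (coulombMass ω) fun u => by
      have hint := (integrable_sphere_inv_dist ω).mul_const ‖u‖
      refine (norm_integral_le_of_norm_le hint (.of_forall fun ω' => ?_)).trans_eq ?_
      · rw [norm_div, norm_norm, div_eq_mul_inv, mul_comm]
        gcongr
        exact u.norm_coe_le_norm ω'
      · rw [integral_mul_const, coulombMass]

theorem singleLayer_apply (ω : S2) (u : C(S2, ℝ)) :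
    singleLayer ω u = ∫ ω' : S2, u ω' / ‖(ω : E3) - ω'‖ ∂surf := rfl

theorem abs_starPotential_sub_sub_le (ω : S2) {ψ₁ ψ₂ : C(S2, ℝ)} {δ : ℝ} (hδ : δ ≤ 1 / 2)
    (h₁ : ‖ψ₁ - 1‖ ≤ δ) (h₂ : ‖ψ₂ - 1‖ ≤ δ) :
    |starPotential ω ψ₁ - starPotential ω ψ₂ - singleLayer ω (ψ₁ - ψ₂)| ≤
      24 * √δ * (∫ ω' : S2, ‖(ω : E3) - ω'‖ ^ (-(3 / 2) : ℝ) ∂surf) * ‖ψ₁ - ψ₂‖ := by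
  have hb : ∀ ψ : C(S2, ℝ), ‖ψ - 1‖ ≤ δ → ∀ ω, |ψ ω - 1| ≤ δ :=
    fun ψ h ω => ((ψ - 1).norm_coe_le_norm ω).trans h
  have hp : ∀ ψ : C(S2, ℝ), ‖ψ - 1‖ ≤ δ → ∀ ω, 0 < ψ ω :=
    fun ψ h ω => by linarith [(abs_le.1 (hb ψ h ω)).1]
  have i1 := integrable_radialKernel ω (hp _ h₁)
  have i2 := integrable_radialKernel ω (hp _ h₂)
  have i3 := integrable_div_dist ω (ψ₁ - ψ₂)
  rw [starPotential, starPotential, singleLayer_apply, ← integral_sub i1 i2,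
    ← integral_sub (by exact i1.sub i2) i3, ← Real.norm_eq_abs]
  have hint := ((integrable_sphere_dist_rpow ω).const_mul (24 * √δ)).mul_const ‖ψ₁ - ψ₂‖
  refine (norm_integral_le_of_norm_le hint ?_).trans_eq ?_
  · filter_upwards [ae_ne ω] with ω' hω'
    have := abs_radialKernel_sub_sub_le hω' hδ (hb _ h₂ ω') (hb _ h₁ ω')
    rw [← div_eq_mul_inv] at this
    refine this.trans ?_
    gcongr
    exact (ψ₁ - ψ₂).norm_coe_le_norm ω'
  · rw [integral_mul_const, integral_const_mul]

/-- The strict form is needed because the remainder will later be compared at two nearby functions,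
`u` and `u ∘ g`. -/
theorem hasStrictFDerivAt_starPotential (ω : S2) :
    HasStrictFDerivAt (starPotential ω) (singleLayer ω) 1 := by
  rw [hasStrictFDerivAt_iff_isLittleO, Asymptotics.isLittleO_iff]
  intro c hc
  set I := ∫ ω' : S2, ‖(ω : E3) - ω'‖ ^ (-(3 / 2) : ℝ) ∂surf
  have hI : 0 ≤ I := integral_nonneg fun ω' => by positivity
  obtain ⟨δ, hδ0, hδ, hδc⟩ : ∃ δ : ℝ, 0 < δ ∧ δ ≤ 1 / 2 ∧ 24 * √δ * I ≤ c := by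
    have hc' : 0 < c / (24 * (I + 1)) := by positivity
    -- Chosen so that `24 √δ I ≤ c`; using `I + 1` avoids a separate case `I = 0`.
    refine ⟨min (1 / 2) ((c / (24 * (I + 1))) ^ 2), by positivity, min_le_left _ _, ?_⟩
    have : √(min (1 / 2) ((c / (24 * (I + 1))) ^ 2)) ≤ c / (24 * (I + 1)) :=
      (Real.sqrt_le_sqrt (min_le_right _ _)).trans_eq (Real.sqrt_sq hc'.le)
    calc 24 * √(min (1 / 2) ((c / (24 * (I + 1))) ^ 2)) * I
        ≤ 24 * (c / (24 * (I + 1))) * (I + 1) := by gcongr; linarith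
      _ = c := by field_simp
  have hball : ∀ᶠ p : C(S2, ℝ) × C(S2, ℝ) in 𝓝 (1, 1), p ∈ Metric.ball (1, 1) δ :=
    Metric.ball_mem_nhds _ hδ0
  filter_upwards [hball] with p hp
  rw [← ball_prod_same, Set.mem_prod, mem_ball_iff_norm, mem_ball_iff_norm] at hp
  refine (abs_starPotential_sub_sub_le ω hδ hp.1.le hp.2.le).trans ?_
  gcongr

/-! ### The potential on the boundary of the set -/

/-- The potential `∫_{Ω_φ} dy / |φ(ω)ω - y|` in polar coordinates. -/
def boundaryPotential (ω : S2) (φ : C(S2, ℝ)) : ℝ :=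
  φ ω ^ 2 * starPotential ω ((φ ω)⁻¹ • φ)

/-- Evaluation at a point. -/
abbrev evalAt (ω : S2) : C(S2, ℝ) →L[ℝ] ℝ := ContinuousMap.evalCLM ℝ ω

/-- Chain rule for `φ(ω)² Q(φ / φ(ω))`: the inner map has derivative `(u - u(ω)) / R` at the
constant `R`, so the result is `2R Q(1) u(ω) + R (S u - u(ω) S 1)`, with `S` the single layer
potential. -/
theorem hasStrictFDerivAt_boundaryPotential (ω : S2) {R : ℝ} (hR : 0 < R) :
    HasStrictFDerivAt (boundaryPotential ω)
      ((2 * R * starPotential ω 1 - R * singleLayer ω 1) • evalAt ω + R • singleLayer ω)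
      (ContinuousMap.const S2 R) := by
  set c : C(S2, ℝ) := ContinuousMap.const S2 R
  have he : HasStrictFDerivAt (fun φ : C(S2, ℝ) => φ ω) (evalAt ω) c :=
    (evalAt ω).hasStrictFDerivAt
  have hc : c ω = R := rfl
  have hinv : HasStrictFDerivAt (fun φ : C(S2, ℝ) => (φ ω)⁻¹) (-(R ^ 2)⁻¹ • evalAt ω) c := by
    have h := (hasStrictDerivAt_inv (x := c ω) (by rw [hc]; exact hR.ne')).comp_hasStrictFDerivAt
      c he
    rw [hc] at h
    exact h
  have hs : HasStrictFDerivAt (fun φ : C(S2, ℝ) => (φ ω)⁻¹ • φ)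
      ((c ω)⁻¹ • ContinuousLinearMap.id ℝ C(S2, ℝ) + (-(R ^ 2)⁻¹ • evalAt ω).smulRight c) c :=
    hinv.smul (hasStrictFDerivAt_id c)
  have h1 : (c ω)⁻¹ • c = 1 := by
    ext x
    simp [hc, c, hR.ne']
  have hQ : HasStrictFDerivAt (starPotential ω) (singleLayer ω) ((c ω)⁻¹ • c) := by
    rw [h1]; exact hasStrictFDerivAt_starPotential ω
  have hcomp := hQ.comp (f := fun φ : C(S2, ℝ) => (φ ω)⁻¹ • φ) c hs
  have hm := (he.pow 2).mul hcomp
  rw [h1] at hm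
  have hc1 : c = R • (1 : C(S2, ℝ)) := by ext x; simp [c]
  refine hm.congr_fderiv ?_
  ext u
  simp only [ContinuousLinearMap.add_apply, ContinuousLinearMap.smul_apply,
    ContinuousLinearMap.comp_apply, ContinuousLinearMap.smulRight_apply, map_add, map_smul,
    hc, ContinuousLinearMap.id_apply, smul_eq_mul, id, map_neg]
  rw [hc1]
  simp only [map_smul, smul_eq_mul]
  field_simp
  ring

/-- The action of a rotation on continuous functions. -/
def compRot (g : E3 ≃ₗᵢ[ℝ] E3) (u : C(S2, ℝ)) : C(S2, ℝ) :=
  u.comp ⟨rotPoint g, continuous_rotPoint g⟩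

@[simp]
theorem compRot_apply (g : E3 ≃ₗᵢ[ℝ] E3) (u : C(S2, ℝ)) (ω : S2) :
    compRot g u ω = u (rotPoint g ω) := rfl

theorem norm_sub_smul_rotPoint (g : E3 ≃ₗᵢ[ℝ] E3) (ω ω' : S2) (r : ℝ) :
    ‖(rotPoint g ω : E3) - r • (rotPoint g ω' : E3)‖ = ‖(ω : E3) - r • (ω' : E3)‖ := by
  rw [← g.norm_map ((ω : E3) - r • (ω' : E3)), map_sub, map_smul]
  rfl

theorem norm_sub_rotPoint (g : E3 ≃ₗᵢ[ℝ] E3) (ω ω' : S2) :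
    ‖(rotPoint g ω : E3) - (rotPoint g ω' : E3)‖ = ‖(ω : E3) - (ω' : E3)‖ := by
  simpa using norm_sub_smul_rotPoint g ω ω' 1

theorem singleLayer_rotPoint (g : E3 ≃ₗᵢ[ℝ] E3) (ω : S2) (u : C(S2, ℝ)) :
    singleLayer (rotPoint g ω) u = singleLayer ω (compRot g u) := by
  rw [singleLayer_apply, singleLayer_apply, ← integral_rotPoint g]
  simp only [norm_sub_rotPoint, compRot_apply]

theorem starPotential_rotPoint (g : E3 ≃ₗᵢ[ℝ] E3) (ω : S2) (u : C(S2, ℝ)) :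
    starPotential (rotPoint g ω) u = starPotential ω (compRot g u) := by
  rw [starPotential, starPotential, ← integral_rotPoint g]
  simp only [radialKernel, norm_sub_smul_rotPoint, compRot_apply]

theorem boundaryPotential_rotPoint (g : E3 ≃ₗᵢ[ℝ] E3) (ω : S2) (u : C(S2, ℝ)) :
    boundaryPotential (rotPoint g ω) u = boundaryPotential ω (compRot g u) := by
  rw [boundaryPotential, boundaryPotential, starPotential_rotPoint]
  rfl

theorem coulombMass_eq (ω : S2) : coulombMass ω = singleLayer ω 1 := by
  simp [coulombMass, singleLayer_apply]

/-! ### Polynomials as functions -/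

/-- The function on `E3` defined by a polynomial. -/
def polyFun (p : MvPolynomial (Fin 3) ℝ) (x : E3) : ℝ := MvPolynomial.eval (fun i => x i) p

theorem contDiff_polyFun (p : MvPolynomial (Fin 3) ℝ) {n : WithTop ℕ∞} :
    ContDiff ℝ n (polyFun p) :=
  (AnalyticOnNhd.eval_continuousLinearMap' (fun i => (EuclideanSpace.proj i : E3 →L[ℝ] ℝ)) p).contDiff

theorem hasFDerivAt_polyFun (p : MvPolynomial (Fin 3) ℝ) (x : E3) :
    HasFDerivAt (polyFun p)
      (∑ i, polyFun (MvPolynomial.pderiv i p) x • (EuclideanSpace.proj i : E3 →L[ℝ] ℝ)) x := by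
  induction p using MvPolynomial.induction_on with
  | C a =>
    have e : polyFun (MvPolynomial.C a) = fun _ => a := by funext y; simp [polyFun]
    rw [e]
    refine (hasFDerivAt_const a x).congr_fderiv ?_
    simp [polyFun]
  | add p q hp hq =>
    have e : polyFun (p + q) = polyFun p + polyFun q := by funext y; simp [polyFun]
    rw [e]
    refine (hp.add hq).congr_fderiv ?_
    simp [polyFun, add_smul, Finset.sum_add_distrib]
  | mul_X p n hp =>
    have h := hp.mul (EuclideanSpace.proj n : E3 →L[ℝ] ℝ).hasFDerivAt
    have e : polyFun (p * MvPolynomial.X n) =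
        fun y => polyFun p y * (EuclideanSpace.proj n : E3 →L[ℝ] ℝ) y := by
      funext y; simp [polyFun]
    rw [e]
    refine h.congr_fderiv ?_
    ext v
    simp only [polyFun, MvPolynomial.pderiv_mul, MvPolynomial.pderiv_X, map_add, map_mul,
      MvPolynomial.eval_X, ContinuousLinearMap.add_apply, ContinuousLinearMap.smul_apply,
      ContinuousLinearMap.sum_apply, smul_eq_mul, add_mul, Finset.sum_add_distrib]
    rw [add_comm, Finset.mul_sum]
    congr 1
    · refine Finset.sum_congr rfl fun i _ => ?_
      change x n * _ = _
      ring
    · rw [Finset.sum_eq_single n]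
      · simp
      · intro i _ hi
        simp [Pi.single_apply, hi.symm]
      · simp

theorem hasDerivAt_polyFun_comp (p : MvPolynomial (Fin 3) ℝ) {c : ℝ → E3} {v x : E3} {θ : ℝ}
    (hc : HasDerivAt c v θ) (hx : c θ = x) :
    HasDerivAt (fun s => polyFun p (c s)) (∑ i, polyFun (MvPolynomial.pderiv i p) x * v i) θ := by
  subst hx
  refine ((hasFDerivAt_polyFun p (c θ)).comp_hasDerivAt θ hc).congr_deriv ?_
  simp

/-- The commutator of two derivations is a derivation, and this one kills every variable. -/
theorem pderiv_comm (i j : Fin 3) (p : MvPolynomial (Fin 3) ℝ) :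
    MvPolynomial.pderiv i (MvPolynomial.pderiv j p) =
      MvPolynomial.pderiv j (MvPolynomial.pderiv i p) := by
  have h : ⁅(MvPolynomial.pderiv i : Derivation ℝ (MvPolynomial (Fin 3) ℝ) (MvPolynomial (Fin 3) ℝ)),
      (MvPolynomial.pderiv j : Derivation ℝ (MvPolynomial (Fin 3) ℝ) (MvPolynomial (Fin 3) ℝ))⁆ =
      0 := by
    apply MvPolynomial.derivation_ext
    intro k
    simp only [Derivation.commutator_apply, MvPolynomial.pderiv_X, Derivation.zero_apply]
    by_cases h1 : j = k <;> by_cases h2 : i = k <;> simp [Pi.single_apply, h1, h2]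
  have h2 := congrArg (fun D => D p) h
  simp only [Derivation.commutator_apply, Derivation.zero_apply] at h2
  exact sub_eq_zero.1 h2

/-- The angular derivative `xᵢ ∂ⱼ - xⱼ ∂ᵢ` of a polynomial. -/
def angular (i j : Fin 3) (p : MvPolynomial (Fin 3) ℝ) : MvPolynomial (Fin 3) ℝ :=
  MvPolynomial.X i * MvPolynomial.pderiv j p - MvPolynomial.X j * MvPolynomial.pderiv i p

/-- The identity `∑ L² = |x|² Δ - E(E + 1)` with `E` the Euler operator, evaluated where `Δp = 0`
and `Ep = lp`. The second-order part of `E²` comes from differentiating Euler's identity. -/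
theorem sum_angular_sq {l : ℕ} {p : MvPolynomial (Fin 3) ℝ} (hp : p.IsHomogeneous l)
    (hΔ : ∑ i : Fin 3, MvPolynomial.pderiv i (MvPolynomial.pderiv i p) = 0) :
    angular 0 1 (angular 0 1 p) + angular 0 2 (angular 0 2 p) + angular 1 2 (angular 1 2 p) =
      -((l : MvPolynomial (Fin 3) ℝ) * (l + 1)) * p := by
  have hE := hp.sum_X_mul_pderiv
  simp only [Fin.sum_univ_three, nsmul_eq_mul] at hE hΔ
  have hn : ∀ i : Fin 3, MvPolynomial.pderiv i (l : MvPolynomial (Fin 3) ℝ) = 0 := fun i => by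
    simp
  have h0 := congrArg (MvPolynomial.pderiv 0) hE
  have h1 := congrArg (MvPolynomial.pderiv 1) hE
  have h2 := congrArg (MvPolynomial.pderiv 2) hE
  simp only [map_add, MvPolynomial.pderiv_mul, MvPolynomial.pderiv_X, hn] at h0 h1 h2
  simp only [angular, map_sub, MvPolynomial.pderiv_mul, MvPolynomial.pderiv_X]
  simp only [Pi.single_apply, Fin.reduceEq, if_true, if_false, zero_mul, one_mul, zero_add,
    pderiv_comm 1 0, pderiv_comm 2 0, pderiv_comm 2 1] at h0 h1 h2 ⊢
  linear_combination (MvPolynomial.X 0 ^ 2 + MvPolynomial.X 1 ^ 2 + MvPolynomial.X 2 ^ 2) * hΔ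
    - MvPolynomial.X 0 * h0 - MvPolynomial.X 1 * h1 - MvPolynomial.X 2 * h2
    - ((l : MvPolynomial (Fin 3) ℝ) + 1) * hE

/-! ### Integration by parts on the sphere -/

theorem continuous_slice {f : ℝ → S2 → ℝ} {s : Set ℝ}
    (hf : ContinuousOn (fun q : ℝ × S2 => f q.1 q.2) (s ×ˢ univ)) {r : ℝ} (hr : r ∈ s) :
    Continuous (f r) := by
  have h : Continuous fun ω : S2 => ((r, ω) : ℝ × S2) := by fun_prop
  exact hf.comp_continuous h fun ω => ⟨hr, mem_univ _⟩

theorem hasDerivAt_integral_sphere {f f' : ℝ → S2 → ℝ} {s : Set ℝ} (hs : IsOpen s)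
    (hf : ∀ r ∈ s, Continuous (f r))
    (hf' : ContinuousOn (fun q : ℝ × S2 => f' q.1 q.2) (s ×ˢ univ))
    (hd : ∀ r ∈ s, ∀ ω, HasDerivAt (fun r => f r ω) (f' r ω) r) {r : ℝ} (hr : r ∈ s) :
    HasDerivAt (fun r => ∫ ω, f r ω ∂surf) (∫ ω, f' r ω ∂surf) r := by
  obtain ⟨ε, hε, hsub⟩ := Metric.nhds_basis_closedBall.mem_iff.1 (hs.mem_nhds hr)
  have hK : IsCompact (Metric.closedBall r ε ×ˢ (univ : Set S2)) :=
    (isCompact_closedBall r ε).prod isCompact_univ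
  obtain ⟨C, hC⟩ := hK.exists_bound_of_continuousOn (hf'.mono (prod_mono hsub le_rfl))
  have hf'r : Continuous (f' r) := continuous_slice hf' hr
  refine (hasDerivAt_integral_of_dominated_loc_of_deriv_le (bound := fun _ => C)
    (Metric.closedBall_mem_nhds r hε) ?_ ?_ ?_ ?_ (integrable_const C) ?_).2
  · filter_upwards [hs.mem_nhds hr] with x hx using (hf x hx).aestronglyMeasurable
  · exact (hf r hr).integrable_of_hasCompactSupport (HasCompactSupport.of_compactSpace _)
  · exact hf'r.aestronglyMeasurable
  · exact .of_forall fun ω x hx => hC (x, ω) ⟨hx, mem_univ _⟩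
  · exact .of_forall fun ω x hx => hd x (hsub hx) ω

/-- The infinitesimal rotation in the plane of the `i`-th and `j`-th coordinates. -/
def rotGen (i j : Fin 3) (x : E3) : E3 :=
  x i • EuclideanSpace.single j 1 - x j • EuclideanSpace.single i 1

/-- The rotation by the angle `θ` in the plane of the `i`-th and `j`-th coordinates. -/
def planeRotFun (i j : Fin 3) (θ : ℝ) (x : E3) : E3 :=
  x + ((Real.cos θ - 1) * x i - Real.sin θ * x j) • EuclideanSpace.single i 1 +
    (Real.sin θ * x i + (Real.cos θ - 1) * x j) • EuclideanSpace.single j 1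

theorem norm_planeRotFun {i j : Fin 3} (hij : i ≠ j) (θ : ℝ) (x : E3) :
    ‖planeRotFun i j θ x‖ = ‖x‖ := by
  rw [← sq_eq_sq₀ (norm_nonneg _) (norm_nonneg _), planeRotFun, norm_add_sq_real, norm_add_sq_real]
  simp only [inner_add_left, inner_smul_left, inner_smul_right, EuclideanSpace.inner_single_left,
    EuclideanSpace.inner_single_right, norm_smul, mul_pow]
  simp [hij, hij.symm]
  linear_combination (x i ^ 2 + x j ^ 2) * Real.sin_sq_add_cos_sq θ

/-- `planeRotFun` as a linear isometry. -/
def planeRot {i j : Fin 3} (hij : i ≠ j) (θ : ℝ) : E3 ≃ₗᵢ[ℝ] E3 :=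
  LinearIsometry.toLinearIsometryEquiv
    { toFun := planeRotFun i j θ
      map_add' := fun x y => by
        simp only [planeRotFun, PiLp.add_apply]
        module
      map_smul' := fun c x => by
        simp only [planeRotFun, PiLp.smul_apply, RingHom.id_apply, smul_eq_mul]
        module
      norm_map' := norm_planeRotFun hij θ } rfl

theorem hasDerivAt_planeRotFun {i j : Fin 3} (hij : i ≠ j) (x : E3) (θ : ℝ) :
    HasDerivAt (fun θ => planeRotFun i j θ x) (rotGen i j (planeRotFun i j θ x)) θ := by
  have hc := Real.hasDerivAt_cos θ
  have hs := Real.hasDerivAt_sin θ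
  have h1 : HasDerivAt (fun θ => (Real.cos θ - 1) * x i - Real.sin θ * x j)
      (-Real.sin θ * x i - Real.cos θ * x j) θ :=
    ((hc.sub_const 1).mul_const (x i)).sub (hs.mul_const (x j))
  have h2 : HasDerivAt (fun θ => Real.sin θ * x i + (Real.cos θ - 1) * x j)
      (Real.cos θ * x i + -Real.sin θ * x j) θ :=
    (hs.mul_const (x i)).add ((hc.sub_const 1).mul_const (x j))
  have h := ((h1.smul_const (EuclideanSpace.single i (1 : ℝ))).const_add x).add
    (h2.smul_const (EuclideanSpace.single j (1 : ℝ)))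
  refine h.congr_deriv ?_
  simp only [rotGen, planeRotFun, PiLp.add_apply, PiLp.smul_apply, smul_eq_mul,
    EuclideanSpace.single_apply, hij, hij.symm, if_true, if_false]
  module

/-- The integral of `f` over the rotated sphere does not depend on the angle; differentiate at angle
`0`. Differentiability is asked only along curves whose velocity is that of the rotation, which
suits the integrands below. -/
theorem integral_rotGen {i j : Fin 3} (hij : i ≠ j) {f f' : E3 → ℝ}
    (hf : Continuous fun ω : S2 => f ω) (hf' : Continuous fun ω : S2 => f' ω)
    (hd : ∀ (x : E3) (c : ℝ → E3) (θ : ℝ), ‖x‖ = 1 → c θ = x → HasDerivAt c (rotGen i j x) θ →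
      HasDerivAt (fun s => f (c s)) (f' x) θ) :
    ∫ ω : S2, f' ω ∂surf = 0 := by
  have hcont : Continuous fun q : ℝ × S2 => rotPoint (planeRot hij q.1) q.2 := by
    refine Continuous.subtype_mk ?_ _
    change Continuous fun q : ℝ × S2 => planeRotFun i j q.1 (q.2 : E3)
    unfold planeRotFun
    fun_prop
  have h := hasDerivAt_integral_sphere (f := fun θ ω => f (rotPoint (planeRot hij θ) ω))
    (f' := fun θ ω => f' (rotPoint (planeRot hij θ) ω)) isOpen_univ
    (fun θ _ => hf.comp (continuous_rotPoint _)) (hf'.comp hcont).continuousOn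
    (fun θ _ ω => hd _ _ θ (norm_coe _) rfl (hasDerivAt_planeRotFun hij (ω : E3) θ))
    (mem_univ 0)
  have h2 : (fun θ : ℝ => ∫ ω, f (rotPoint (planeRot hij θ) ω) ∂surf) =
      fun _ => ∫ ω : S2, f ω ∂surf :=
    funext fun θ => integral_rotPoint (planeRot hij θ) fun ω => f ω
  rw [h2] at h
  have h3 := h.unique (hasDerivAt_const 0 _)
  rw [integral_rotPoint (planeRot hij 0) fun ω => f' ω] at h3
  exact h3

/-! ### The generating function `(1 - 2rt + r²)^(-1/2)` -/

/-- `(1 - 2rt + r²)^(-1/2)`, the generating function of the Legendre polynomials. -/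
def legendreGen (r t : ℝ) : ℝ := (√(1 - 2 * r * t + r ^ 2))⁻¹

/-- The radicand is at least `(1 - |r|)²`. -/
theorem legendreGen_radicand_pos {r t : ℝ} (hr : |r| < 1) (ht : |t| ≤ 1) :
    0 < 1 - 2 * r * t + r ^ 2 := by
  have h1 : r * t ≤ |r| := by
    calc r * t ≤ |r * t| := le_abs_self _
      _ = |r| * |t| := abs_mul _ _
      _ ≤ |r| * 1 := by gcongr
      _ = |r| := mul_one _
  have h2 : r ^ 2 = |r| ^ 2 := (sq_abs r).symm
  nlinarith

theorem legendreGen_sq {r t : ℝ} (h : 0 < 1 - 2 * r * t + r ^ 2) :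
    legendreGen r t ^ 2 * (1 - 2 * r * t + r ^ 2) = 1 := by
  rw [legendreGen, inv_pow, Real.sq_sqrt h.le, inv_mul_cancel₀ h.ne']

theorem HasDerivAt.legendreGen {a b : ℝ → ℝ} {a' b' s : ℝ} (ha : HasDerivAt a a' s)
    (hb : HasDerivAt b b' s) (h : 0 < 1 - 2 * a s * b s + a s ^ 2) :
    HasDerivAt (fun s => legendreGen (a s) (b s))
      (LiquidDrop.legendreGen (a s) (b s) ^ 3 * (a' * (b s - a s) + a s * b')) s := by
  have hq : HasDerivAt (fun s => 1 - 2 * a s * b s + a s ^ 2)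
      (-(2 * a' * b s + 2 * a s * b') + 2 * a s * a') s := by
    have := (((ha.const_mul 2).mul hb).const_sub 1).add (ha.pow 2)
    refine this.congr_deriv ?_
    push_cast
    ring
  have hi := (hq.sqrt h.ne').inv (Real.sqrt_pos.2 h).ne'
  refine hi.congr_deriv ?_
  have hs := Real.sqrt_pos.2 h
  rw [LiquidDrop.legendreGen]
  field_simp
  ring

theorem abs_inner_coe_le (ω ω' : S2) : |inner ℝ (ω : E3) (ω' : E3)| ≤ 1 := by
  simpa [norm_coe] using abs_real_inner_le_norm (ω : E3) (ω' : E3)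

theorem norm_sub_smul_sq (ω ω' : S2) (r : ℝ) :
    ‖(ω : E3) - r • (ω' : E3)‖ ^ 2 = 1 - 2 * r * inner ℝ (ω : E3) (ω' : E3) + r ^ 2 := by
  rw [norm_sub_sq_real, norm_coe, norm_smul_coe, inner_smul_right, sq_abs]
  ring

theorem legendreGen_inner (ω ω' : S2) (r : ℝ) :
    legendreGen r (inner ℝ (ω : E3) (ω' : E3)) = ‖(ω : E3) - r • (ω' : E3)‖⁻¹ := by
  rw [legendreGen, ← norm_sub_smul_sq, Real.sqrt_sq (norm_nonneg _)]

theorem continuousOn_legendreGen (ω : S2) :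
    ContinuousOn (fun q : ℝ × S2 => legendreGen q.1 (inner ℝ (ω : E3) (q.2 : E3)))
      (Ioo (-1) 1 ×ˢ univ) := by
  refine ContinuousOn.inv₀ (by fun_prop) fun q hq => ?_
  exact (Real.sqrt_pos.2 (legendreGen_radicand_pos (abs_lt.2 hq.1) (abs_inner_coe_le ω q.2))).ne'

theorem continuous_legendreGen (ω : S2) {r : ℝ} (hr : |r| < 1) :
    Continuous fun ω' : S2 => legendreGen r (inner ℝ (ω : E3) (ω' : E3)) := by
  have h : Continuous fun ω' : S2 => ((r, ω') : ℝ × S2) := by fun_prop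
  exact (continuousOn_legendreGen ω).comp_continuous h fun ω' => ⟨abs_lt.1 hr, mem_univ _⟩

theorem continuous_polyFun (p : MvPolynomial (Fin 3) ℝ) :
    Continuous fun ω : S2 => polyFun p ω :=
  (contDiff_polyFun (n := 0) p).continuous.comp continuous_subtype_val

theorem integrable_of_continuous {f : S2 → ℝ} (hf : Continuous f) : Integrable f surf :=
  hf.integrable_of_hasCompactSupport (HasCompactSupport.of_compactSpace _)

theorem polyFun_angular (i j : Fin 3) (p : MvPolynomial (Fin 3) ℝ) (x : E3) :
    polyFun (angular i j p) x =
      x i * polyFun (MvPolynomial.pderiv j p) x - x j * polyFun (MvPolynomial.pderiv i p) x := by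
  simp [polyFun, angular]

theorem inner_eq_sum (x y : E3) : inner ℝ x y = x 0 * y 0 + x 1 * y 1 + x 2 * y 2 := by
  rw [PiLp.inner_apply, Fin.sum_univ_three]
  simp [mul_comm]

theorem hasDerivAt_polyFun_rotGen {i j : Fin 3} (p : MvPolynomial (Fin 3) ℝ)
    {c : ℝ → E3} {x : E3} {θ : ℝ} (hc : HasDerivAt c (rotGen i j x) θ) (hx : c θ = x) :
    HasDerivAt (fun s => polyFun p (c s)) (polyFun (angular i j p) x) θ := by
  refine (hasDerivAt_polyFun_comp p hc hx).congr_deriv ?_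
  rw [polyFun_angular]
  simp only [rotGen, PiLp.sub_apply, PiLp.smul_apply, smul_eq_mul, EuclideanSpace.single_apply,
    mul_sub, Finset.sum_sub_distrib]
  simp [mul_comm]

/-- Green's identity for one rotation generator `L`: the integrand is `L(p Lκ - κ Lp) = p L²κ - κ
L²p`, where `Lκ = r κ³ Lt` and `L²t = -(xᵢωᵢ + xⱼωⱼ)`. -/
theorem integral_angular {i j : Fin 3} (hij : i ≠ j) (p : MvPolynomial (Fin 3) ℝ) (ω : S2) {r : ℝ}
    (hr : |r| < 1) :
    ∫ ω' : S2, (polyFun p ω' * (3 * r ^ 2 * legendreGen r (inner ℝ (ω : E3) (ω' : E3)) ^ 5) *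
        ((ω' : E3) i * (ω : E3) j - (ω' : E3) j * (ω : E3) i) ^ 2
      - polyFun p ω' * (r * legendreGen r (inner ℝ (ω : E3) (ω' : E3)) ^ 3) *
        ((ω' : E3) i * (ω : E3) i + (ω' : E3) j * (ω : E3) j)
      - polyFun (angular i j (angular i j p)) ω' * legendreGen r (inner ℝ (ω : E3) (ω' : E3)))
      ∂surf = 0 := by
  have hK := continuous_legendreGen ω hr
  have hp := continuous_polyFun p
  have hci : ∀ m : Fin 3, Continuous fun ω' : S2 => (ω' : E3) m := fun m => by fun_prop
  refine integral_rotGen hij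
    (f := fun x => polyFun p x * (r * legendreGen r (inner ℝ (ω : E3) x) ^ 3) *
        (x i * (ω : E3) j - x j * (ω : E3) i)
      - polyFun (angular i j p) x * legendreGen r (inner ℝ (ω : E3) x))
    (f' := fun x => polyFun p x * (3 * r ^ 2 * legendreGen r (inner ℝ (ω : E3) x) ^ 5) *
        (x i * (ω : E3) j - x j * (ω : E3) i) ^ 2
      - polyFun p x * (r * legendreGen r (inner ℝ (ω : E3) x) ^ 3) *
        (x i * (ω : E3) i + x j * (ω : E3) j)
      - polyFun (angular i j (angular i j p)) x * legendreGen r (inner ℝ (ω : E3) x)) ?_ ?_ ?_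
  · exact ((hp.mul ((hK.pow 3).const_mul r)).mul (((hci i).mul_const _).sub
      ((hci j).mul_const _))).sub ((continuous_polyFun _).mul hK)
  · exact (((hp.mul ((hK.pow 5).const_mul _)).mul ((((hci i).mul_const _).sub
      ((hci j).mul_const _)).pow 2)).sub ((hp.mul ((hK.pow 3).const_mul r)).mul
      (((hci i).mul_const _).add ((hci j).mul_const _)))).sub ((continuous_polyFun _).mul hK)
  · intro x c θ hx hcx hc
    have h1 := hasDerivAt_polyFun_rotGen p hc hcx
    have h2 := hasDerivAt_polyFun_rotGen (angular i j p) hc hcx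
    have hcm : ∀ m : Fin 3, HasDerivAt (fun s => c s m) (rotGen i j x m) θ := fun m =>
      (EuclideanSpace.proj m : E3 →L[ℝ] ℝ).hasFDerivAt.comp_hasDerivAt θ hc
    have hi : HasDerivAt (fun s => c s i) (-x j) θ := by
      refine (hcm i).congr_deriv ?_
      simp [rotGen, hij]
    have hj : HasDerivAt (fun s => c s j) (x i) θ := by
      refine (hcm j).congr_deriv ?_
      simp [rotGen, hij.symm]
    have ht : HasDerivAt (fun s => inner ℝ (ω : E3) (c s))
        (x i * (ω : E3) j - x j * (ω : E3) i) θ := by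
      refine ((innerSL ℝ (ω : E3)).hasFDerivAt.comp_hasDerivAt θ hc).congr_deriv ?_
      simp [rotGen, inner_sub_right, inner_smul_right, EuclideanSpace.inner_single_right]
    have hxt : |inner ℝ (ω : E3) (c θ)| ≤ 1 := by
      rw [hcx]
      simpa [norm_coe, hx] using abs_real_inner_le_norm (ω : E3) x
    have hk := HasDerivAt.legendreGen (hasDerivAt_const θ r) ht (legendreGen_radicand_pos hr hxt)
    have h := ((h1.mul ((hk.pow 3).const_mul r)).mul ((hi.mul_const ((ω : E3) j)).sub
      (hj.mul_const ((ω : E3) i)))).sub (h2.mul hk)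
    refine h.congr_deriv ?_
    simp only [hcx]
    push_cast
    simp only [Pi.mul_apply, Pi.sub_apply, Pi.pow_apply, hcx]
    ring

/-- Summing over the three coordinate planes turns `∑ L²` into the spherical Laplacian. Lagrange's
identity gives `∑ (Lt)² = 1 - t²`, and `∑ L²t = -2t`; the statement is `∫ p (Δκ + l(l + 1)κ) = 0`.
-/
theorem integral_legendre_operator {l : ℕ} {p : MvPolynomial (Fin 3) ℝ} (hp : p.IsHomogeneous l)
    (hΔ : ∑ i : Fin 3, MvPolynomial.pderiv i (MvPolynomial.pderiv i p) = 0) (ω : S2) {r : ℝ}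
    (hr : |r| < 1) :
    ∫ ω' : S2, polyFun p ω' *
      (3 * r ^ 2 * legendreGen r (inner ℝ (ω : E3) (ω' : E3)) ^ 5 *
          (1 - inner ℝ (ω : E3) (ω' : E3) ^ 2)
        - 2 * inner ℝ (ω : E3) (ω' : E3) * r * legendreGen r (inner ℝ (ω : E3) (ω' : E3)) ^ 3
        + l * (l + 1) * legendreGen r (inner ℝ (ω : E3) (ω' : E3))) ∂surf = 0 := by
  have hK := continuous_legendreGen ω hr
  have hci : ∀ m : Fin 3, Continuous fun ω' : S2 => (ω' : E3) m := fun m => by fun_prop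
  have hcont : ∀ i j : Fin 3, Continuous fun ω' : S2 =>
      (polyFun p ω' * (3 * r ^ 2 * legendreGen r (inner ℝ (ω : E3) (ω' : E3)) ^ 5) *
        ((ω' : E3) i * (ω : E3) j - (ω' : E3) j * (ω : E3) i) ^ 2
      - polyFun p ω' * (r * legendreGen r (inner ℝ (ω : E3) (ω' : E3)) ^ 3) *
        ((ω' : E3) i * (ω : E3) i + (ω' : E3) j * (ω : E3) j)
      - polyFun (angular i j (angular i j p)) ω' * legendreGen r (inner ℝ (ω : E3) (ω' : E3))) :=
    fun i j => ((((continuous_polyFun p).mul ((hK.pow 5).const_mul _)).mul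
      ((((hci i).mul_const _).sub ((hci j).mul_const _)).pow 2)).sub
      (((continuous_polyFun p).mul ((hK.pow 3).const_mul r)).mul
      (((hci i).mul_const _).add ((hci j).mul_const _)))).sub ((continuous_polyFun _).mul hK)
  have h01 := integral_angular (show (0 : Fin 3) ≠ 1 by decide) p ω hr
  have h02 := integral_angular (show (0 : Fin 3) ≠ 2 by decide) p ω hr
  have h12 := integral_angular (show (1 : Fin 3) ≠ 2 by decide) p ω hr
  have hsum := congrArg₂ (· + ·) (congrArg₂ (· + ·) h01 h02) h12
  have i01 := integrable_of_continuous (hcont 0 1)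
  have i02 := integrable_of_continuous (hcont 0 2)
  have i12 := integrable_of_continuous (hcont 1 2)
  simp only at hsum
  rw [← integral_add i01 i02, ← integral_add (by exact i01.add i02) i12, add_zero, add_zero] at hsum
  rw [← hsum]
  refine integral_congr_ae (.of_forall fun ω' => ?_)
  have ha := congrArg (fun q => polyFun q (ω' : E3)) (sum_angular_sq hp hΔ)
  have ha' : polyFun (angular 0 1 (angular 0 1 p)) ω' + polyFun (angular 0 2 (angular 0 2 p)) ω' +
      polyFun (angular 1 2 (angular 1 2 p)) ω' = -(l * (l + 1)) * polyFun p ω' := by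
    simpa [polyFun] using ha
  have n1 : (ω : E3) 0 ^ 2 + (ω : E3) 1 ^ 2 + (ω : E3) 2 ^ 2 = 1 := by
    have := inner_eq_sum (ω : E3) (ω : E3)
    rw [real_inner_self_eq_norm_sq, norm_coe] at this
    linarith
  have n2 : (ω' : E3) 0 ^ 2 + (ω' : E3) 1 ^ 2 + (ω' : E3) 2 ^ 2 = 1 := by
    have := inner_eq_sum (ω' : E3) (ω' : E3)
    rw [real_inner_self_eq_norm_sq, norm_coe] at this
    linarith
  have ht := inner_eq_sum (ω : E3) (ω' : E3)
  simp only
  set k := legendreGen r (inner ℝ (ω : E3) (ω' : E3))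
  set t : ℝ := inner ℝ (ω : E3) (ω' : E3)
  have hL : ((ω' : E3) 0 * (ω : E3) 1 - (ω' : E3) 1 * (ω : E3) 0) ^ 2 +
      ((ω' : E3) 0 * (ω : E3) 2 - (ω' : E3) 2 * (ω : E3) 0) ^ 2 +
      ((ω' : E3) 1 * (ω : E3) 2 - (ω' : E3) 2 * (ω : E3) 1) ^ 2 = 1 - t ^ 2 := by
    rw [ht]
    linear_combination ((ω' : E3) 0 ^ 2 + (ω' : E3) 1 ^ 2 + (ω' : E3) 2 ^ 2) * n1 + n2
  linear_combination -(polyFun p ω' * (3 * r ^ 2 * k ^ 5)) * hL + k * ha' -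
    2 * r * k ^ 3 * polyFun p ω' * ht

/-! ### The Poisson identity for harmonic polynomials -/

/-- The integrand `Y (r ∂ᵣκ - lκ)`, where `κ` is the generating function. -/
def radialFlux (l : ℕ) (p : MvPolynomial (Fin 3) ℝ) (ω : S2) (r : ℝ) (ω' : S2) : ℝ :=
  polyFun p ω' * (r * (inner ℝ (ω : E3) (ω' : E3) - r) *
      legendreGen r (inner ℝ (ω : E3) (ω' : E3)) ^ 3
    - l * legendreGen r (inner ℝ (ω : E3) (ω' : E3)))

/-- The derivative of `radialFlux` in `r`. -/
def radialFluxDeriv (l : ℕ) (p : MvPolynomial (Fin 3) ℝ) (ω : S2) (r : ℝ) (ω' : S2) : ℝ :=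
  polyFun p ω' *
    ((inner ℝ (ω : E3) (ω' : E3) - 2 * r) * legendreGen r (inner ℝ (ω : E3) (ω' : E3)) ^ 3
    + 3 * r * (inner ℝ (ω : E3) (ω' : E3) - r) ^ 2 *
      legendreGen r (inner ℝ (ω : E3) (ω' : E3)) ^ 5
    - l * (inner ℝ (ω : E3) (ω' : E3) - r) * legendreGen r (inner ℝ (ω : E3) (ω' : E3)) ^ 3)

theorem continuous_radialFlux (l : ℕ) (p : MvPolynomial (Fin 3) ℝ) (ω : S2) {r : ℝ}
    (hr : r ∈ Ioo (-1 : ℝ) 1) : Continuous (radialFlux l p ω r) := by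
  have hK := continuous_legendreGen ω (abs_lt.2 hr)
  have ht : Continuous fun ω' : S2 => inner ℝ (ω : E3) (ω' : E3) := by fun_prop
  exact (continuous_polyFun p).mul ((((ht.sub continuous_const).const_mul r).mul (hK.pow 3)).sub
    (hK.const_mul _))

theorem continuousOn_radialFluxDeriv (l : ℕ) (p : MvPolynomial (Fin 3) ℝ) (ω : S2) :
    ContinuousOn (fun q : ℝ × S2 => radialFluxDeriv l p ω q.1 q.2) (Ioo (-1) 1 ×ˢ univ) := by
  have hK := continuousOn_legendreGen ω
  have ht : ContinuousOn (fun q : ℝ × S2 => inner ℝ (ω : E3) (q.2 : E3)) (Ioo (-1) 1 ×ˢ univ) := by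
    fun_prop
  have hq : ContinuousOn (fun q : ℝ × S2 => q.1) (Ioo (-1) 1 ×ˢ univ) := by fun_prop
  have hpc : ContinuousOn (fun q : ℝ × S2 => polyFun p q.2) (Ioo (-1) 1 ×ˢ univ) :=
    ((continuous_polyFun p).comp continuous_snd).continuousOn
  exact hpc.mul ((((ht.sub (hq.const_mul 2)).mul (hK.pow 3)).add
    (((hq.const_mul 3).mul ((ht.sub hq).pow 2)).mul (hK.pow 5))).sub
    (((ht.sub hq).const_mul (l : ℝ)).mul (hK.pow 3)))

theorem hasDerivAt_radialFlux (l : ℕ) (p : MvPolynomial (Fin 3) ℝ) (ω ω' : S2) {r : ℝ}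
    (hr : r ∈ Ioo (-1 : ℝ) 1) :
    HasDerivAt (fun r => radialFlux l p ω r ω') (radialFluxDeriv l p ω r ω') r := by
  unfold radialFlux radialFluxDeriv
  have hq := legendreGen_radicand_pos (abs_lt.2 hr) (abs_inner_coe_le ω ω')
  set t : ℝ := inner ℝ (ω : E3) (ω' : E3)
  have hk := HasDerivAt.legendreGen (hasDerivAt_id' r) (hasDerivAt_const r t) hq
  have h := ((((hasDerivAt_id' r).mul ((hasDerivAt_id' r).const_sub t)).mul (hk.pow 3)).sub
    (hk.const_mul (l : ℝ))).const_mul (polyFun p ω')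
  refine h.congr_deriv ?_
  simp only [Pi.mul_apply, Pi.pow_apply, Nat.cast_ofNat]
  ring

/-- Since `κ` is harmonic, `(r∂ᵣ)²κ + r∂ᵣκ = -Δκ` with `Δ` the spherical Laplacian. The operator
`(r∂ᵣ)² + r∂ᵣ - l(l + 1)` factors as `(r∂ᵣ + l + 1)(r∂ᵣ - l)`, and `radialFlux` is what the second
factor produces. -/
theorem integral_radialFlux_add {l : ℕ} {p : MvPolynomial (Fin 3) ℝ} (hp : p.IsHomogeneous l)
    (hΔ : ∑ i : Fin 3, MvPolynomial.pderiv i (MvPolynomial.pderiv i p) = 0) (ω : S2) {r : ℝ}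
    (hr : r ∈ Ioo (-1 : ℝ) 1) :
    ∫ ω', ((l + 1) * radialFlux l p ω r ω' + r * radialFluxDeriv l p ω r ω') ∂surf = 0 := by
  refine Eq.trans ?_ (neg_eq_zero.2 (integral_legendre_operator hp hΔ ω (abs_lt.2 hr)))
  rw [← integral_neg]
  refine integral_congr_ae (.of_forall fun ω' => ?_)
  have hq := legendreGen_sq (legendreGen_radicand_pos (abs_lt.2 hr) (abs_inner_coe_le ω ω'))
  simp only [radialFlux, radialFluxDeriv]
  set k := legendreGen r (inner ℝ (ω : E3) (ω' : E3))
  set t : ℝ := inner ℝ (ω : E3) (ω' : E3)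
  linear_combination (polyFun p ω' * 3 * r ^ 2 * k ^ 3) * hq

theorem hasDerivAt_pow_mul_integral_radialFlux {l : ℕ} {p : MvPolynomial (Fin 3) ℝ}
    (hp : p.IsHomogeneous l)
    (hΔ : ∑ i : Fin 3, MvPolynomial.pderiv i (MvPolynomial.pderiv i p) = 0) (ω : S2) {r : ℝ}
    (hr : r ∈ Ioo (-1 : ℝ) 1) :
    HasDerivAt (fun r => r ^ (l + 1) * ∫ ω', radialFlux l p ω r ω' ∂surf) 0 r := by
  have h1 := hasDerivAt_integral_sphere isOpen_Ioo (fun r hr => continuous_radialFlux l p ω hr)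
    (continuousOn_radialFluxDeriv l p ω) (fun r hr ω' => hasDerivAt_radialFlux l p ω ω' hr) hr
  refine ((hasDerivAt_pow (l + 1) r).mul h1).congr_deriv ?_
  have hf'r : Continuous (radialFluxDeriv l p ω r) :=
    continuous_slice (f := radialFluxDeriv l p ω) (continuousOn_radialFluxDeriv l p ω) hr
  have h2 := integral_radialFlux_add hp hΔ ω hr
  rw [integral_add ((integrable_of_continuous (continuous_radialFlux l p ω hr)).const_mul _)
    ((integrable_of_continuous hf'r).const_mul _), integral_const_mul, integral_const_mul] at h2
  simp only [Nat.add_sub_cancel]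
  push_cast
  linear_combination r ^ l * h2

/-- The first-order equation makes `r ^ (l + 1)` times the integral constant on `(-1, 1)`. It
vanishes at `r = 0`, which rules out the singular solution `r ^ (-(l + 1))`. -/
theorem integral_radialFlux_eq_zero {l : ℕ} {p : MvPolynomial (Fin 3) ℝ} (hp : p.IsHomogeneous l)
    (hΔ : ∑ i : Fin 3, MvPolynomial.pderiv i (MvPolynomial.pderiv i p) = 0) (ω : S2) {r : ℝ}
    (hr0 : 0 < r) (hr : r < 1) : ∫ ω', radialFlux l p ω r ω' ∂surf = 0 := by
  have hB := fun r hr => hasDerivAt_pow_mul_integral_radialFlux hp hΔ ω (r := r) hr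
  have hconst := IsOpen.is_const_of_deriv_eq_zero isOpen_Ioo isPreconnected_Ioo
    (fun r hr => (hB r hr).differentiableAt.differentiableWithinAt)
    (fun r hr => (hB r hr).deriv) (show r ∈ Ioo (-1 : ℝ) 1 from ⟨by linarith, hr⟩)
    (show (0 : ℝ) ∈ Ioo (-1 : ℝ) 1 by simp)
  rw [zero_pow (Nat.succ_ne_zero l), zero_mul] at hconst
  exact (mul_eq_zero.1 hconst).resolve_left (pow_pos hr0 _).ne'

/-- Combine the vanishing of `∫ p (r∂ᵣκ - lκ)` with the pointwise identity `2r∂ᵣκ + κ = (1 - r²)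
κ³`, whose right side is the Poisson kernel up to normalization. -/
theorem integral_poisson {l : ℕ} {p : MvPolynomial (Fin 3) ℝ} (hp : p.IsHomogeneous l)
    (hΔ : ∑ i : Fin 3, MvPolynomial.pderiv i (MvPolynomial.pderiv i p) = 0) (ω : S2) {r : ℝ}
    (hr0 : 0 < r) (hr : r < 1) :
    (2 * l + 1) * ∫ ω' : S2, polyFun p ω' * legendreGen r (inner ℝ (ω : E3) (ω' : E3)) ∂surf =
      (1 - r ^ 2) *
        ∫ ω' : S2, polyFun p ω' * legendreGen r (inner ℝ (ω : E3) (ω' : E3)) ^ 3 ∂surf := by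
  have hr' : |r| < 1 := by rw [abs_of_pos hr0]; exact hr
  have hK := continuous_legendreGen ω hr'
  have h := integral_radialFlux_eq_zero hp hΔ ω hr0 hr
  have i1 : Integrable (fun ω' : S2 => polyFun p ω' *
      legendreGen r (inner ℝ (ω : E3) (ω' : E3))) surf :=
    integrable_of_continuous ((continuous_polyFun p).mul hK)
  have i3 : Integrable (fun ω' : S2 => polyFun p ω' *
      legendreGen r (inner ℝ (ω : E3) (ω' : E3)) ^ 3) surf :=
    integrable_of_continuous ((continuous_polyFun p).mul (hK.pow 3))
  rw [← sub_eq_zero, ← integral_const_mul, ← integral_const_mul, ← integral_sub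
    (i1.const_mul _) (i3.const_mul _)]
  have h2 := congrArg (fun x => -2 * x) h
  simp only [mul_zero, ← integral_const_mul] at h2
  rw [← h2]
  refine integral_congr_ae (.of_forall fun ω' => ?_)
  have hq := legendreGen_sq (legendreGen_radicand_pos hr' (abs_inner_coe_le ω ω'))
  simp only [radialFlux]
  set k := legendreGen r (inner ℝ (ω : E3) (ω' : E3))
  set t : ℝ := inner ℝ (ω : E3) (ω' : E3)
  linear_combination -(polyFun p ω' * k) * hq

/-! ### The single layer potential of a spherical harmonic -/

theorem polyFun_one (x : E3) : polyFun 1 x = 1 := by simp [polyFun]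

theorem isHomogeneous_one : (1 : MvPolynomial (Fin 3) ℝ).IsHomogeneous 0 :=
  MvPolynomial.isHomogeneous_one _ _

theorem laplace_one :
    ∑ i : Fin 3, MvPolynomial.pderiv i (MvPolynomial.pderiv i (1 : MvPolynomial (Fin 3) ℝ)) = 0 := by
  simp

theorem integral_inner_eq_zero (ω : S2) : ∫ ω' : S2, inner ℝ (ω : E3) (ω' : E3) ∂surf = 0 := by
  have h := integral_rotPoint (LinearIsometryEquiv.neg ℝ) fun ω' => inner ℝ (ω : E3) (ω' : E3)
  have h2 : ∫ ω' : S2, inner ℝ (ω : E3) (rotPoint (LinearIsometryEquiv.neg ℝ) ω' : E3) ∂surf =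
      -∫ ω' : S2, inner ℝ (ω : E3) (ω' : E3) ∂surf := by
    rw [← integral_neg]
    refine integral_congr_ae (.of_forall fun ω' => ?_)
    simp [rotPoint]
  rw [h2] at h
  linarith

/-- For `r > 0` this is the degree-zero case of `integral_radialFlux_eq_zero` divided by `r`; at `r
= 0` the derivative is the integral of the odd function `t`. -/
theorem hasDerivAt_integral_legendreGen (ω : S2) {r : ℝ} (h0 : 0 ≤ r) (h1 : r < 1) :
    HasDerivAt (fun r => ∫ ω' : S2, legendreGen r (inner ℝ (ω : E3) (ω' : E3)) ∂surf) 0 r := by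
  have hK := continuousOn_legendreGen ω
  have ht : ContinuousOn (fun q : ℝ × S2 => inner ℝ (ω : E3) (q.2 : E3) - q.1)
      (Ioo (-1) 1 ×ˢ univ) := by fun_prop
  have h := hasDerivAt_integral_sphere (f := fun r ω' => legendreGen r (inner ℝ (ω : E3) (ω' : E3)))
    (f' := fun r ω' => legendreGen r (inner ℝ (ω : E3) (ω' : E3)) ^ 3 *
      (inner ℝ (ω : E3) (ω' : E3) - r)) (isOpen_Ioo (a := -1) (b := 1))
    (fun r hr => continuous_legendreGen ω (abs_lt.2 hr)) ((hK.pow 3).mul ht)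
    (fun r hr ω' => by
      have := HasDerivAt.legendreGen (hasDerivAt_id' r)
        (hasDerivAt_const r (inner ℝ (ω : E3) (ω' : E3)))
        (legendreGen_radicand_pos (abs_lt.2 hr) (abs_inner_coe_le ω ω'))
      refine this.congr_deriv ?_
      ring) (show r ∈ Ioo (-1 : ℝ) 1 from ⟨by linarith, h1⟩)
  refine h.congr_deriv ?_
  rcases h0.eq_or_lt with rfl | hr0
  · refine Eq.trans ?_ (integral_inner_eq_zero ω)
    refine integral_congr_ae (.of_forall fun ω' => ?_)
    simp [legendreGen]
  · have h2 := integral_radialFlux_eq_zero isHomogeneous_one laplace_one ω hr0 h1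
    have h3 : ∫ ω', radialFlux 0 1 ω r ω' ∂surf = r * ∫ ω' : S2,
        legendreGen r (inner ℝ (ω : E3) (ω' : E3)) ^ 3 * (inner ℝ (ω : E3) (ω' : E3) - r) ∂surf := by
      rw [← integral_const_mul]
      refine integral_congr_ae (.of_forall fun ω' => ?_)
      simp only [radialFlux, polyFun_one, CharP.cast_eq_zero]
      ring
    rw [h3] at h2
    exact (mul_eq_zero.1 h2).resolve_left hr0.ne'

theorem integral_legendreGen (ω : S2) {r : ℝ} (h0 : 0 ≤ r) (h1 : r < 1) :
    ∫ ω' : S2, legendreGen r (inner ℝ (ω : E3) (ω' : E3)) ∂surf = 4 * Real.pi := by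
  have h := constant_of_has_deriv_right_zero
    (f := fun r => ∫ ω' : S2, legendreGen r (inner ℝ (ω : E3) (ω' : E3)) ∂surf) (a := 0) (b := r)
    (fun s hs => (hasDerivAt_integral_legendreGen ω hs.1
      (hs.2.trans_lt h1)).continuousAt.continuousWithinAt)
    (fun s hs => (hasDerivAt_integral_legendreGen ω hs.1 (hs.2.trans h1)).hasDerivWithinAt)
    r ⟨h0, le_rfl⟩
  rw [h, ← surf_real_univ]
  simp [legendreGen]

theorem norm_sub_smul_ge {r : ℝ} (h1 : r ≤ 1) (h0 : 0 ≤ r) (ω ω' : S2) :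
    1 - r ≤ ‖(ω : E3) - r • (ω' : E3)‖ := by
  have := norm_sub_norm_le (ω : E3) (r • (ω' : E3))
  rwa [norm_coe, norm_smul_coe, abs_of_nonneg h0] at this

theorem norm_sub_le_two_mul {r : ℝ} (h1 : r ≤ 1) (h0 : 0 ≤ r) (ω ω' : S2) :
    ‖(ω : E3) - ω'‖ ≤ 2 * ‖(ω : E3) - r • (ω' : E3)‖ := by
  have h : (ω : E3) - ω' = ((ω : E3) - r • (ω' : E3)) + (r - 1) • (ω' : E3) := by module
  have h2 := norm_add_le ((ω : E3) - r • (ω' : E3)) ((r - 1) • (ω' : E3))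
  rw [← h, norm_smul_coe, abs_sub_comm, abs_of_nonneg (by linarith)] at h2
  linarith [norm_sub_smul_ge h1 h0 ω ω']

/-- Dominated convergence, with majorant `2 / |ω - ω'|` for the kernel as `r` increases to `1`. -/
theorem tendsto_integral_legendreGen (ω : S2) (u : C(S2, ℝ)) :
    Tendsto (fun r => ∫ ω' : S2, u ω' * legendreGen r (inner ℝ (ω : E3) (ω' : E3)) ∂surf)
      (𝓝[<] 1) (𝓝 (singleLayer ω u)) := by
  have hev : ∀ᶠ r : ℝ in 𝓝[<] 1, 0 < r ∧ r < 1 := by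
    have : Ioo (0 : ℝ) 1 ∈ 𝓝[<] (1 : ℝ) := Ioo_mem_nhdsLT one_pos
    exact this
  rw [singleLayer_apply]
  refine tendsto_integral_filter_of_dominated_convergence
    (fun ω' : S2 => ‖u‖ * (2 * ‖(ω : E3) - ω'‖⁻¹)) ?_ ?_ ?_ ?_
  · filter_upwards [hev] with r hr
    have := continuous_legendreGen ω (r := r) (by rw [abs_of_pos hr.1]; exact hr.2)
    exact (u.continuous.mul this).aestronglyMeasurable
  · filter_upwards [hev] with r hr
    filter_upwards [ae_ne ω] with ω' hω'
    rw [legendreGen_inner, norm_mul, norm_inv, norm_norm]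
    have hd := norm_sub_pos hω'
    have hD := norm_sub_le_two_mul hr.2.le hr.1.le ω ω'
    have hD0 := norm_sub_smul_pos hω' hr.1.le
    gcongr
    · exact u.norm_coe_le_norm ω'
    · rw [inv_le_iff_one_le_mul₀ hD0]
      field_simp
      linarith
  · exact ((integrable_sphere_inv_dist ω).const_mul 2).const_mul _
  · filter_upwards [ae_ne ω] with ω' hω'
    simp only [legendreGen_inner, div_eq_mul_inv]
    have hd := norm_sub_pos hω'
    have hc : ContinuousAt (fun r : ℝ => u ω' * ‖(ω : E3) - r • (ω' : E3)‖⁻¹) 1 := by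
      refine ContinuousAt.mul continuousAt_const (ContinuousAt.inv₀ (by fun_prop) ?_)
      simpa using hd.ne'
    have := hc.tendsto
    simp only [one_smul] at this
    exact this.mono_left nhdsWithin_le_nhds

theorem exists_lipschitz_polyFun (p : MvPolynomial (Fin 3) ℝ) :
    ∃ K : ℝ, 0 ≤ K ∧ ∀ ω ω' : S2, |polyFun p ω' - polyFun p ω| ≤ K * ‖(ω : E3) - ω'‖ := by
  obtain ⟨K, hK⟩ := LocallyLipschitzOn.exists_lipschitzOnWith_of_compact
    (isCompact_sphere (0 : E3) 1)
    (contDiff_polyFun (n := 1) p).locallyLipschitz.locallyLipschitzOn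
  refine ⟨K, K.2, fun ω ω' => ?_⟩
  have := hK.dist_le_mul _ ω'.2 _ ω.2
  rwa [Real.dist_eq, dist_eq_norm, norm_sub_rev] at this

/-- Split `D⁻³` into three powers: `D⁻¹` absorbs `d`, `D ^ (-1/2)` is bounded through `e`, and `D ^
(-3/2)` through `d`. With `e = 1 - r` the prefactor `1 - r²` beats `e ^ (-1/2)`. -/
theorem poisson_kernel_bound {d D e : ℝ} (hd : 0 < d) (he : 0 < e) (heD : e ≤ D)
    (hdD : d ≤ 2 * D) : d * D⁻¹ ^ 3 ≤ 8 * (√e)⁻¹ * d ^ (-(3 / 2) : ℝ) := by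
  have hD : 0 < D := he.trans_le heD
  have h1 : D⁻¹ ^ 3 = D⁻¹ * (D ^ (-(1 / 2) : ℝ) * D ^ (-(3 / 2) : ℝ)) := by
    rw [← Real.rpow_neg_one, ← Real.rpow_natCast, ← Real.rpow_mul hD.le, ← Real.rpow_add hD,
      ← Real.rpow_add hD]
    norm_num
  have h2 : D ^ (-(1 / 2) : ℝ) ≤ (√e)⁻¹ := by
    rw [Real.sqrt_eq_rpow, ← Real.rpow_neg he.le]
    exact Real.rpow_le_rpow_of_nonpos he heD (by norm_num)
  have h3 : D ^ (-(3 / 2) : ℝ) ≤ 4 * d ^ (-(3 / 2) : ℝ) := by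
    have f1 : D ^ (-(3 / 2) : ℝ) ≤ (d / 2) ^ (-(3 / 2) : ℝ) :=
      Real.rpow_le_rpow_of_nonpos (by positivity) (by linarith) (by norm_num)
    have f2 : (d / 2) ^ (-(3 / 2) : ℝ) = 2 ^ (3 / 2 : ℝ) * d ^ (-(3 / 2) : ℝ) := by
      rw [div_eq_inv_mul, Real.mul_rpow (by norm_num) hd.le, Real.inv_rpow (by norm_num),
        ← Real.rpow_neg (by norm_num), neg_neg]
    have f3 : (2 : ℝ) ^ (3 / 2 : ℝ) ≤ 4 := by
      calc (2 : ℝ) ^ (3 / 2 : ℝ) ≤ 2 ^ (2 : ℝ) :=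
            Real.rpow_le_rpow_of_exponent_le (by norm_num) (by norm_num)
        _ = 4 := by norm_num
    rw [f2] at f1
    refine f1.trans ?_
    gcongr
  have h4 : d * D⁻¹ ≤ 2 := by
    rw [← div_eq_mul_inv, div_le_iff₀ hD]; exact hdD
  calc d * D⁻¹ ^ 3 = (d * D⁻¹) * (D ^ (-(1 / 2) : ℝ) * D ^ (-(3 / 2) : ℝ)) := by rw [h1]; ring
    _ ≤ 2 * ((√e)⁻¹ * (4 * d ^ (-(3 / 2) : ℝ))) := by gcongr
    _ = _ := by ring

/-- The Poisson kernel is an approximate identity. The Lipschitz bound for the polynomial cancels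
one power of the singularity, and the error is `O(√(1 - r))`. -/
theorem tendsto_poisson_sub (p : MvPolynomial (Fin 3) ℝ) (ω : S2) :
    Tendsto (fun r : ℝ => (1 - r ^ 2) * ∫ ω' : S2, (polyFun p ω' - polyFun p ω) *
      legendreGen r (inner ℝ (ω : E3) (ω' : E3)) ^ 3 ∂surf) (𝓝[<] 1) (𝓝 0) := by
  obtain ⟨K, hK0, hK⟩ := exists_lipschitz_polyFun p
  set I := ∫ ω' : S2, ‖(ω : E3) - ω'‖ ^ (-(3 / 2) : ℝ) ∂surf
  have hI : 0 ≤ I := integral_nonneg fun ω' => by positivity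
  have hlim : Tendsto (fun r : ℝ => 16 * K * I * √(1 - r)) (𝓝[<] 1) (𝓝 0) := by
    have : ContinuousAt (fun r : ℝ => 16 * K * I * √(1 - r)) 1 := by fun_prop
    have h2 := this.tendsto
    simp only [sub_self, Real.sqrt_zero, mul_zero] at h2
    exact h2.mono_left nhdsWithin_le_nhds
  refine squeeze_zero_norm' ?_ hlim
  filter_upwards [Ioo_mem_nhdsLT (one_pos : (0 : ℝ) < 1)] with r hr
  have he : 0 < 1 - r := by linarith [hr.2]
  have hint := (integrable_sphere_dist_rpow ω).const_mul (K * (8 * (√(1 - r))⁻¹))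
  have h1 : ‖∫ ω' : S2, (polyFun p ω' - polyFun p ω) *
      legendreGen r (inner ℝ (ω : E3) (ω' : E3)) ^ 3 ∂surf‖ ≤ K * (8 * (√(1 - r))⁻¹) * I := by
    refine (norm_integral_le_of_norm_le hint ?_).trans_eq (integral_const_mul _ _)
    filter_upwards [ae_ne ω] with ω' hω'
    have hd := norm_sub_pos hω'
    have hb := poisson_kernel_bound hd he (norm_sub_smul_ge hr.2.le hr.1.le ω ω')
      (norm_sub_le_two_mul hr.2.le hr.1.le ω ω')
    rw [legendreGen_inner, norm_mul, Real.norm_eq_abs, norm_pow, norm_inv, norm_norm]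
    calc |polyFun p ω' - polyFun p ω| * ‖(ω : E3) - r • (ω' : E3)‖⁻¹ ^ 3
        ≤ K * ‖(ω : E3) - ω'‖ * ‖(ω : E3) - r • (ω' : E3)‖⁻¹ ^ 3 := by
          gcongr; exact hK ω ω'
      _ = K * (‖(ω : E3) - ω'‖ * ‖(ω : E3) - r • (ω' : E3)‖⁻¹ ^ 3) := by ring
      _ ≤ K * (8 * (√(1 - r))⁻¹ * ‖(ω : E3) - ω'‖ ^ (-(3 / 2) : ℝ)) := by gcongr
      _ = _ := by ring
  have h2 : ‖1 - r ^ 2‖ ≤ 2 * (1 - r) := by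
    rw [Real.norm_of_nonneg (by nlinarith [hr.1, hr.2])]
    nlinarith [hr.1, hr.2]
  rw [norm_mul]
  have hs := Real.sqrt_pos.2 he
  have hss := Real.mul_self_sqrt he.le
  calc ‖1 - r ^ 2‖ * _ ≤ 2 * (1 - r) * (K * (8 * (√(1 - r))⁻¹) * I) := by gcongr
    _ = 16 * K * I * ((1 - r) * (√(1 - r))⁻¹) := by ring
    _ = 16 * K * I * √(1 - r) := by
      congr 1
      rw [← div_eq_mul_inv, div_eq_iff hs.ne', hss]

/-- A polynomial as a continuous function on the sphere. -/
def polyC (p : MvPolynomial (Fin 3) ℝ) : C(S2, ℝ) := ⟨fun ω => polyFun p ω, continuous_polyFun p⟩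

/-- Let `r → 1` in `integral_poisson`. The degree-zero case says that the kernel `(1 - r²) κ³` has
total mass `4π`, so freezing the polynomial at `ω` yields the right side. -/
theorem singleLayer_polyC {l : ℕ} {p : MvPolynomial (Fin 3) ℝ} (hp : p.IsHomogeneous l)
    (hΔ : ∑ i : Fin 3, MvPolynomial.pderiv i (MvPolynomial.pderiv i p) = 0) (ω : S2) :
    (2 * l + 1) * singleLayer ω (polyC p) = 4 * Real.pi * polyFun p ω := by
  have h1 := (tendsto_integral_legendreGen ω (polyC p)).const_mul (2 * (l : ℝ) + 1)
  have h2 := (tendsto_poisson_sub p ω).add_const (4 * Real.pi * polyFun p ω)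
  rw [zero_add] at h2
  refine tendsto_nhds_unique (h1.congr' ?_) h2
  filter_upwards [Ioo_mem_nhdsLT (one_pos : (0 : ℝ) < 1)] with r hr
  have hr' : |r| < 1 := by rw [abs_of_pos hr.1]; exact hr.2
  have hK := continuous_legendreGen ω hr'
  have hP := integral_poisson hp hΔ ω hr.1 hr.2
  have hP1 := integral_poisson isHomogeneous_one laplace_one ω hr.1 hr.2
  simp only [polyFun_one, one_mul, CharP.cast_eq_zero, mul_zero, zero_add] at hP1
  rw [integral_legendreGen ω hr.1.le hr.2] at hP1
  refine hP.trans ?_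
  have i1 : Integrable (fun ω' : S2 => polyFun p ω' *
      legendreGen r (inner ℝ (ω : E3) (ω' : E3)) ^ 3) surf :=
    integrable_of_continuous ((continuous_polyFun p).mul (hK.pow 3))
  have i2 : Integrable (fun ω' : S2 => polyFun p ω *
      legendreGen r (inner ℝ (ω : E3) (ω' : E3)) ^ 3) surf :=
    integrable_of_continuous ((hK.pow 3).const_mul _)
  simp only [sub_mul]
  rw [integral_sub i1 i2, integral_const_mul]
  linear_combination -(polyFun p ω) * hP1

theorem singleLayer_one (ω : S2) : singleLayer ω 1 = 4 * Real.pi := by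
  have h := singleLayer_polyC isHomogeneous_one laplace_one ω
  have h2 : polyC 1 = 1 := by ext x; exact polyFun_one _
  rw [h2, polyFun_one] at h
  simpa using h

/-- The potential of the unit ball at its boundary. Integrating over the angle first, each shell of
radius `r < 1` contributes `4π r²` (Newton's theorem, in the form of `integral_legendreGen`), and
`∫₀¹ 4π r² dr = 4π/3`. -/
theorem starPotential_one (ω : S2) : starPotential ω 1 = 4 * Real.pi / 3 := by
  have hi := integrable_indicator_Omega (ω : E3) 1
  have h1 : starPotential ω 1 = ∫ y, (Omega (1 : C(S2, ℝ))).indicator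
      (fun y => 1 / ‖(ω : E3) - y‖) y := by
    rw [integral_polar hi, starPotential]
    refine integral_congr_ae (.of_forall fun ω' => ?_)
    have := integral_ray_Omega (φ := (1 : C(S2, ℝ))) (fun _ => by simp) one_pos ω ω'
    simp only [one_smul, inv_one, one_mul, one_pow] at this
    exact this.symm
  rw [h1, polar_integral, integral_prod_symm _ ((polar_integrable_iff _).1 hi)]
  have h2 := integral_volumeIoiPow fun r => ∫ ω' : S2, (Omega (1 : C(S2, ℝ))).indicator
      (fun y => 1 / ‖(ω : E3) - y‖) (r • (ω' : E3)) ∂surf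
  refine h2.trans ?_
  have h3 : ∀ r ∈ Ioi (0 : ℝ), (r ^ 2 * ∫ ω' : S2, (Omega (1 : C(S2, ℝ))).indicator
      (fun y => 1 / ‖(ω : E3) - y‖) (r • (ω' : E3)) ∂surf) =
      (Ioo (0 : ℝ) 1).indicator (fun r => r ^ 2 * (4 * Real.pi)) r := by
    intro r (hr : 0 < r)
    by_cases h : r < 1
    · rw [indicator_of_mem (show r ∈ Ioo (0 : ℝ) 1 from ⟨hr, h⟩), ← integral_legendreGen ω hr.le h]
      congr 1
      refine integral_congr_ae (.of_forall fun ω' => ?_)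
      simp only [indicator_of_mem ((smul_mem_Omega_iff (1 : C(S2, ℝ)) hr ω').2 h),
        legendreGen_inner, one_div]
    · rw [indicator_of_notMem fun h' : r ∈ Ioo (0 : ℝ) 1 => h h'.2]
      have : ∀ ω' : S2, (Omega (1 : C(S2, ℝ))).indicator (fun y => 1 / ‖(ω : E3) - y‖)
          (r • (ω' : E3)) = 0 := fun ω' =>
        indicator_of_notMem (fun h' => h ((smul_mem_Omega_iff (1 : C(S2, ℝ)) hr ω').1 h')) _
      simp only [this, integral_zero, mul_zero]
  rw [setIntegral_congr_fun measurableSet_Ioi h3, setIntegral_indicator measurableSet_Ioo,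
    inter_eq_self_of_subset_right (fun r hr => hr.1), ← integral_Ioc_eq_integral_Ioo,
    ← intervalIntegral.integral_of_le zero_le_one, intervalIntegral.integral_mul_const, integral_pow]
  norm_num
  ring

/-- The coefficient of `u(ω)` is `2R · 4π/3 - 4πR = -4πR/3`. -/
theorem hasStrictFDerivAt_boundaryPotential_const (ω : S2) {R : ℝ} (hR : 0 < R) :
    HasStrictFDerivAt (boundaryPotential ω)
      (R • singleLayer ω - (4 * Real.pi / 3 * R) • evalAt ω) (ContinuousMap.const S2 R) := by
  refine (hasStrictFDerivAt_boundaryPotential ω hR).congr_fderiv ?_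
  rw [starPotential_one, singleLayer_one]
  ext u
  simp only [ContinuousLinearMap.add_apply, ContinuousLinearMap.sub_apply,
    ContinuousLinearMap.smul_apply, smul_eq_mul]
  ring

/-! ### Partial derivatives of the ray-constant extension -/

/-- The `i`-th standard unit vector. -/
abbrev stdVec (i : Fin 3) : E3 := EuclideanSpace.single i 1

/-- `∂ᵢ` of the ray-constant extension. -/
def d1 (f : S2 → ℝ) (i : Fin 3) (x : E3) : ℝ := fderiv ℝ (ext f) x (stdVec i)

/-- `∂ⱼ∂ᵢ` of the ray-constant extension. -/
def d2 (f : S2 → ℝ) (i j : Fin 3) (x : E3) : ℝ := fderiv ℝ (d1 f i) x (stdVec j)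

theorem gradient_apply (f : E3 → ℝ) (x : E3) (i : Fin 3) :
    gradient f x i = fderiv ℝ f x (stdVec i) := by
  rw [← inner_gradient_left (𝕜 := ℝ) (f := f), EuclideanSpace.inner_single_right]
  simp

theorem grad_apply (f : S2 → ℝ) (ω : S2) (i : Fin 3) : grad f ω i = d1 f i ω :=
  gradient_apply _ _ _

theorem norm_grad_sq (f : S2 → ℝ) (ω : S2) : ‖grad f ω‖ ^ 2 = ∑ i, d1 f i ω ^ 2 := by
  rw [EuclideanSpace.norm_sq_eq]
  refine Finset.sum_congr rfl fun i _ => ?_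
  rw [grad_apply, Real.norm_eq_abs, sq_abs]

theorem ext_smul_pos (f : S2 → ℝ) {c : ℝ} (hc : 0 < c) (x : E3) : ext f (c • x) = ext f x := by
  by_cases hx : x = 0
  · simp [hx]
  · have hcx : c • x ≠ 0 := smul_ne_zero hc.ne' hx
    rw [ext, ext, dif_pos hx, dif_pos hcx]
    congr 1
    apply Subtype.ext
    simp only [proj, norm_smul, Real.norm_of_nonneg hc.le, smul_smul]
    congr 1
    have := norm_pos_iff.2 hx
    field_simp

/-- The extension is homogeneous of degree `0`, so its first derivatives are homogeneous of degree
`-1`. This is why powers of `‖x‖` appear when spherical gradients are extended off the sphere. -/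
theorem d1_smul (f : S2 → ℝ) (i : Fin 3) {c : ℝ} (hc : 0 < c) (x : E3) :
    d1 f i x = c * d1 f i (c • x) := by
  have h := fderiv_comp_smul (f := ext f) (x := x) c
  simp only [ext_smul_pos f hc] at h
  rw [d1, h]
  rfl

theorem d1_proj (f : S2 → ℝ) (i : Fin 3) {x : E3} (hx : x ≠ 0) :
    d1 f i (proj x hx) = ‖x‖ * d1 f i x := by
  have hn := norm_pos_iff.2 hx
  rw [d1_smul f i (inv_pos.2 hn) x, mul_inv_cancel_left₀ hn.ne']
  rfl

theorem fderiv_radial (f : S2 → ℝ) (ω : S2) : fderiv ℝ (ext f) (ω : E3) (ω : E3) = 0 := by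
  by_cases hd : DifferentiableAt ℝ (ext f) (ω : E3)
  · have hc : HasDerivAt (fun t : ℝ => t • (ω : E3)) (ω : E3) 1 := by
      simpa using (hasDerivAt_id (1 : ℝ)).smul_const (ω : E3)
    have hd' : HasFDerivAt (ext f) (fderiv ℝ (ext f) (ω : E3)) ((1 : ℝ) • (ω : E3)) := by
      rw [one_smul]; exact hd.hasFDerivAt
    have h := hd'.comp_hasDerivAt (1 : ℝ) hc
    have h2 : (ext f ∘ fun t : ℝ => t • (ω : E3)) =ᶠ[𝓝 1] fun _ => f ω := by
      filter_upwards [lt_mem_nhds (zero_lt_one' ℝ)] with t ht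
      exact ext_smul_coe f ht ω
    exact (h.congr_of_eventuallyEq h2.symm).unique (hasDerivAt_const _ _)
  · rw [fderiv_zero_of_not_differentiableAt hd]; rfl

theorem sum_mul_d1 (f : S2 → ℝ) (ω : S2) : ∑ i, (ω : E3) i * d1 f i ω = 0 := by
  have h : (ω : E3) = ∑ i, (ω : E3) i • stdVec i := by
    have := (EuclideanSpace.basisFun (Fin 3) ℝ).sum_repr (ω : E3)
    simpa using this.symm
  have h2 := fderiv_radial f ω
  nth_rewrite 2 [h] at h2
  simpa [map_sum, d1] using h2

/-- Regularity used below: the ray-constant extension is `C²` off the origin. -/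
def ExtC2 (f : S2 → ℝ) : Prop := ContDiffOn ℝ 2 (ext f) {0}ᶜ

theorem ExtC2.contDiffAt {f : S2 → ℝ} (hf : ExtC2 f) {x : E3} (hx : x ≠ 0) :
    ContDiffAt ℝ 2 (ext f) x := ContDiffOn.contDiffAt hf (isOpen_compl_singleton.mem_nhds hx)

theorem ExtC2.differentiableAt {f : S2 → ℝ} (hf : ExtC2 f) {x : E3} (hx : x ≠ 0) :
    DifferentiableAt ℝ (ext f) x := (hf.contDiffAt hx).differentiableAt (by norm_num)

theorem ExtC2.differentiableAt_fderiv {f : S2 → ℝ} (hf : ExtC2 f) {x : E3} (hx : x ≠ 0) :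
    DifferentiableAt ℝ (fderiv ℝ (ext f)) x :=
  ((hf.contDiffAt hx).fderiv_right (m := 1) (by norm_num)).differentiableAt (by norm_num)

theorem ExtC2.differentiableAt_d1 {f : S2 → ℝ} (hf : ExtC2 f) (i : Fin 3) {x : E3} (hx : x ≠ 0) :
    DifferentiableAt ℝ (d1 f i) x :=
  (hf.differentiableAt_fderiv hx).clm_apply (differentiableAt_const _)

theorem ExtC2.d2_eq {f : S2 → ℝ} (hf : ExtC2 f) (i j : Fin 3) {x : E3} (hx : x ≠ 0) :
    d2 f i j x = iteratedFDeriv ℝ 2 (ext f) x ![stdVec j, stdVec i] := by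
  rw [iteratedFDeriv_two_apply, d2]
  have h := (hf.differentiableAt_fderiv hx).hasFDerivAt.clm_apply
    (hasFDerivAt_const (stdVec i) x)
  have h2 : fderiv ℝ (d1 f i) x = _ := h.fderiv
  rw [h2]
  simp

theorem d1_eq (f : S2 → ℝ) (i : Fin 3) (x : E3) :
    d1 f i x = iteratedFDeriv ℝ 1 (ext f) x ![stdVec i] := by
  rw [iteratedFDeriv_one_apply]
  rfl

theorem hasFDerivAt_norm_coe (ω : S2) : HasFDerivAt (fun x : E3 => ‖x‖) (innerSL ℝ (ω : E3)) ω := by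
  have h := (hasStrictFDerivAt_norm_sq (ω : E3)).hasFDerivAt.sqrt (by simp [norm_coe])
  simp only [Real.sqrt_sq (norm_nonneg _)] at h
  refine h.congr_fderiv ?_
  ext v
  simp [norm_coe]

/-! ### Divergence of multiples of the gradient -/

/-- Off the sphere the ray-constant extension of `c ∇φ` is `c'(x) ‖x‖ ∇(ext φ)(x)`. The term from
differentiating `‖x‖` is `c ∑ ωᵢ ∂ᵢφ`, which vanishes because the gradient is tangential. -/
theorem divg_smul_grad {φ : S2 → ℝ} (hφ : ExtC2 φ) (c : S2 → ℝ) {c' : E3 → ℝ} {ω : S2}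
    (hc : ∀ (x : E3) (hx : x ≠ 0), c (proj x hx) = c' x) (hd : DifferentiableAt ℝ c' ω) :
    divg (fun ω' => c ω' • grad φ ω') ω =
      c ω * (∑ i, d2 φ i i ω) + ∑ i, fderiv ℝ c' ω (stdVec i) * d1 φ i ω := by
  have hω := ne_zero ω
  set X : S2 → E3 := fun ω' => c ω' • grad φ ω'
  have hev : ∀ᶠ x : E3 in 𝓝 (ω : E3), x ≠ 0 := isOpen_ne.mem_nhds hω
  have hX : ∀ x : E3, x ≠ 0 → ∀ i, ext X x i = c' x * ‖x‖ * d1 φ i x := by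
    intro x hx i
    rw [ext, dif_pos hx]
    change (c (proj x hx) • grad φ (proj x hx)) i = _
    rw [PiLp.smul_apply, grad_apply, d1_proj φ i hx, hc x hx, smul_eq_mul, mul_assoc]
  have hXd : ∀ i, HasFDerivAt (fun x => ext X x i)
      ((c ω * 1) • fderiv ℝ (d1 φ i) ω + d1 φ i ω • (c ω • innerSL ℝ (ω : E3) +
        (1 : ℝ) • fderiv ℝ c' ω)) (ω : E3) := by
    intro i
    have h := (hd.hasFDerivAt.mul (hasFDerivAt_norm_coe ω)).mul
      (hφ.differentiableAt_d1 i hω).hasFDerivAt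
    have hcω : c' ω = c ω := by
      rw [← hc _ hω]
      congr 1
      apply Subtype.ext
      simp [proj, norm_coe]
    have h2 := h.congr_of_eventuallyEq (f₁ := fun x => ext X x i) (by
      filter_upwards [hev] with x hx
      exact hX x hx i)
    refine h2.congr_fderiv ?_
    simp [norm_coe, hcω]
  have hdiff : DifferentiableAt ℝ (ext X) (ω : E3) :=
    differentiableAt_euclidean.2 fun i => (hXd i).differentiableAt
  have hcomp : ∀ i : Fin 3, (fderiv ℝ (ext X) (ω : E3) (stdVec i)) i =
      c ω * d2 φ i i ω + d1 φ i ω * (c ω * (ω : E3) i + fderiv ℝ c' ω (stdVec i)) := by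
    intro i
    have h := ((EuclideanSpace.proj i : E3 →L[ℝ] ℝ).hasFDerivAt.comp (ω : E3)
      hdiff.hasFDerivAt).unique (hXd i)
    have h2 := congrArg (fun L : E3 →L[ℝ] ℝ => L (stdVec i)) h
    simp only [ContinuousLinearMap.comp_apply, ContinuousLinearMap.add_apply,
      ContinuousLinearMap.smul_apply, smul_eq_mul, innerSL_apply_apply,
      EuclideanSpace.inner_single_right, mul_one, one_mul] at h2
    refine h2.trans ?_
    simp [d2]
  rw [divg, Finset.sum_congr rfl fun i _ => hcomp i]
  have h0 := sum_mul_d1 φ ω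
  simp only [Fin.sum_univ_three] at h0 ⊢
  linear_combination c ω * h0

theorem lap_eq {φ : S2 → ℝ} (hφ : ExtC2 φ) (ω : S2) : lap φ ω = ∑ i, d2 φ i i ω := by
  have h := divg_smul_grad hφ (fun _ => 1) (c' := fun _ => 1) (ω := ω) (fun _ _ => rfl)
    (differentiableAt_const _)
  simpa [lap] using h

/-! ### The local part of the functional -/

/-- Values of a function, its gradient and its Hessian. -/
abbrev Jet : Type := ℝ × (Fin 3 → ℝ) × (Fin 3 → Fin 3 → ℝ)

/-- The second-order jet of the ray-constant extension. -/
def jet (f : S2 → ℝ) (ω : S2) : Jet := (f ω, fun i => d1 f i ω, fun i j => d2 f i j ω)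

/-- `√(v² + |p|²)`. -/
def jetSlope (J : Jet) : ℝ := √(J.1 ^ 2 + ∑ i, J.2.1 i ^ 2)

/-- The local part of the functional as a function of the jet. -/
def localPart (J : Jet) : ℝ :=
  -((J.1 * jetSlope J)⁻¹ * (∑ i, J.2.2 i i) - ((J.1 * jetSlope J) ^ 2)⁻¹ *
      (jetSlope J * (∑ i, J.2.1 i ^ 2) + J.1 * ((J.1 * (∑ i, J.2.1 i ^ 2) +
        ∑ i, ∑ j, J.2.1 i * J.2.2 i j * J.2.1 j) * (jetSlope J)⁻¹)))
    + 3 * (jetSlope J)⁻¹ - jetSlope J * (J.1 ^ 2)⁻¹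

theorem jetSlope_pos {J : Jet} (hJ : 0 < J.1) : 0 < jetSlope J :=
  Real.sqrt_pos.2 (add_pos_of_pos_of_nonneg (by positivity)
    (Finset.sum_nonneg fun i _ => sq_nonneg _))

theorem slope_eq (φ : S2 → ℝ) (ω : S2) : slope φ ω = jetSlope (jet φ ω) := by
  rw [slope, norm_grad_sq]
  rfl

theorem slope_proj (φ : S2 → ℝ) {x : E3} (hx : x ≠ 0) :
    slope φ (proj x hx) = √(ext φ x ^ 2 + ‖x‖ ^ 2 * ∑ i, d1 φ i x ^ 2) := by
  rw [slope, norm_grad_sq]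
  have h : ext φ x = φ (proj x hx) := by rw [ext, dif_pos hx]
  simp only [d1_proj φ _ hx, h, mul_pow, Finset.mul_sum]

/-- The coefficient `1 / (φ √(φ² + |∇φ|²))`, written with ray-constant extensions, contains `‖x‖² ∑
(∂ᵢφ)²`. Differentiating `‖x‖²` produces a multiple of `ω`, which again drops out against the
tangential gradient. -/
theorem local_eq_localPart {φ : S2 → ℝ} (hφ : ExtC2 φ) (hpos : ∀ ω, 0 < φ ω) (ω : S2) :
    - divg (fun ω' => (φ ω' * slope φ ω')⁻¹ • grad φ ω') ω + 3 / slope φ ω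
      - slope φ ω / φ ω ^ 2 = localPart (jet φ ω) := by
  have hω := ne_zero ω
  have hf : HasFDerivAt (ext φ) (fderiv ℝ (ext φ) ω) (ω : E3) :=
    (hφ.differentiableAt hω).hasFDerivAt
  have hP : HasFDerivAt (fun x => ∑ i, d1 φ i x ^ 2)
      (∑ i, ((2 : ℕ) • d1 φ i ω ^ (2 - 1)) • fderiv ℝ (d1 φ i) (ω : E3)) (ω : E3) :=
    HasFDerivAt.fun_sum fun i _ => (hφ.differentiableAt_d1 i hω).hasFDerivAt.pow 2
  have hn := (hasStrictFDerivAt_norm_sq (ω : E3)).hasFDerivAt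
  have hval : √(ext φ (ω : E3) ^ 2 + ‖(ω : E3)‖ ^ 2 * ∑ i, d1 φ i ω ^ 2) = jetSlope (jet φ ω) := by
    rw [ext_coe, norm_coe]; simp [jet, jetSlope]
  have hs0 : 0 < jetSlope (jet φ ω) := jetSlope_pos (hpos ω)
  set s := jetSlope (jet φ ω) with hsdef
  have hs : HasFDerivAt (fun x => √(ext φ x ^ 2 + ‖x‖ ^ 2 * ∑ i, d1 φ i x ^ 2))
      (s⁻¹ • (φ ω • fderiv ℝ (ext φ) ω + ((∑ i, d1 φ i ω ^ 2) • innerSL ℝ (ω : E3) +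
        ∑ i, d1 φ i ω • fderiv ℝ (d1 φ i) (ω : E3)))) (ω : E3) := by
    have h := ((hf.pow 2).fun_add (hn.fun_mul hP)).sqrt (fun h => hs0.ne' (by
      rw [← hval, h, Real.sqrt_zero]))
    refine h.congr_fderiv ?_
    rw [hval]
    ext v
    simp only [ContinuousLinearMap.add_apply, ContinuousLinearMap.smul_apply, smul_eq_mul,
      ContinuousLinearMap.sum_apply, ext_coe, norm_coe, nsmul_eq_mul, Fin.sum_univ_three,
      Nat.cast_ofNat, Nat.add_one_sub_one, pow_one, one_pow, one_mul, one_div, mul_inv]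
    ring
  have hinv : HasFDerivAt (fun x => (ext φ x * √(ext φ x ^ 2 + ‖x‖ ^ 2 * ∑ i, d1 φ i x ^ 2))⁻¹)
      (-((φ ω * s) ^ 2)⁻¹ • (φ ω • (s⁻¹ • (φ ω • fderiv ℝ (ext φ) ω +
        ((∑ i, d1 φ i ω ^ 2) • innerSL ℝ (ω : E3) + ∑ i, d1 φ i ω • fderiv ℝ (d1 φ i) (ω : E3)))) +
        s • fderiv ℝ (ext φ) ω)) (ω : E3) := by
    have h := (hasDerivAt_inv (x := ext φ (ω : E3) *
      √(ext φ (ω : E3) ^ 2 + ‖(ω : E3)‖ ^ 2 * ∑ i, d1 φ i ω ^ 2)) (by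
      rw [hval, ext_coe]; exact (mul_pos (hpos ω) hs0).ne')).comp_hasFDerivAt (ω : E3)
      (hf.fun_mul hs)
    rw [hval, ext_coe] at h
    exact h
  rw [divg_smul_grad hφ (fun ω' => (φ ω' * slope φ ω')⁻¹)
    (c' := fun x => (ext φ x * √(ext φ x ^ 2 + ‖x‖ ^ 2 * ∑ i, d1 φ i x ^ 2))⁻¹) (ω := ω)
    (fun x hx => by
      have h : ext φ x = φ (proj x hx) := by rw [ext, dif_pos hx]
      simp only [slope_proj φ hx, h]) hinv.differentiableAt]
  have hder' : ∀ j, fderiv ℝ (fun x => (ext φ x * √(ext φ x ^ 2 + ‖x‖ ^ 2 *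
      ∑ i, d1 φ i x ^ 2))⁻¹) (ω : E3) (stdVec j) =
      -((φ ω * s) ^ 2)⁻¹ * (φ ω * (s⁻¹ *
        (φ ω * d1 φ j ω + ((∑ i, d1 φ i ω ^ 2) * (ω : E3) j + ∑ i, d1 φ i ω * d2 φ i j ω))) +
        s * d1 φ j ω) := by
    intro j
    rw [hinv.fderiv]
    simp only [ContinuousLinearMap.add_apply, ContinuousLinearMap.smul_apply, smul_eq_mul,
      innerSL_apply_apply, EuclideanSpace.inner_single_right, ContinuousLinearMap.sum_apply,
      conj_trivial, one_mul]
    rfl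
  simp only [hder']
  have h0 := sum_mul_d1 φ ω
  rw [localPart, slope_eq, ← hsdef]
  simp only [div_eq_mul_inv]
  simp only [jet, Fin.sum_univ_three] at h0 ⊢
  linear_combination -((φ ω * s) ^ 2)⁻¹ * (-(φ ω * s⁻¹ *
    (d1 φ 0 ω ^ 2 + d1 φ 1 ω ^ 2 + d1 φ 2 ω ^ 2))) * h0

theorem contDiffAt_jetSlope {J : Jet} (hJ : 0 < J.1) : ContDiffAt ℝ 1 jetSlope J := by
  have h : ContDiff ℝ 1 fun J : Jet => J.1 ^ 2 + ∑ i, J.2.1 i ^ 2 := by fun_prop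
  refine h.contDiffAt.sqrt ?_
  have : 0 < J.1 ^ 2 + ∑ i, J.2.1 i ^ 2 :=
    add_pos_of_pos_of_nonneg (by positivity) (Finset.sum_nonneg fun i _ => sq_nonneg _)
  exact this.ne'

theorem contDiffAt_localPart {J : Jet} (hJ : 0 < J.1) : ContDiffAt ℝ 1 localPart J := by
  have hs := contDiffAt_jetSlope hJ
  have hs0 := jetSlope_pos hJ
  have hv : ContDiffAt ℝ 1 (fun J : Jet => J.1) J := contDiffAt_fst
  have hP : ContDiffAt ℝ 1 (fun J : Jet => ∑ i, J.2.1 i ^ 2) J := by fun_prop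
  have hT : ContDiffAt ℝ 1 (fun J : Jet => ∑ i, J.2.2 i i) J := by fun_prop
  have hq : ContDiffAt ℝ 1 (fun J : Jet => ∑ i, ∑ j, J.2.1 i * J.2.2 i j * J.2.1 j) J := by
    fun_prop
  have hvs := hv.mul hs
  have hsi := hs.inv hs0.ne'
  unfold localPart
  exact (((((hvs.inv (mul_pos hJ hs0).ne').mul hT).sub (((hvs.pow 2).inv
    (pow_pos (mul_pos hJ hs0) 2).ne').mul ((hs.mul hP).add (hv.mul (((hv.mul hP).add hq).mul
    hsi))))).neg).add (contDiffAt_const.mul hsi)).sub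
    (hs.mul ((hv.pow 2).inv (pow_pos hJ 2).ne'))

/-- The linearization of `localPart` at a constant. -/
def localPartDeriv (R : ℝ) : Jet →L[ℝ] ℝ :=
  -(R ^ 2)⁻¹ • (LinearMap.toContinuousLinearMap
    { toFun := fun J : Jet => (∑ i, J.2.2 i i) + 2 * J.1
      map_add' := fun J K => by simp [Finset.sum_add_distrib]; ring
      map_smul' := fun c J => by simp [Finset.mul_sum, mul_add]; ring })

theorem localPartDeriv_apply (R : ℝ) (J : Jet) :
    localPartDeriv R J = -(R ^ 2)⁻¹ * ((∑ i, J.2.2 i i) + 2 * J.1) := rfl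

/-- The `C¹` property gives a strict derivative, which is then identified along lines `(R, 0, 0) +
tJ`. The gradient enters quadratically and drops out; `-T / R²` comes from the divergence and `-2v /
R²` from `3/s - s/v² = 2/v` at zero gradient. -/
theorem hasStrictFDerivAt_localPart {R : ℝ} (hR : 0 < R) :
    HasStrictFDerivAt localPart (localPartDeriv R) (R, 0, 0) := by
  have h := (contDiffAt_localPart (J := (R, 0, 0)) hR).hasStrictFDerivAt (by norm_num)
  refine h.congr_fderiv ?_
  refine ContinuousLinearMap.ext fun J => ?_
  have hc : HasDerivAt (fun t : ℝ => ((R, 0, 0) : Jet) + t • J) J 0 := by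
    simpa using ((hasDerivAt_id (0 : ℝ)).smul_const J).const_add ((R, 0, 0) : Jet)
  have h0 : ((R, 0, 0) : Jet) + (0 : ℝ) • J = (R, 0, 0) := by simp
  have h1 := (h0.symm ▸ h.hasFDerivAt : HasFDerivAt localPart _
    (((R, 0, 0) : Jet) + (0 : ℝ) • J)).comp_hasDerivAt (0 : ℝ) hc
  rw [h0] at h1
  refine h1.unique ?_
  obtain ⟨v, p, m⟩ := J
  set P := ∑ i, p i ^ 2
  set T := ∑ i, m i i
  set q := ∑ i, ∑ j, p i * m i j * p j
  have hfun : (localPart ∘ fun t : ℝ => ((R, 0, 0) : Jet) + t • ((v, p, m) : Jet)) = fun t =>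
      -(((R + t * v) * √((R + t * v) ^ 2 + t ^ 2 * P))⁻¹ * (t * T) -
        (((R + t * v) * √((R + t * v) ^ 2 + t ^ 2 * P)) ^ 2)⁻¹ *
        (t ^ 2 * (√((R + t * v) ^ 2 + t ^ 2 * P) * P + (R + t * v) * (((R + t * v) * P + t * q) *
          (√((R + t * v) ^ 2 + t ^ 2 * P))⁻¹)))) +
      3 * (√((R + t * v) ^ 2 + t ^ 2 * P))⁻¹ -
      √((R + t * v) ^ 2 + t ^ 2 * P) * ((R + t * v) ^ 2)⁻¹ := by
    funext t
    simp only [Function.comp, localPart, jetSlope]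
    simp only [Prod.smul_mk, Prod.mk_add_mk, Pi.add_apply, Pi.zero_apply, Pi.smul_apply, smul_eq_mul,
      zero_add, P, T, q, Fin.sum_univ_three, mul_pow]
    ring_nf
  rw [hfun, localPartDeriv_apply]
  have hv : HasDerivAt (fun t : ℝ => R + t * v) v 0 := by
    simpa using ((hasDerivAt_id (0 : ℝ)).mul_const v).const_add R
  have hid := hasDerivAt_id' (0 : ℝ)
  have hs : HasDerivAt (fun t : ℝ => √((R + t * v) ^ 2 + t ^ 2 * P)) v 0 := by
    have := ((hv.pow 2).add ((hid.pow 2).mul_const P)).sqrt (by simp [hR.ne'])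
    refine this.congr_deriv ?_
    simp [Real.sqrt_sq hR.le]
    field_simp
  have hs0 : √((R + 0 * v) ^ 2 + 0 ^ 2 * P) = R := by simp [Real.sqrt_sq hR.le]
  have hsi := hs.fun_inv (by rw [hs0]; exact hR.ne')
  have hvs := hv.fun_mul hs
  have hvs0 : (R + 0 * v) * √((R + 0 * v) ^ 2 + 0 ^ 2 * P) ≠ 0 := by
    rw [hs0]; simp [hR.ne']
  have hA := (hvs.fun_inv hvs0).fun_mul (hid.mul_const T)
  have hB := ((hvs.fun_pow 2).fun_inv (pow_ne_zero 2 hvs0)).fun_mul ((hid.fun_pow 2).fun_mul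
    ((hs.mul_const P).fun_add (hv.fun_mul (((hv.mul_const P).fun_add (hid.mul_const q)).fun_mul
    hsi))))
  have hC := hs.fun_mul ((hv.fun_pow 2).fun_inv (by simp [hR.ne']))
  have hfin := (((hA.fun_sub hB).fun_neg).fun_add (hsi.const_mul 3)).fun_sub hC
  refine hfin.congr_deriv ?_
  rw [hs0]
  simp only [zero_mul, add_zero, mul_zero, zero_add, Nat.add_one_sub_one, pow_one]
  simp
  field_simp
  ring

/-! ### Hölder bounds -/

/-- `f` is bounded by `C` and `α`-Hölder continuous with constant `C`. -/
def HolderBound {V : Type*} [NormedAddCommGroup V] (α : ℝ≥0) (C : ℝ) (f : S2 → V) : Prop :=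
  (∀ ω, ‖f ω‖ ≤ C) ∧ ∀ ω ω', ‖f ω - f ω'‖ ≤ C * dist ω ω' ^ (α : ℝ)

section HolderBound

variable {V : Type*} [NormedAddCommGroup V] {α : ℝ≥0} {C C' : ℝ} {f g : S2 → V}

theorem HolderBound.nonneg (h : HolderBound α C f) : 0 ≤ C :=
  (norm_nonneg _).trans (h.1 (Classical.arbitrary S2))

theorem HolderBound.add (hf : HolderBound α C f) (hg : HolderBound α C' g) :
    HolderBound α (C + C') (fun ω => f ω + g ω) := by
  refine ⟨fun ω => (norm_add_le _ _).trans (add_le_add (hf.1 ω) (hg.1 ω)), fun ω ω' => ?_⟩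
  rw [add_sub_add_comm, add_mul]
  exact (norm_add_le _ _).trans (add_le_add (hf.2 ω ω') (hg.2 ω ω'))

theorem HolderBound.mono (hf : HolderBound α C f) (h : C ≤ C') : HolderBound α C' f :=
  ⟨fun ω => (hf.1 ω).trans h, fun ω ω' => (hf.2 ω ω').trans (by gcongr)⟩

theorem HolderBound.const_mul {f : S2 → ℝ} (hf : HolderBound α C f) (c : ℝ) :
    HolderBound α (|c| * C) (fun ω => c * f ω) := by
  refine ⟨fun ω => ?_, fun ω ω' => ?_⟩
  · rw [norm_mul, Real.norm_eq_abs]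
    exact mul_le_mul_of_nonneg_left (hf.1 ω) (abs_nonneg c)
  · rw [← mul_sub, norm_mul, Real.norm_eq_abs, mul_assoc]
    exact mul_le_mul_of_nonneg_left (hf.2 ω ω') (abs_nonneg c)

theorem HolderBound.holderWith (hf : HolderBound α C f) : HolderWith C.toNNReal α f := by
  intro ω ω'
  rw [edist_dist, edist_dist, ENNReal.ofReal_rpow_of_nonneg dist_nonneg α.coe_nonneg, dist_eq_norm]
  change _ ≤ ENNReal.ofReal C * _
  rw [← ENNReal.ofReal_mul hf.nonneg]
  exact ENNReal.ofReal_le_ofReal (hf.2 ω ω')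

theorem HolderBound.continuous (hα : 0 < α) (hf : HolderBound α C f) : Continuous f :=
  hf.holderWith.continuous hα

theorem HolderBound.iteratedFDeriv_zero {f : S2 → ℝ} (hf : HolderBound α C f) :
    HolderBound α C (fun ω : S2 => iteratedFDeriv ℝ 0 (ext f) (ω : E3)) := by
  refine ⟨fun ω => ?_, fun ω ω' => ?_⟩
  · rw [norm_iteratedFDeriv_zero, ext_coe]
    exact hf.1 ω
  · rw [iteratedFDeriv_zero_eq_comp]
    simp only [Function.comp, ext_coe]
    rw [← map_sub, LinearIsometryEquiv.norm_map]
    exact hf.2 ω ω'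

theorem HolderBound.isHolder (hα : 0 < α) {f : S2 → ℝ} (hf : HolderBound α C f) :
    IsHolder 0 α f :=
  ⟨contDiffOn_zero.2 (continuousOn_ext (hf.continuous hα)),
    hf.iteratedFDeriv_zero.holderWith.memHolder⟩

theorem Holder.norm_le_of_holderBound (f : Holder 0 α) (hf : HolderBound α C f) :
    ‖f‖ ≤ 2 * C := by
  rw [Holder.norm_def, Finset.sum_range_one, two_mul]
  refine add_le_add (ciSup_le fun ω => hf.iteratedFDeriv_zero.1 ω) ?_
  rw [← Real.coe_toNNReal C hf.nonneg]
  exact NNReal.coe_le_coe.2 hf.iteratedFDeriv_zero.holderWith.nnholderNorm_le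

end HolderBound

/-! ### Hölder bounds for the derivatives of a `C^{2,α}` function -/

theorem supDeriv_le_norm {k : ℕ} {α : ℝ≥0} (u : Holder k α) {j : ℕ} (hj : j ≤ k) :
    Holder.supDeriv j u.1 ≤ ‖u‖ := by
  rw [Holder.norm_def]
  have := Finset.single_le_sum (f := fun j => Holder.supDeriv j u.1)
    (fun j _ => Holder.supDeriv_nonneg j u.1) (Finset.mem_range.2 (Nat.lt_succ_of_le hj))
  have h5 := NNReal.coe_nonneg
    (nnHolderNorm α (fun ω : S2 => iteratedFDeriv ℝ k (ext u.1) (ω : E3)))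
  linarith

theorem norm_iteratedFDeriv_le_norm {k : ℕ} {α : ℝ≥0} (u : Holder k α) {j : ℕ} (hj : j ≤ k)
    (ω : S2) : ‖iteratedFDeriv ℝ j (ext u.1) (ω : E3)‖ ≤ ‖u‖ :=
  (u.le_supDeriv hj ω).trans (supDeriv_le_norm u hj)

/-- Derivatives of order `j` of a function homogeneous of degree `0` are homogeneous of degree `-j`.
-/
theorem norm_iteratedFDeriv_smul_le (f : S2 → ℝ) {c : ℝ} (hc : 0 < c) (j : ℕ) (x : E3) :
    ‖iteratedFDeriv ℝ j (ext f) x‖ ≤ c ^ j * ‖iteratedFDeriv ℝ j (ext f) (c • x)‖ := by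
  set e : E3 ≃L[ℝ] E3 := ContinuousLinearEquiv.smulLeft (Units.mk0 c hc.ne')
  have he : ∀ y, e y = c • y := fun y => rfl
  have h := e.iteratedFDerivWithin_comp_right (ext f) (s := univ) uniqueDiffOn_univ
    (mem_univ _) (x := x) j
  simp only [preimage_univ, iteratedFDerivWithin_univ] at h
  have hcomp : ext f ∘ e = ext f := funext fun y => ext_smul_pos f hc y
  rw [hcomp] at h
  rw [h]
  refine (ContinuousMultilinearMap.norm_compContinuousLinearMap_le _ _).trans ?_
  rw [he, mul_comm, Finset.prod_const, Finset.card_univ, Fintype.card_fin]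
  gcongr
  refine ContinuousLinearMap.opNorm_le_bound _ hc.le fun y => ?_
  change ‖e y‖ ≤ _
  rw [he, norm_smul, Real.norm_of_nonneg hc.le]

theorem norm_iteratedFDeriv_le_of_half_le {k : ℕ} {α : ℝ≥0} (u : Holder k α) {j : ℕ}
    (hj : j ≤ k) {x : E3} (hx : 1 / 2 ≤ ‖x‖) :
    ‖iteratedFDeriv ℝ j (ext u.1) x‖ ≤ 2 ^ j * ‖u‖ := by
  have hn : 0 < ‖x‖ := by linarith
  have hx0 : x ≠ 0 := norm_pos_iff.1 hn
  refine (norm_iteratedFDeriv_smul_le u.1 (inv_pos.2 hn) j x).trans ?_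
  gcongr
  · rw [inv_le_comm₀ hn (by norm_num)]
    linarith
  · exact norm_iteratedFDeriv_le_norm u hj (proj x hx0)

theorem rpow_le_mul_rpow {α : ℝ≥0} (hα1 : α < 1) {K d : ℝ} (hK : 1 ≤ K) (hd : 0 ≤ d) :
    (K * d) ^ (α : ℝ) ≤ K * d ^ (α : ℝ) := by
  rw [Real.mul_rpow (by linarith) hd]
  gcongr
  calc K ^ (α : ℝ) ≤ K ^ (1 : ℝ) :=
        Real.rpow_le_rpow_of_exponent_le hK (by exact_mod_cast hα1.le)
    _ = K := Real.rpow_one K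

/-- The norm contains a Hölder seminorm only for the top derivative. For lower orders, nearby points
are compared by the mean value inequality and distant points by the sup bound. -/
theorem holderBound_iteratedFDeriv {α : ℝ≥0} (hα1 : α < 1) (u : Holder 2 α) {j : ℕ} (hj : j ≤ 2) :
    HolderBound α (4 * ‖u‖) (fun ω : S2 => iteratedFDeriv ℝ j (ext u.1) (ω : E3)) := by
  have hu : 0 ≤ ‖u‖ := norm_nonneg u
  refine ⟨fun ω => (norm_iteratedFDeriv_le_norm u hj ω).trans (by linarith), fun ω ω' => ?_⟩
  rcases hj.eq_or_lt with rfl | hj2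
  · have h := u.2.2.holderWith.dist_le ω ω'
    rw [dist_eq_norm] at h
    refine h.trans ?_
    gcongr
    have h2 : (nnHolderNorm α (fun ω : S2 => iteratedFDeriv ℝ 2 (ext u.1) (ω : E3)) : ℝ) ≤ ‖u‖ := by
      rw [Holder.norm_def]
      have := Finset.sum_nonneg (s := Finset.range (2 + 1)) (f := fun j => Holder.supDeriv j u.1)
        (fun j _ => Holder.supDeriv_nonneg j u.1)
      linarith
    linarith
  · rcases le_or_gt (dist ω ω') (1 / 2) with hd | hd
    -- The chord leaves the sphere, but within this ball it stays at distance at least `1/2` from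
    -- the origin, where homogeneity costs a factor `2 ^ (j + 1) ≤ 4`.
    · have hball : ∀ x ∈ Metric.closedBall (ω' : E3) (1 / 2), 1 / 2 ≤ ‖x‖ := by
        intro x hx
        rw [mem_closedBall_iff_norm'] at hx
        have := norm_sub_norm_le (ω' : E3) x
        rw [norm_coe] at this
        linarith
      have hne : ∀ x ∈ Metric.closedBall (ω' : E3) (1 / 2), x ≠ 0 := fun x hx h => by
        have := hball x hx
        rw [h, norm_zero] at this
        norm_num at this
      have h := Convex.norm_image_sub_le_of_norm_fderiv_le (𝕜 := ℝ)
        (f := iteratedFDeriv ℝ j (ext u.1)) (C := 4 * ‖u‖) (s := Metric.closedBall (ω' : E3) (1 / 2))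
        (x := ω') (y := ω)
        (fun x hx => ((IsHolder.contDiffAt u.2 le_rfl (hne x hx)).iteratedFDeriv_right (m := 1)
          (i := j) (by exact_mod_cast (by omega : 1 + j ≤ 2))).differentiableAt (by norm_num))
        (fun x hx => by
          rw [norm_fderiv_iteratedFDeriv]
          refine (norm_iteratedFDeriv_le_of_half_le u (by omega : j + 1 ≤ 2) (hball x hx)).trans ?_
          gcongr
          calc (2 : ℝ) ^ (j + 1) ≤ 2 ^ 2 := pow_le_pow_right₀ (by norm_num) (by omega)
            _ = 4 := by norm_num)
        (convex_closedBall _ _) (Metric.mem_closedBall_self (by norm_num)) hd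
      refine h.trans ?_
      gcongr
      rw [← dist_eq_norm, ← Subtype.dist_eq]
      calc dist ω ω' = dist ω ω' ^ (1 : ℝ) := (Real.rpow_one _).symm
        _ ≤ dist ω ω' ^ (α : ℝ) :=
          Real.rpow_le_rpow_of_exponent_ge_of_imp dist_nonneg (by linarith)
            (by exact_mod_cast hα1.le) (fun _ h => absurd h one_ne_zero)
    · have h1 : 1 ≤ 2 * dist ω ω' ^ (α : ℝ) :=
        (Real.one_le_rpow (by linarith : 1 ≤ 2 * dist ω ω') α.coe_nonneg).trans
          (rpow_le_mul_rpow hα1 (by norm_num) dist_nonneg)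
      refine (norm_sub_le _ _).trans ?_
      have h2 := norm_iteratedFDeriv_le_norm u hj ω
      have h3 := norm_iteratedFDeriv_le_norm u hj ω'
      nlinarith

theorem IsHolder.extC2 {α : ℝ≥0} {f : S2 → ℝ} (h : IsHolder 2 α f) : ExtC2 f := h.1

theorem jet_eq {α : ℝ≥0} {f : S2 → ℝ} (h : IsHolder 2 α f) (ω : S2) :
    jet f ω = (iteratedFDeriv ℝ 0 (ext f) (ω : E3) ![],
      fun i => iteratedFDeriv ℝ 1 (ext f) (ω : E3) ![stdVec i],
      fun i j => iteratedFDeriv ℝ 2 (ext f) (ω : E3) ![stdVec j, stdVec i]) := by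
  have h1 : ∀ i j, d2 f i j ω = _ := fun i j => h.extC2.d2_eq i j (ne_zero ω)
  simp only [jet, h1, d1_eq, iteratedFDeriv_zero_apply, ext_coe]

theorem jet_add {α : ℝ≥0} {f g : S2 → ℝ} (hf : IsHolder 2 α f) (hg : IsHolder 2 α g) (ω : S2) :
    jet (f + g) ω = jet f ω + jet g ω := by
  rw [jet_eq (hf.add hg), jet_eq hf, jet_eq hg, IsHolder.deriv_add hf hg (by norm_num),
    IsHolder.deriv_add hf hg (by norm_num), IsHolder.deriv_add hf hg le_rfl]
  rfl

theorem jet_smul {α : ℝ≥0} {f : S2 → ℝ} (hf : IsHolder 2 α f) (c : ℝ) (ω : S2) :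
    jet (c • f) ω = c • jet f ω := by
  rw [jet_eq (hf.smul c), jet_eq hf, IsHolder.deriv_smul hf c (by norm_num),
    IsHolder.deriv_smul hf c (by norm_num), IsHolder.deriv_smul hf c le_rfl]
  rfl

theorem norm_multilinear_le {j : ℕ} (L : ContinuousMultilinearMap ℝ (fun _ : Fin j => E3) ℝ)
    (m : Fin j → E3) (hm : ∀ i, ‖m i‖ = 1) : ‖L m‖ ≤ ‖L‖ := by
  refine (L.le_opNorm m).trans_eq ?_
  simp [hm]

theorem norm_jetMap_le (L₀ : ContinuousMultilinearMap ℝ (fun _ : Fin 0 => E3) ℝ)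
    (L₁ : ContinuousMultilinearMap ℝ (fun _ : Fin 1 => E3) ℝ)
    (L₂ : ContinuousMultilinearMap ℝ (fun _ : Fin 2 => E3) ℝ) {C : ℝ} (h₀ : ‖L₀‖ ≤ C)
    (h₁ : ‖L₁‖ ≤ C) (h₂ : ‖L₂‖ ≤ C) :
    ‖((L₀ ![], fun i => L₁ ![stdVec i], fun i j => L₂ ![stdVec j, stdVec i]) : Jet)‖ ≤ C := by
  have hC : 0 ≤ C := (norm_nonneg _).trans h₀
  refine norm_prod_le_iff.2 ⟨(norm_multilinear_le _ _ fun i => i.elim0).trans h₀,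
    norm_prod_le_iff.2 ⟨(pi_norm_le_iff_of_nonneg hC).2 fun i => ?_,
    (pi_norm_le_iff_of_nonneg hC).2 fun i => (pi_norm_le_iff_of_nonneg hC).2 fun j => ?_⟩⟩
  · exact (norm_multilinear_le _ _ (by simp)).trans h₁
  · refine (norm_multilinear_le _ _ fun k => ?_).trans h₂
    fin_cases k <;> simp

theorem holderBound_jet {α : ℝ≥0} (hα1 : α < 1) (u : Holder 2 α) :
    HolderBound α (4 * ‖u‖) (jet u) := by
  have h0 := holderBound_iteratedFDeriv hα1 u (j := 0) (by norm_num)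
  have h1 := holderBound_iteratedFDeriv hα1 u (j := 1) (by norm_num)
  have h2 := holderBound_iteratedFDeriv hα1 u (j := 2) le_rfl
  refine ⟨fun ω => ?_, fun ω ω' => ?_⟩
  · rw [jet_eq u.2]
    exact norm_jetMap_le _ _ _ (h0.1 ω) (h1.1 ω) (h2.1 ω)
  · rw [jet_eq u.2, jet_eq u.2]
    have h0' : ‖iteratedFDeriv ℝ 0 (ext u.1) (ω : E3) -
        iteratedFDeriv ℝ 0 (ext u.1) (ω' : E3)‖ ≤ _ := h0.2 ω ω'
    have h1' : ‖iteratedFDeriv ℝ 1 (ext u.1) (ω : E3) -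
        iteratedFDeriv ℝ 1 (ext u.1) (ω' : E3)‖ ≤ _ := h1.2 ω ω'
    have h2' : ‖iteratedFDeriv ℝ 2 (ext u.1) (ω : E3) -
        iteratedFDeriv ℝ 2 (ext u.1) (ω' : E3)‖ ≤ _ := h2.2 ω ω'
    generalize iteratedFDeriv ℝ 0 (ext u.1) (ω : E3) = A₀ at *
    generalize iteratedFDeriv ℝ 1 (ext u.1) (ω : E3) = A₁ at *
    generalize iteratedFDeriv ℝ 2 (ext u.1) (ω : E3) = A₂ at *
    generalize iteratedFDeriv ℝ 0 (ext u.1) (ω' : E3) = B₀ at *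
    generalize iteratedFDeriv ℝ 1 (ext u.1) (ω' : E3) = B₁ at *
    generalize iteratedFDeriv ℝ 2 (ext u.1) (ω' : E3) = B₂ at *
    exact norm_jetMap_le (A₀ - B₀) (A₁ - B₁) (A₂ - B₂) h0' h1' h2'

/-- `H` need be `C¹` only at points of the range: it is locally Lipschitz there, and compactness of
the range makes it Lipschitz without any convexity. -/
theorem HolderBound.comp_exists {V W : Type*} [NormedAddCommGroup V] [NormedSpace ℝ V]
    [NormedAddCommGroup W] [NormedSpace ℝ W] {α : ℝ≥0} (hα : 0 < α) {C : ℝ} {g : S2 → V}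
    (hg : HolderBound α C g) {H : V → W}
    (hH : ∀ ω, ContDiffAt ℝ 1 H (g ω)) : ∃ C', HolderBound α C' fun ω => H (g ω) := by
  have hgc := hg.continuous hα
  have hK : IsCompact (range g) := isCompact_range hgc
  have hL : LocallyLipschitzOn (range g) H := by
    rintro _ ⟨ω, rfl⟩
    obtain ⟨K, t, ht, hKt⟩ := (hH ω).exists_lipschitzOnWith
    exact ⟨K, t, mem_nhdsWithin_of_mem_nhds ht, hKt⟩
  obtain ⟨K, hKl⟩ := LocallyLipschitzOn.exists_lipschitzOnWith_of_compact hK hL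
  obtain ⟨M, hM⟩ := hK.exists_bound_of_continuousOn hKl.continuousOn
  refine ⟨max M (K * C), fun ω => (hM _ ⟨ω, rfl⟩).trans (le_max_left _ _), fun ω ω' => ?_⟩
  have h := hKl.dist_le_mul _ ⟨ω, rfl⟩ _ ⟨ω', rfl⟩
  rw [dist_eq_norm, dist_eq_norm] at h
  calc ‖H (g ω) - H (g ω')‖ ≤ K * (C * dist ω ω' ^ (α : ℝ)) :=
        h.trans (mul_le_mul_of_nonneg_left (hg.2 ω ω') K.coe_nonneg)
    _ = (K * C) * dist ω ω' ^ (α : ℝ) := by ring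
    _ ≤ _ := by gcongr; exact le_max_right _ _

/-! ### Hölder bounds for rotation-equivariant functionals -/

/-- An element of `C^{2,α}` as a continuous function. -/
def toC {α : ℝ≥0} (u : Holder 2 α) : C(S2, ℝ) :=
  ⟨u.1, by
    have h : Continuous fun ω : S2 => ext u.1 (ω : E3) :=
      u.2.1.continuousOn.comp_continuous continuous_subtype_val fun ω => ne_zero ω
    simpa only [ext_coe] using h⟩

@[simp]
theorem toC_apply {α : ℝ≥0} (u : Holder 2 α) (ω : S2) : toC u ω = u ω := rfl

theorem norm_toC_le {α : ℝ≥0} (u : Holder 2 α) : ‖toC u‖ ≤ ‖u‖ := by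
  rw [ContinuousMap.norm_le _ (norm_nonneg u)]
  intro ω
  have h := norm_iteratedFDeriv_le_norm u (Nat.zero_le 2) ω
  rwa [norm_iteratedFDeriv_zero, ext_coe] at h

theorem norm_compRot_sub_le {α : ℝ≥0} (hα1 : α < 1) (u : Holder 2 α) {g : E3 ≃ₗᵢ[ℝ] E3} {d : ℝ}
    (hd : 0 ≤ d) (hg : ∀ x : S2, dist (rotPoint g x) x ≤ 4 * d) :
    ‖compRot g (toC u) - toC u‖ ≤ 16 * ‖u‖ * d ^ (α : ℝ) := by
  rw [ContinuousMap.norm_le _ (by positivity)]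
  intro x
  have h := (holderBound_jet hα1 u).2 (rotPoint g x) x
  have h2 : ‖u (rotPoint g x) - u x‖ ≤ ‖jet u (rotPoint g x) - jet u x‖ :=
    norm_fst_le (jet u (rotPoint g x) - jet u x)
  refine h2.trans (h.trans ?_)
  calc 4 * ‖u‖ * dist (rotPoint g x) x ^ (α : ℝ) ≤ 4 * ‖u‖ * (4 * d) ^ (α : ℝ) := by
        gcongr
        exact hg x
    _ ≤ 4 * ‖u‖ * (4 * d ^ (α : ℝ)) := by
        gcongr
        exact rpow_le_mul_rpow hα1 (by norm_num) hd
    _ = _ := by ring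

/-- Choose `g` with `gω = ω'` from `exists_rot`. Then `N(ω', u) = N(ω, u ∘ g)`, so variation in the
point becomes variation in the function, and sup-norm Lipschitz control of `N(ω, ·)` suffices. -/
theorem abs_sub_le_of_equivariant {α : ℝ≥0} (hα1 : α < 1) (u : Holder 2 α)
    {N : S2 → C(S2, ℝ) → ℝ}
    (hN : ∀ g ω v, N (rotPoint g ω) v = N ω (compRot g v)) {K : ℝ} (hK0 : 0 ≤ K)
    (hK : ∀ ω g, |N ω (compRot g (toC u)) - N ω (toC u)| ≤ K * ‖compRot g (toC u) - toC u‖)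
    (ω ω' : S2) : |N ω (toC u) - N ω' (toC u)| ≤ 16 * K * ‖u‖ * dist ω ω' ^ (α : ℝ) := by
  obtain ⟨g, rfl, hg⟩ := exists_rot ω ω'
  rw [hN, abs_sub_comm]
  refine (hK ω g).trans ?_
  calc K * ‖compRot g (toC u) - toC u‖ ≤ K * (16 * ‖u‖ * dist ω (rotPoint g ω) ^ (α : ℝ)) :=
        mul_le_mul_of_nonneg_left (norm_compRot_sub_le hα1 u dist_nonneg hg) hK0
    _ = _ := by ring

theorem compRot_add (g : E3 ≃ₗᵢ[ℝ] E3) (u v : C(S2, ℝ)) :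
    compRot g (u + v) = compRot g u + compRot g v := rfl

theorem compRot_sub (g : E3 ≃ₗᵢ[ℝ] E3) (u v : C(S2, ℝ)) :
    compRot g (u - v) = compRot g u - compRot g v := rfl

theorem compRot_const (g : E3 ≃ₗᵢ[ℝ] E3) (R : ℝ) :
    compRot g (ContinuousMap.const S2 R) = ContinuousMap.const S2 R := rfl

theorem norm_compRot_le (g : E3 ≃ₗᵢ[ℝ] E3) (u : C(S2, ℝ)) : ‖compRot g u‖ ≤ ‖u‖ :=
  (ContinuousMap.norm_le _ (norm_nonneg u)).2 fun x => u.norm_coe_le_norm _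

/-- The linearization of the boundary potential at the ball of radius `R`. -/
def potentialDeriv (R : ℝ) (ω : S2) : C(S2, ℝ) →L[ℝ] ℝ :=
  R • singleLayer ω - (4 * Real.pi / 3 * R) • evalAt ω

theorem potentialDeriv_apply (R : ℝ) (ω : S2) (u : C(S2, ℝ)) :
    potentialDeriv R ω u = R * singleLayer ω u - 4 * Real.pi / 3 * R * u ω := rfl

theorem potentialDeriv_rotPoint (R : ℝ) (g : E3 ≃ₗᵢ[ℝ] E3) (ω : S2) (u : C(S2, ℝ)) :
    potentialDeriv R (rotPoint g ω) u = potentialDeriv R ω (compRot g u) := by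
  rw [potentialDeriv_apply, potentialDeriv_apply, singleLayer_rotPoint, compRot_apply]

theorem exists_norm_potentialDeriv_le (R : ℝ) :
    ∃ K, 0 ≤ K ∧ ∀ ω u, |potentialDeriv R ω u| ≤ K * ‖u‖ := by
  set ω₀ : S2 := Classical.arbitrary S2
  refine ⟨‖potentialDeriv R ω₀‖, (potentialDeriv R ω₀).opNorm_nonneg, fun ω u => ?_⟩
  obtain ⟨g, rfl, -⟩ := exists_rot ω₀ ω
  rw [potentialDeriv_rotPoint]
  refine ((potentialDeriv R ω₀).le_opNorm _).trans ?_
  gcongr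
  exact norm_compRot_le g u

/-- One base point suffices: a rotation carries it to any `ω`, and composing with a rotation does
not increase the sup norm, so the same `δ` works everywhere. -/
theorem exists_uniform_strict {R : ℝ} (hR : 0 < R) {ε : ℝ} (hε : 0 < ε) :
    ∃ δ > 0, ∀ (ω : S2) (u v : C(S2, ℝ)), ‖u‖ < δ → ‖v‖ < δ →
      |boundaryPotential ω (ContinuousMap.const S2 R + u) -
        boundaryPotential ω (ContinuousMap.const S2 R + v) - potentialDeriv R ω (u - v)| ≤
        ε * ‖u - v‖ := by
  set ω₀ : S2 := Classical.arbitrary S2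
  set c := ContinuousMap.const S2 R
  have h : HasStrictFDerivAt (boundaryPotential ω₀) (potentialDeriv R ω₀) c :=
    hasStrictFDerivAt_boundaryPotential_const ω₀ hR
  rw [hasStrictFDerivAt_iff_isLittleO, Asymptotics.isLittleO_iff] at h
  obtain ⟨δ, hδ, hball⟩ := Metric.eventually_nhds_iff_ball.1 (h hε)
  refine ⟨δ, hδ, fun ω u v hu hv => ?_⟩
  obtain ⟨g, rfl, -⟩ := exists_rot ω₀ ω
  rw [boundaryPotential_rotPoint, boundaryPotential_rotPoint, potentialDeriv_rotPoint,
    compRot_add, compRot_add, compRot_const, compRot_sub]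
  have hmem : (c + compRot g u, c + compRot g v) ∈ Metric.ball (c, c) δ := by
    rw [← ball_prod_same, Set.mem_prod, mem_ball_iff_norm, mem_ball_iff_norm]
    simp only [add_sub_cancel_left]
    exact ⟨(norm_compRot_le g u).trans_lt hu, (norm_compRot_le g v).trans_lt hv⟩
  have h2 := hball _ hmem
  simp only [add_sub_add_left_eq_sub] at h2
  refine h2.trans ?_
  gcongr
  rw [← compRot_sub]
  exact norm_compRot_le g _

theorem holderBound_potentialDeriv {α : ℝ≥0} (hα1 : α < 1) (R : ℝ) :
    ∃ K, 0 ≤ K ∧ ∀ u : Holder 2 α,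
      HolderBound α (K * ‖u‖) fun ω => potentialDeriv R ω (toC u) := by
  obtain ⟨K, hK0, hK⟩ := exists_norm_potentialDeriv_le R
  refine ⟨16 * K, by positivity, fun u => ⟨fun ω => ?_, fun ω ω' => ?_⟩⟩
  · refine (hK ω _).trans ?_
    have := norm_toC_le u
    have := norm_nonneg u
    nlinarith
  · exact abs_sub_le_of_equivariant hα1 u (N := fun ω v => potentialDeriv R ω v)
      (fun g ω v => potentialDeriv_rotPoint R g ω v) hK0
      (fun ω g => by rw [← map_sub]; exact hK ω _) ω ω'

/-- The sup bound compares `u` with `0`; the Hölder bound compares `u ∘ g` with `u`, which is where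
strictness is used. -/
theorem holderBound_potential_remainder {α : ℝ≥0} (hα1 : α < 1) {R : ℝ} (hR : 0 < R) {ε : ℝ}
    (hε : 0 < ε) : ∃ δ > 0, ∀ u : Holder 2 α, ‖u‖ < δ → HolderBound α (ε * ‖u‖) fun ω =>
      boundaryPotential ω (ContinuousMap.const S2 R + toC u) -
        boundaryPotential ω (ContinuousMap.const S2 R) - potentialDeriv R ω (toC u) := by
  -- The `16` offsets the factor lost in `abs_sub_le_of_equivariant`.
  obtain ⟨δ, hδ, h⟩ := exists_uniform_strict hR (show 0 < ε / 16 by positivity)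
  refine ⟨δ, hδ, fun u hu => ?_⟩
  have hu' : ‖toC u‖ < δ := (norm_toC_le u).trans_lt hu
  have hun := norm_nonneg u
  refine ⟨fun ω => ?_, fun ω ω' => ?_⟩
  · have h1 := h ω (toC u) 0 hu' (by simpa using hδ)
    simp only [add_zero, sub_zero] at h1
    refine h1.trans ?_
    have := norm_toC_le u
    nlinarith
  · have h2 := abs_sub_le_of_equivariant hα1 u (N := fun ω v =>
      boundaryPotential ω (ContinuousMap.const S2 R + v) -
        boundaryPotential ω (ContinuousMap.const S2 R) - potentialDeriv R ω v)
      (fun g ω v => by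
        simp only [boundaryPotential_rotPoint, potentialDeriv_rotPoint, compRot_add, compRot_const])
      (show 0 ≤ ε / 16 by positivity)
      (fun ω g => by
        have h3 := h ω (compRot g (toC u)) (toC u) ((norm_compRot_le g _).trans_lt hu') hu'
        rw [map_sub] at h3
        refine le_trans (le_of_eq ?_) h3
        congr 1
        ring) ω ω'
    refine h2.trans_eq ?_
    ring

/-- The lower bound `m` keeps the normalization `φ / φ(ω)` below `M / m` and Lipschitz in `φ`; the
star potential is then handled by `abs_starPotential_sub_le`, with total Coulomb mass `4π` for every
`ω`. -/
theorem exists_lipschitz_boundaryPotential {m M : ℝ} (hm : 0 < m) (hmM : m ≤ M) :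
    ∃ K, 0 ≤ K ∧ ∀ (ω : S2) (φ₁ φ₂ : C(S2, ℝ)), (∀ x, m ≤ φ₁ x) → (∀ x, m ≤ φ₂ x) →
      (∀ x, φ₁ x ≤ M) → (∀ x, φ₂ x ≤ M) →
      |boundaryPotential ω φ₁ - boundaryPotential ω φ₂| ≤ K * ‖φ₁ - φ₂‖ := by
  have hM : 0 < M := hm.trans_le hmM
  have hone : 1 ≤ M / m := (one_le_div hm).2 hmM
  set A : ℝ := 2 * (M / m) * (4 * Real.pi)
  have hA : 0 ≤ A := by positivity
  set q : ℝ := A * (M / m + 1) + 4 * Real.pi / 3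
  have hq : 0 ≤ q := by positivity
  refine ⟨2 * M * q + M ^ 2 * (A * (2 * M / m ^ 2)), by positivity, ?_⟩
  intro ω φ₁ φ₂ hm₁ hm₂ hM₁ hM₂
  set E := ‖φ₁ - φ₂‖
  have hE : ∀ x, |φ₁ x - φ₂ x| ≤ E := fun x => (φ₁ - φ₂).norm_coe_le_norm x
  have hE0 : 0 ≤ E := norm_nonneg _
  have hψ : ∀ φ : C(S2, ℝ), (∀ x, m ≤ φ x) → (∀ x, φ x ≤ M) →
      (∀ x, 0 < ((φ ω)⁻¹ • φ) x) ∧ ∀ x, ((φ ω)⁻¹ • φ) x ≤ M / m := by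
    intro φ h1 h2
    have hω : 0 < φ ω := hm.trans_le (h1 ω)
    refine ⟨fun x => mul_pos (inv_pos.2 hω) (hm.trans_le (h1 x)), fun x => ?_⟩
    change (φ ω)⁻¹ * φ x ≤ _
    rw [inv_mul_eq_div]
    exact div_le_div₀ hM.le (h2 x) hm (h1 ω)
  obtain ⟨p1, b1⟩ := hψ φ₁ hm₁ hM₁
  obtain ⟨p2, b2⟩ := hψ φ₂ hm₂ hM₂
  set ψ₁ := (φ₁ ω)⁻¹ • φ₁
  set ψ₂ := (φ₂ ω)⁻¹ • φ₂
  have hlip : |starPotential ω ψ₁ - starPotential ω ψ₂| ≤ A * ‖ψ₁ - ψ₂‖ := by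
    have := abs_starPotential_sub_le ω p1 p2 b1 b2
    rwa [coulombMass_eq, singleLayer_one] at this
  have hψE : ‖ψ₁ - ψ₂‖ ≤ 2 * M / m ^ 2 * E := by
    rw [ContinuousMap.norm_le _ (by positivity)]
    intro x
    change |(φ₁ ω)⁻¹ * φ₁ x - (φ₂ ω)⁻¹ * φ₂ x| ≤ _
    have h1 : 0 < φ₁ ω := hm.trans_le (hm₁ ω)
    have h2 : 0 < φ₂ ω := hm.trans_le (hm₂ ω)
    have e : (φ₁ ω)⁻¹ * φ₁ x - (φ₂ ω)⁻¹ * φ₂ x =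
        ((φ₁ x - φ₂ x) * φ₂ ω - φ₂ x * (φ₁ ω - φ₂ ω)) / (φ₁ ω * φ₂ ω) := by
      field_simp
      ring
    rw [e, abs_div, abs_of_pos (mul_pos h1 h2), div_mul_eq_mul_div]
    refine div_le_div₀ (by positivity) ?_ (by positivity) ?_
    · refine (abs_sub _ _).trans ?_
      rw [abs_mul, abs_mul, abs_of_pos h2, abs_of_pos (hm.trans_le (hm₂ x))]
      calc |φ₁ x - φ₂ x| * φ₂ ω + φ₂ x * |φ₁ ω - φ₂ ω| ≤ E * M + M * E := by
            gcongr
            · exact hE x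
            · exact hM₂ ω
            · exact hM₂ x
            · exact hE ω
        _ = 2 * M * E := by ring
    · rw [sq]
      exact mul_le_mul (hm₁ ω) (hm₂ ω) hm.le h1.le
  have hbound : |starPotential ω ψ₁| ≤ q := by
    have h1 := abs_starPotential_sub_le ω (ψ₁ := ψ₁) (ψ₂ := 1) (M := M / m) p1
      (fun _ => by simp) b1 (fun _ => by simpa using hone)
    rw [coulombMass_eq, singleLayer_one, starPotential_one] at h1
    have h2 : ‖ψ₁ - 1‖ ≤ M / m + 1 := by
      rw [ContinuousMap.norm_le _ (by positivity)]
      intro x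
      change |ψ₁ x - 1| ≤ _
      rw [abs_le]
      constructor
      · linarith [p1 x, hone]
      · linarith [b1 x]
    have h3 := abs_sub_abs_le_abs_sub (starPotential ω ψ₁) (4 * Real.pi / 3)
    rw [abs_of_pos (show 0 < 4 * Real.pi / 3 by positivity)] at h3
    have h4 : A * ‖ψ₁ - 1‖ ≤ A * (M / m + 1) := by gcongr
    simp only [q]
    linarith
  have hsq : |φ₁ ω ^ 2 - φ₂ ω ^ 2| ≤ 2 * M * E := by
    have h1 : 0 < φ₁ ω := hm.trans_le (hm₁ ω)
    have h2 : 0 < φ₂ ω := hm.trans_le (hm₂ ω)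
    rw [sq_sub_sq, abs_mul, abs_of_pos (add_pos h1 h2)]
    calc (φ₁ ω + φ₂ ω) * |φ₁ ω - φ₂ ω| ≤ (M + M) * E := by
          gcongr
          · exact hM₁ ω
          · exact hM₂ ω
          · exact hE ω
      _ = _ := by ring
  have hsq2 : φ₂ ω ^ 2 ≤ M ^ 2 := pow_le_pow_left₀ (hm.le.trans (hm₂ ω)) (hM₂ ω) 2
  have e : boundaryPotential ω φ₁ - boundaryPotential ω φ₂ =
      (φ₁ ω ^ 2 - φ₂ ω ^ 2) * starPotential ω ψ₁ +
        φ₂ ω ^ 2 * (starPotential ω ψ₁ - starPotential ω ψ₂) := by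
    simp only [boundaryPotential, ψ₁, ψ₂]
    ring
  rw [e]
  refine (abs_add_le _ _).trans ?_
  rw [abs_mul, abs_mul, abs_of_nonneg (sq_nonneg (φ₂ ω))]
  calc |φ₁ ω ^ 2 - φ₂ ω ^ 2| * |starPotential ω ψ₁| +
        φ₂ ω ^ 2 * |starPotential ω ψ₁ - starPotential ω ψ₂|
      ≤ 2 * M * E * q + M ^ 2 * (A * (2 * M / m ^ 2 * E)) := by
        gcongr
        exact hlip.trans (by gcongr)
    _ = _ := by ring

theorem exists_holderBound_potential {α : ℝ≥0} (hα1 : α < 1) {R m : ℝ} (hm : 0 < m)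
    (u : Holder 2 α) (hu : ∀ x, m ≤ R + u x) :
    ∃ C, HolderBound α C fun ω => boundaryPotential ω (ContinuousMap.const S2 R + toC u) := by
  set φ := ContinuousMap.const S2 R + toC u with hφ
  have hφm : ∀ x, m ≤ φ x := hu
  have hφM : ∀ x, φ x ≤ ‖φ‖ := fun x => (le_abs_self _).trans (φ.norm_coe_le_norm x)
  obtain ⟨K, hK0, hK⟩ := exists_lipschitz_boundaryPotential hm
    ((hφm (Classical.arbitrary S2)).trans (hφM _))
  have hω : ∀ ω ω', |boundaryPotential ω φ - boundaryPotential ω' φ| ≤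
      16 * K * ‖u‖ * dist ω ω' ^ (α : ℝ) :=
    abs_sub_le_of_equivariant hα1 u
      (N := fun ω v => boundaryPotential ω (ContinuousMap.const S2 R + v))
      (fun g ω v => by simp only [boundaryPotential_rotPoint, compRot_add, compRot_const]) hK0
      (fun ω g => by
        have h := hK ω (ContinuousMap.const S2 R + compRot g (toC u)) φ
          (fun x => hφm (rotPoint g x)) hφm (fun x => hφM (rotPoint g x)) hφM
        rwa [hφ, add_sub_add_left_eq_sub] at h)
  set ω₀ : S2 := Classical.arbitrary S2
  set B := |boundaryPotential ω₀ φ| + 16 * K * ‖u‖ * 2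
  have h0 : 0 ≤ 16 * K * ‖u‖ := by positivity
  refine ⟨B + 16 * K * ‖u‖, fun ω => ?_, fun ω ω' => ?_⟩
  · have h1 := hω ω ω₀
    have h2 : dist ω ω₀ ^ (α : ℝ) ≤ 2 := by
      have hd : dist ω ω₀ ≤ 2 := by
        rw [Subtype.dist_eq, dist_eq_norm]; exact norm_sub_le_two ω ω₀
      calc dist ω ω₀ ^ (α : ℝ) ≤ (2 * 1) ^ (α : ℝ) := by gcongr; simpa using hd
        _ ≤ 2 * 1 ^ (α : ℝ) := rpow_le_mul_rpow hα1 (by norm_num) zero_le_one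
        _ = 2 := by simp
    have h3 := abs_sub_abs_le_abs_sub (boundaryPotential ω φ) (boundaryPotential ω₀ φ)
    have h4 : 16 * K * ‖u‖ * dist ω ω₀ ^ (α : ℝ) ≤ 16 * K * ‖u‖ * 2 := by gcongr
    rw [Real.norm_eq_abs]
    simp only [B]
    linarith
  · refine (hω ω ω').trans ?_
    gcongr
    simp only [B]
    have := abs_nonneg (boundaryPotential ω₀ φ)
    linarith

/-! ### The functional near a ball -/

theorem ext_const_add (R : ℝ) (f : S2 → ℝ) {x : E3} (hx : x ≠ 0) :
    ext (fun ω => R + f ω) x = R + ext f x := by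
  simp only [ext, dif_pos hx]

theorem ExtC2.const_add {f : S2 → ℝ} (hf : ExtC2 f) (R : ℝ) : ExtC2 fun ω => R + f ω :=
  (contDiffOn_const.add hf).congr fun _ hx => ext_const_add R f hx

theorem d1_const_add (R : ℝ) (f : S2 → ℝ) (i : Fin 3) {x : E3} (hx : x ≠ 0) :
    d1 (fun ω => R + f ω) i x = d1 f i x := by
  have h : ext (fun ω => R + f ω) =ᶠ[𝓝 x] fun y => R + ext f y := by
    filter_upwards [isOpen_ne.mem_nhds hx] with y hy
    exact ext_const_add R f hy
  rw [d1, d1, h.fderiv_eq, fderiv_const_add]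

theorem d2_const_add (R : ℝ) (f : S2 → ℝ) (i j : Fin 3) {x : E3} (hx : x ≠ 0) :
    d2 (fun ω => R + f ω) i j x = d2 f i j x := by
  have h : d1 (fun ω => R + f ω) i =ᶠ[𝓝 x] d1 f i := by
    filter_upwards [isOpen_ne.mem_nhds hx] with y hy
    exact d1_const_add R f i hy
  rw [d2, d2, h.fderiv_eq]

theorem jet_const_add (R : ℝ) (f : S2 → ℝ) (ω : S2) :
    jet (fun ω => R + f ω) ω = ((R, 0, 0) : Jet) + jet f ω := by
  simp only [jet, d1_const_add R f _ (ne_zero ω), d2_const_add R f _ _ (ne_zero ω)]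
  refine Prod.ext rfl (Prod.ext ?_ ?_)
  · exact (zero_add _).symm
  · exact (zero_add _).symm

theorem F_const_add {α : ℝ≥0} {R : ℝ} (χ : Holder 2 α) (h : ∀ ω, 0 < R + χ ω) (ω : S2) :
    F (fun ω' => R + χ ω') ω = localPart (((R, 0, 0) : Jet) + jet χ ω) +
      boundaryPotential ω (ContinuousMap.const S2 R + toC χ) := by
  rw [F, local_eq_localPart ((IsHolder.extC2 χ.2).const_add R) h, jet_const_add]
  congr 1
  exact integral_Omega_eq ω (φ := ContinuousMap.const S2 R + toC χ) h

theorem jet_zero (ω : S2) : jet (0 : S2 → ℝ) ω = 0 := by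
  have h := jet_smul (IsHolder.zero 2 1) 0 ω
  rwa [zero_smul, zero_smul] at h

theorem F_const (α : ℝ≥0) {R : ℝ} (hR : 0 < R) (ω : S2) :
    F (fun _ => R) ω = localPart (R, 0, 0) + boundaryPotential ω (ContinuousMap.const S2 R) := by
  have h := F_const_add (R := R) (0 : Holder 2 α) (fun ω => by
    change 0 < R + 0
    simpa using hR) ω
  have e1 : (fun ω' => R + (0 : Holder 2 α) ω') = fun _ => R := funext fun ω' => add_zero R
  have e2 : jet (0 : Holder 2 α) ω = 0 := jet_zero ω
  have e3 : ContinuousMap.const S2 R + toC (0 : Holder 2 α) = ContinuousMap.const S2 R := by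
    ext x
    exact add_zero R
  rwa [e1, e2, e3, add_zero] at h

theorem PhiFun_eq {α : ℝ≥0} {R : ℝ} (hR : 0 < R) (χ : Holder 2 α) (h : ∀ ω, 0 < R + χ ω)
    (ω : S2) : PhiFun R χ ω = R ^ 2 * ((localPart (((R, 0, 0) : Jet) + jet χ ω) -
      localPart (R, 0, 0)) + (boundaryPotential ω (ContinuousMap.const S2 R + toC χ) -
      boundaryPotential ω (ContinuousMap.const S2 R))) := by
  rw [PhiFun, F_const_add χ h, F_const α hR]
  ring

theorem holderBound_const {V : Type*} [NormedAddCommGroup V] (α : ℝ≥0) (c : V) :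
    HolderBound α ‖c‖ fun _ : S2 => c :=
  ⟨fun _ => le_rfl, fun ω ω' => by rw [sub_self, norm_zero]; positivity⟩

theorem isHolder_PhiFun {α : ℝ≥0} (hα0 : 0 < α) (hα1 : α < 1) {R m : ℝ} (hR : 0 < R)
    (hm : 0 < m) (χ : Holder 2 α) (h : ∀ ω, m ≤ R + χ ω) : IsHolder 0 α (PhiFun R χ) := by
  have hpos : ∀ ω, 0 < R + χ ω := fun ω => hm.trans_le (h ω)
  obtain ⟨C₁, h₁⟩ := ((holderBound_const α ((R, 0, 0) : Jet)).add
    (holderBound_jet hα1 χ)).comp_exists hα0 (H := localPart)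
    (fun ω => contDiffAt_localPart (hpos ω))
  obtain ⟨C₂, h₂⟩ := exists_holderBound_potential hα1 hm χ h
  obtain ⟨C₃, h₃⟩ := exists_holderBound_potential hα1 hR (0 : Holder 2 α)
    (fun x => (add_zero R).ge)
  have h4 := (((h₁.add (holderBound_const α (-localPart (R, 0, 0)))).add
    (h₂.add (h₃.const_mul (-1)))).const_mul (R ^ 2)).isHolder hα0
  convert h4 using 1
  funext ω
  rw [PhiFun_eq hR χ hpos]
  have e3 : ContinuousMap.const S2 R + toC (0 : Holder 2 α) = ContinuousMap.const S2 R := by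
    ext x
    exact add_zero R
  rw [e3]
  ring

theorem Phi_apply {α : ℝ≥0} (hα0 : 0 < α) (hα1 : α < 1) {R : ℝ} (χ : Holder 2 α)
    (h : (R, χ) ∈ domO α) (ω : S2) : Phi α R χ ω = PhiFun R χ ω := by
  obtain ⟨hR, hinf⟩ := h
  simp only at hR hinf
  have hbdd : BddBelow (range fun ω : S2 => χ ω) :=
    (isCompact_range (toC χ).continuous).bddBelow
  -- Membership in the domain says exactly that `R + inf χ` is a positive lower bound for the radius
  -- function.
  have hH : IsHolder 0 α (PhiFun R χ) :=
    isHolder_PhiFun hα0 hα1 hR (m := R + ⨅ ω : S2, χ ω) (by linarith) χ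
      fun ω => by linarith [ciInf_le hbdd ω]
  rw [Phi, dif_pos hH]

theorem mem_domO {α : ℝ≥0} {R : ℝ} (χ : Holder 2 α) (h : ‖χ‖ < R) : (R, χ) ∈ domO α := by
  refine ⟨(norm_nonneg χ).trans_lt h, ?_⟩
  refine (neg_lt_neg h).trans_le (le_ciInf fun ω => ?_)
  have := (toC χ).norm_coe_le_norm ω
  have h2 := norm_toC_le χ
  exact neg_le_of_abs_le (this.trans h2)

/-! ### The linearization -/

/-- The linearization of `R² F(R + ·)` at zero, as a function on the sphere. -/
def linFun {α : ℝ≥0} (R : ℝ) (u : Holder 2 α) (ω : S2) : ℝ :=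
  R ^ 2 * (localPartDeriv R (jet u ω) + potentialDeriv R ω (toC u))

theorem HolderBound.clm_comp {V : Type*} [NormedAddCommGroup V] [NormedSpace ℝ V] {α : ℝ≥0}
    {C : ℝ} {f : S2 → V} (hf : HolderBound α C f) (L : V →L[ℝ] ℝ) :
    HolderBound α (‖L‖ * C) fun ω => L (f ω) := by
  refine ⟨fun ω => L.le_opNorm_of_le (hf.1 ω), fun ω ω' => ?_⟩
  rw [← map_sub, mul_assoc]
  exact L.le_opNorm_of_le (hf.2 ω ω')

theorem exists_holderBound_linFun {α : ℝ≥0} (hα1 : α < 1) (R : ℝ) :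
    ∃ K, 0 ≤ K ∧ ∀ u : Holder 2 α, HolderBound α (K * ‖u‖) (linFun R u) := by
  obtain ⟨K, hK0, hK⟩ := holderBound_potentialDeriv hα1 R
  refine ⟨R ^ 2 * (‖localPartDeriv R‖ * 4 + K), by positivity, fun u => ?_⟩
  have h := (((holderBound_jet hα1 u).clm_comp (localPartDeriv R)).add (hK u)).const_mul (R ^ 2)
  refine h.mono (le_of_eq ?_)
  rw [abs_of_nonneg (sq_nonneg R)]
  ring

theorem exists_clm_linFun {α : ℝ≥0} (hα0 : 0 < α) (hα1 : α < 1) (R : ℝ) :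
    ∃ D : Holder 2 α →L[ℝ] Holder 0 α, ∀ u ω, D u ω = linFun R u ω := by
  obtain ⟨K, hK0, hK⟩ := exists_holderBound_linFun hα1 R
  let L : Holder 2 α →ₗ[ℝ] Holder 0 α :=
    { toFun := fun u => ⟨linFun R u, (hK u).isHolder hα0⟩
      map_add' := fun u v => Holder.toFun_injective <| funext fun ω => by
        change linFun R (u + v) ω = linFun R u ω + linFun R v ω
        have e1 : jet (u + v : Holder 2 α) ω = jet u ω + jet v ω := jet_add u.2 v.2 ω
        have e2 : toC (u + v) = toC u + toC v := rfl
        rw [linFun, e1, e2, map_add, map_add, linFun, linFun]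
        ring
      map_smul' := fun c u => Holder.toFun_injective <| funext fun ω => by
        change linFun R (c • u) ω = c * linFun R u ω
        have e1 : jet (c • u : Holder 2 α) ω = c • jet u ω := jet_smul u.2 c ω
        have e2 : toC (c • u) = c • toC u := rfl
        rw [linFun, e1, e2, map_smul, map_smul, linFun, smul_eq_mul, smul_eq_mul]
        ring }
  refine ⟨L.mkContinuous (2 * K) fun u => ?_, fun u ω => rfl⟩
  refine (Holder.norm_le_of_holderBound (L u) (hK u)).trans_eq ?_
  ring

/-- Strict differentiability is applied to the pairs `(jet at ω, 0)` and `(jet at ω, jet at ω')`,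
shifted by `(R, 0, 0)`; the second pair gives the Hölder estimate. The factors `4` are the constant
of `holderBound_jet`. -/
theorem holderBound_local_remainder {α : ℝ≥0} (hα1 : α < 1) {R : ℝ} (hR : 0 < R) {ε : ℝ}
    (hε : 0 < ε) : ∃ δ > 0, ∀ u : Holder 2 α, ‖u‖ < δ → HolderBound α (ε * ‖u‖) fun ω =>
      localPart (((R, 0, 0) : Jet) + jet u ω) - localPart (R, 0, 0) -
        localPartDeriv R (jet u ω) := by
  have h := hasStrictFDerivAt_localPart hR
  rw [hasStrictFDerivAt_iff_isLittleO, Asymptotics.isLittleO_iff] at h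
  obtain ⟨δ, hδ, hball⟩ := Metric.eventually_nhds_iff_ball.1 (h (show 0 < ε / 4 by positivity))
  refine ⟨δ / 4, by positivity, fun u hu => ?_⟩
  have hj := holderBound_jet hα1 u
  set c : Jet := (R, 0, 0)
  have hmem : ∀ ω, c + jet u ω ∈ Metric.ball c δ := fun ω => by
    rw [mem_ball_iff_norm, add_sub_cancel_left]
    exact (hj.1 ω).trans_lt (by linarith)
  refine ⟨fun ω => ?_, fun ω ω' => ?_⟩
  · have h1 := hball (c + jet u ω, c) (by
      rw [← ball_prod_same]
      exact ⟨hmem ω, Metric.mem_ball_self hδ⟩)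
    simp only [add_sub_cancel_left] at h1
    refine h1.trans ?_
    have := hj.1 ω
    nlinarith
  · have h1 := hball (c + jet u ω, c + jet u ω') (by
      rw [← ball_prod_same]
      exact ⟨hmem ω, hmem ω'⟩)
    simp only [add_sub_add_left_eq_sub, map_sub] at h1
    have e : localPart (c + jet u ω) - localPart c - localPartDeriv R (jet u ω) -
        (localPart (c + jet u ω') - localPart c - localPartDeriv R (jet u ω')) =
        localPart (c + jet u ω) - localPart (c + jet u ω') -
        (localPartDeriv R (jet u ω) - localPartDeriv R (jet u ω')) := by ring
    rw [e]
    refine h1.trans ?_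
    calc ε / 4 * ‖jet u ω - jet u ω'‖ ≤ ε / 4 * (4 * ‖u‖ * dist ω ω' ^ (α : ℝ)) :=
          mul_le_mul_of_nonneg_left (hj.2 ω ω') (by positivity)
      _ = _ := by ring

theorem hasFDerivAt_Phi {α : ℝ≥0} (hα0 : 0 < α) (hα1 : α < 1) {R : ℝ} (hR : 0 < R)
    (D : Holder 2 α →L[ℝ] Holder 0 α) (hD : ∀ u ω, D u ω = linFun R u ω) :
    HasFDerivAt (Phi α R) D 0 := by
  rw [hasFDerivAt_iff_isLittleO_nhds_zero, Asymptotics.isLittleO_iff]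
  intro ε hε
  -- The `4` covers two remainders and the two terms of the `C^{0,α}` norm; `R²` is the prefactor in
  -- `Φ`.
  set ε' : ℝ := ε / (4 * R ^ 2) with hε'
  have hε'0 : 0 < ε' := by positivity
  obtain ⟨δ₁, hδ₁, h₁⟩ := holderBound_local_remainder hα1 hR hε'0
  obtain ⟨δ₂, hδ₂, h₂⟩ := holderBound_potential_remainder hα1 hR hε'0
  have hz : (R, (0 : Holder 2 α)) ∈ domO α := mem_domO 0 (by rw [norm_zero]; exact hR)
  filter_upwards [Metric.ball_mem_nhds (0 : Holder 2 α) (lt_min hR (lt_min hδ₁ hδ₂))] with u hu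
  rw [mem_ball_zero_iff, lt_min_iff, lt_min_iff] at hu
  obtain ⟨hu, hu1, hu2⟩ := hu
  have hdom := mem_domO u hu
  have hpos : ∀ ω, 0 < R + u ω := fun ω => by
    have := ((toC u).norm_coe_le_norm ω).trans (norm_toC_le u)
    have := neg_le_of_abs_le this
    rw [toC_apply] at this
    linarith
  have h := ((h₁ u hu1).add (h₂ u hu2)).const_mul (R ^ 2)
  have hval : ∀ ω, (Phi α R (0 + u) - Phi α R 0 - D u) ω = R ^ 2 *
      (localPart (((R, 0, 0) : Jet) + jet u ω) - localPart (R, 0, 0) -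
        localPartDeriv R (jet u ω) + (boundaryPotential ω (ContinuousMap.const S2 R + toC u) -
        boundaryPotential ω (ContinuousMap.const S2 R) - potentialDeriv R ω (toC u))) := by
    intro ω
    change Phi α R (0 + u) ω - Phi α R 0 ω - D u ω = _
    rw [zero_add, Phi_apply hα0 hα1 u hdom, Phi_apply hα0 hα1 0 hz, hD, PhiFun_eq hR u hpos]
    have e : PhiFun R (0 : Holder 2 α) ω = 0 := by
      have e1 : (fun ω' => R + (0 : Holder 2 α) ω') = fun _ => R := funext fun ω' => add_zero R
      rw [PhiFun, e1, sub_self, mul_zero]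
    rw [e, linFun]
    ring
  have h3 := Holder.norm_le_of_holderBound (Phi α R (0 + u) - Phi α R 0 - D u)
    ((funext hval : (Phi α R (0 + u) - Phi α R 0 - D u).1 = _) ▸ h)
  refine h3.trans_eq ?_
  rw [abs_of_nonneg (sq_nonneg R), hε']
  field_simp
  ring

theorem differentiableAt_Phi {α : ℝ≥0} (hα0 : 0 < α) (hα1 : α < 1) {R : ℝ} (hR : 0 < R) :
    DifferentiableAt ℝ (Phi α R) 0 := by
  obtain ⟨D, hD⟩ := exists_clm_linFun hα0 hα1 R
  exact (hasFDerivAt_Phi hα0 hα1 hR D hD).differentiableAt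

theorem DPhi_apply {α : ℝ≥0} (hα0 : 0 < α) (hα1 : α < 1) {R : ℝ} (hR : 0 < R) (u : Holder 2 α)
    (ω : S2) : DPhi α R u ω = - lap u ω - 2 * u ω +
      R ^ 3 * ((∫ ω' : S2, u ω' / ‖(ω : E3) - (ω' : E3)‖ ∂surf) - 4 * Real.pi / 3 * u ω) := by
  obtain ⟨D, hD⟩ := exists_clm_linFun hα0 hα1 R
  rw [DPhi, (hasFDerivAt_Phi hα0 hα1 hR D hD).fderiv, hD, linFun, localPartDeriv_apply,
    potentialDeriv_apply, lap_eq (IsHolder.extC2 u.2), singleLayer_apply]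
  simp only [jet, toC_apply]
  field_simp
  ring

/-! ### Rotation invariance -/

theorem sum_d2_eq_laplacian {f : S2 → ℝ} (hf : ExtC2 f) {x : E3} (hx : x ≠ 0) :
    ∑ i, d2 f i i x = Laplacian.laplacian (ext f) x := by
  rw [InnerProductSpace.laplacian_eq_iteratedFDeriv_orthonormalBasis (ext f)
    (EuclideanSpace.basisFun (Fin 3) ℝ)]
  simp [hf.d2_eq _ _ hx]

/-- The spherical Laplacian is the Euclidean Laplacian of the extension, a trace of the Hessian that
may be computed in any orthonormal basis; use the standard basis at `ω` and its image under `g` at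
`gω`. -/
theorem lap_rotPoint {α : ℝ≥0} (g : E3 ≃ₗᵢ[ℝ] E3) (u : Holder 2 α) (ω : S2) :
    lap (rot g u) ω = lap u (rotPoint g ω) := by
  rw [lap_eq (IsHolder.extC2 (rot g u).2), lap_eq (IsHolder.extC2 u.2),
    sum_d2_eq_laplacian (IsHolder.extC2 (rot g u).2) (ne_zero ω),
    sum_d2_eq_laplacian (IsHolder.extC2 u.2) (ne_zero _)]
  have he : ext (rot g u).1 = ext u.1 ∘ g := ext_rot g u.1
  have hd := g.toContinuousLinearEquiv.iteratedFDerivWithin_comp_right (ext u.1)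
    (s := univ) uniqueDiffOn_univ (mem_univ _) (x := (ω : E3)) 2
  simp only [preimage_univ, iteratedFDerivWithin_univ] at hd
  rw [he, InnerProductSpace.laplacian_eq_iteratedFDeriv_orthonormalBasis _
    (EuclideanSpace.basisFun (Fin 3) ℝ),
    InnerProductSpace.laplacian_eq_iteratedFDeriv_orthonormalBasis (ext u.1)
    ((EuclideanSpace.basisFun (Fin 3) ℝ).map g)]
  refine Finset.sum_congr rfl fun i _ => ?_
  have hd' : iteratedFDeriv ℝ 2 (ext u.1 ∘ g) (ω : E3) = _ := hd
  rw [hd', ContinuousMultilinearMap.compContinuousLinearMap_apply]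
  congr 1
  funext k
  fin_cases k <;> rfl

theorem DPhi_rot {α : ℝ≥0} (hα0 : 0 < α) (hα1 : α < 1) {R : ℝ} (hR : 0 < R)
    (g : E3 ≃ₗᵢ[ℝ] E3) (u : Holder 2 α) : DPhi α R (rot g u) = rot g (DPhi α R u) := by
  refine Holder.toFun_injective (funext fun ω => ?_)
  change DPhi α R (rot g u) ω = DPhi α R u (rotPoint g ω)
  have h : ∫ ω' : S2, rot g u ω' / ‖(ω : E3) - (ω' : E3)‖ ∂surf =
      ∫ ω' : S2, u ω' / ‖(rotPoint g ω : E3) - (ω' : E3)‖ ∂surf :=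
    (singleLayer_rotPoint g ω (toC u)).symm
  rw [DPhi_apply hα0 hα1 hR, DPhi_apply hα0 hα1 hR, lap_rotPoint, h]
  rfl

/-! ### Spherical harmonics -/

theorem holderBound_coe {α : ℝ≥0} (hα1 : α < 1) :
    HolderBound α 2 fun ω : S2 => (ω : E3) := by
  refine ⟨fun ω => by rw [norm_coe]; norm_num, fun ω ω' => ?_⟩
  have h2 : dist ω ω' ≤ 2 := by
    rw [Subtype.dist_eq, dist_eq_norm]
    exact norm_sub_le_two ω ω'
  rw [← dist_eq_norm, ← Subtype.dist_eq]
  have h := rpow_le_mul_rpow hα1 (K := 2) (d := dist ω ω' / 2) (by norm_num) (by positivity)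
  have h3 : dist ω ω' / 2 ≤ (dist ω ω' / 2) ^ (α : ℝ) := by
    calc dist ω ω' / 2 = (dist ω ω' / 2) ^ (1 : ℝ) := (Real.rpow_one _).symm
      _ ≤ _ := Real.rpow_le_rpow_of_exponent_ge_of_imp (by positivity) (by linarith)
            (by exact_mod_cast hα1.le) (fun _ h => absurd h one_ne_zero)
  have h4 : (dist ω ω' / 2) ^ (α : ℝ) ≤ dist ω ω' ^ (α : ℝ) := by
    gcongr
    linarith [dist_nonneg (x := ω) (y := ω')]
  linarith

/-- With one derivative to spare, the `k`-th derivative is `C¹` near the sphere, and it is composed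
with the inclusion of the sphere, which is `α`-Hölder since the sphere is bounded. -/
theorem isHolder_of_contDiffOn {α : ℝ≥0} (hα0 : 0 < α) (hα1 : α < 1) {k : ℕ} {f : S2 → ℝ}
    (hf : ContDiffOn ℝ (k + 1) (ext f) {0}ᶜ) : IsHolder k α f := by
  obtain ⟨C, hC⟩ := (holderBound_coe hα1).comp_exists hα0 (H := iteratedFDeriv ℝ k (ext f))
    (fun ω => (hf.contDiffAt (isOpen_compl_singleton.mem_nhds (ne_zero ω))).iteratedFDeriv_right
      (add_comm _ _).le)
  exact ⟨hf.of_le (by exact_mod_cast k.le_succ), hC.holderWith.memHolder⟩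

theorem polyFun_smul {l : ℕ} {p : MvPolynomial (Fin 3) ℝ} (hp : p.IsHomogeneous l) (c : ℝ)
    (x : E3) : polyFun p (c • x) = c ^ l * polyFun p x := by
  rw [polyFun, polyFun, MvPolynomial.eval_eq', MvPolynomial.eval_eq', Finset.mul_sum]
  refine Finset.sum_congr rfl fun d hd => ?_
  have hl : ∑ i, d i = l := by
    have h := hp (MvPolynomial.mem_support_iff.1 hd)
    rwa [Finsupp.weight_apply, Finsupp.sum_fintype _ _ (by simp), Finset.sum_congr rfl
      (fun i _ => show d i • (1 : Fin 3 → ℕ) i = d i by simp)] at h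
  simp only [PiLp.smul_apply, smul_eq_mul, mul_pow, Finset.prod_mul_distrib,
    Finset.prod_pow_eq_pow_sum, hl]
  ring

theorem ext_polyFun {l : ℕ} {p : MvPolynomial (Fin 3) ℝ} (hp : p.IsHomogeneous l) {x : E3}
    (hx : x ≠ 0) : ext (fun ω : S2 => polyFun p ω) x = ‖x‖⁻¹ ^ l * polyFun p x := by
  rw [ext, dif_pos hx]
  exact polyFun_smul hp _ x

theorem isHolder_polyFun {α : ℝ≥0} (hα0 : 0 < α) (hα1 : α < 1) (k : ℕ) {l : ℕ}
    {p : MvPolynomial (Fin 3) ℝ} (hp : p.IsHomogeneous l) :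
    IsHolder k α fun ω : S2 => polyFun p ω := by
  refine isHolder_of_contDiffOn hα0 hα1 ?_
  have h : ContDiffOn ℝ (k + 1) (fun x : E3 => ‖x‖⁻¹ ^ l * polyFun p x) {0}ᶜ := fun x hx =>
    ((((contDiffAt_norm ℝ hx).inv (norm_ne_zero_iff.2 hx)).pow l).mul
      (contDiff_polyFun p).contDiffAt).contDiffWithinAt
  exact h.congr fun x hx => ext_polyFun hp hx

theorem hasFDerivAt_inv_norm_pow (n : ℕ) {x : E3} (hx : x ≠ 0) :
    HasFDerivAt (fun y : E3 => ‖y‖⁻¹ ^ n) (-(n * ‖x‖⁻¹ ^ (n + 2)) • innerSL ℝ x) x := by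
  have hn : ‖x‖ ≠ 0 := norm_ne_zero_iff.2 hx
  have h1 : HasFDerivAt (fun y : E3 => ‖y‖) (‖x‖⁻¹ • innerSL ℝ x) x := by
    have h := (hasStrictFDerivAt_norm_sq x).hasFDerivAt.sqrt (pow_ne_zero 2 hn)
    simp only [Real.sqrt_sq (norm_nonneg _)] at h
    refine h.congr_fderiv ?_
    ext v
    simp
    ring
  have h2 := ((hasDerivAt_inv hn).comp_hasFDerivAt x h1).pow n
  refine h2.congr_fderiv ?_
  ext v
  cases n with
  | zero => simp
  | succ n =>
    simp
    field_simp
    ring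

theorem innerSL_stdVec (x : E3) (i : Fin 3) : innerSL ℝ x (stdVec i) = x i := by
  rw [innerSL_apply_apply, EuclideanSpace.inner_single_right]
  simp

theorem fderiv_polyFun_stdVec (p : MvPolynomial (Fin 3) ℝ) (x : E3) (i : Fin 3) :
    (∑ j, polyFun (MvPolynomial.pderiv j p) x • (EuclideanSpace.proj j : E3 →L[ℝ] ℝ)) (stdVec i) =
      polyFun (MvPolynomial.pderiv i p) x := by
  simp [ContinuousLinearMap.sum_apply, Pi.single_apply]

theorem d1_polyFun {l : ℕ} {p : MvPolynomial (Fin 3) ℝ} (hp : p.IsHomogeneous l) (i : Fin 3)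
    {x : E3} (hx : x ≠ 0) : d1 (fun ω : S2 => polyFun p ω) i x =
      ‖x‖⁻¹ ^ l * polyFun (MvPolynomial.pderiv i p) x -
        l * (‖x‖⁻¹ ^ (l + 2) * (x i * polyFun p x)) := by
  have h := (hasFDerivAt_inv_norm_pow l hx).mul (hasFDerivAt_polyFun p x)
  have he : ext (fun ω : S2 => polyFun p ω) =ᶠ[𝓝 x] fun y => ‖y‖⁻¹ ^ l * polyFun p y := by
    filter_upwards [isOpen_ne.mem_nhds hx] with y hy
    exact ext_polyFun hp hy
  rw [d1, (h.congr_of_eventuallyEq he).fderiv]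
  simp only [ContinuousLinearMap.add_apply, ContinuousLinearMap.smul_apply, smul_eq_mul,
    innerSL_stdVec, fderiv_polyFun_stdVec]
  ring

theorem d2_polyFun {l : ℕ} {p : MvPolynomial (Fin 3) ℝ} (hp : p.IsHomogeneous l) (i : Fin 3)
    (ω : S2) : d2 (fun ω : S2 => polyFun p ω) i i ω =
      polyFun (MvPolynomial.pderiv i (MvPolynomial.pderiv i p)) ω
        - 2 * l * ((ω : E3) i * polyFun (MvPolynomial.pderiv i p) ω)
        - l * polyFun p ω + l * (l + 2) * (ω : E3) i ^ 2 * polyFun p ω := by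
  have hω := ne_zero ω
  have h := ((hasFDerivAt_inv_norm_pow l hω).fun_mul
    (hasFDerivAt_polyFun (MvPolynomial.pderiv i p) ω)).fun_sub
    (((hasFDerivAt_inv_norm_pow (l + 2) hω).fun_mul
      ((EuclideanSpace.proj i : E3 →L[ℝ] ℝ).hasFDerivAt.fun_mul
        (hasFDerivAt_polyFun p ω))).const_mul (l : ℝ))
  have he : d1 (fun ω : S2 => polyFun p ω) i =ᶠ[𝓝 (ω : E3)] fun x =>
      ‖x‖⁻¹ ^ l * polyFun (MvPolynomial.pderiv i p) x -
        l * (‖x‖⁻¹ ^ (l + 2) * (EuclideanSpace.proj i x * polyFun p x)) := by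
    filter_upwards [isOpen_ne.mem_nhds hω] with y hy
    exact d1_polyFun hp i hy
  rw [d2, (h.congr_of_eventuallyEq he).fderiv]
  have e : (EuclideanSpace.proj i : E3 →L[ℝ] ℝ) (stdVec i) = 1 := by simp
  simp only [ContinuousLinearMap.add_apply, ContinuousLinearMap.sub_apply,
    ContinuousLinearMap.smul_apply, smul_eq_mul, innerSL_stdVec, fderiv_polyFun_stdVec, e,
    norm_coe, inv_one, one_pow]
  have e2 : (EuclideanSpace.proj i : E3 →L[ℝ] ℝ) (ω : E3) = (ω : E3) i := rfl
  rw [e2]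
  push_cast
  ring

/-- The extension is `|x|^(-l) p`. With `Δp = 0`, Euler's identity and `|ω| = 1`, the terms add up
to `-2l² - 3l + l(l + 2) = -l(l + 1)` times `p`. -/
theorem lap_polyFun {l : ℕ} {p : MvPolynomial (Fin 3) ℝ} (hp : p.IsHomogeneous l)
    (hΔ : ∑ i : Fin 3, MvPolynomial.pderiv i (MvPolynomial.pderiv i p) = 0)
    (hC : ExtC2 fun ω : S2 => polyFun p ω) (ω : S2) :
    lap (fun ω : S2 => polyFun p ω) ω = -(l * (l + 1)) * polyFun p ω := by
  rw [lap_eq hC]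
  simp only [d2_polyFun hp]
  have h1 : ∑ i : Fin 3, polyFun (MvPolynomial.pderiv i (MvPolynomial.pderiv i p)) ω = 0 := by
    simp only [polyFun, ← map_sum, hΔ, map_zero]
  have h2 : ∑ i : Fin 3, (ω : E3) i * polyFun (MvPolynomial.pderiv i p) ω = l * polyFun p ω := by
    have h := congrArg (MvPolynomial.eval fun i => (ω : E3) i) hp.sum_X_mul_pderiv
    simpa [polyFun, map_sum] using h
  have h3 : ∑ i : Fin 3, (ω : E3) i ^ 2 = 1 := by
    have h := EuclideanSpace.norm_sq_eq (ω : E3)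
    rw [norm_coe] at h
    simpa using h.symm
  simp only [Fin.sum_univ_three] at h1 h2 h3 ⊢
  linear_combination h1 - 2 * (l : ℝ) * h2 + l * (l + 2) * polyFun p ω * h3

theorem exists_eigenfunction {α : ℝ≥0} (hα0 : 0 < α) (hα1 : α < 1) {R : ℝ} (hR : 0 < R) (l : ℕ)
    (Y : S2 → ℝ) (hY : IsSphericalHarmonic l Y) :
    ∃ u : Holder 2 α, (∀ ω : S2, u ω = Y ω) ∧ ∀ ω : S2, DPhi α R u ω =
      ((l : ℝ) * (l + 1) - 2 - 4 * Real.pi / 3 * R ^ 3 * (1 - 3 / (2 * (l : ℝ) + 1))) * Y ω := by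
  obtain ⟨p, hp, hΔ, hYp⟩ := hY
  have hH : IsHolder 2 α fun ω : S2 => polyFun p ω := isHolder_polyFun hα0 hα1 2 hp
  refine ⟨⟨_, hH⟩, fun ω => (hYp ω).symm, fun ω => ?_⟩
  have hY' : Y ω = polyFun p ω := hYp ω
  have hI := singleLayer_polyC hp hΔ ω
  rw [singleLayer_apply] at hI
  have hI' : (2 * (l : ℝ) + 1) * ∫ ω' : S2, polyFun p ω' / ‖(ω : E3) - (ω' : E3)‖ ∂surf =
    4 * Real.pi * polyFun p ω := hI
  have hl : (2 * (l : ℝ) + 1) ≠ 0 := by positivity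
  have hI2 := (eq_div_iff hl).2 ((mul_comm _ _).trans hI')
  rw [DPhi_apply hα0 hα1 hR, hY']
  simp only [lap_polyFun hp hΔ hH.extC2, hI2]
  field_simp
  ring

end LiquidDrop

end

theorem proposition1p8 (α : ℝ≥0) (hα0 : 0 < α) (hα1 : α < 1) (R : ℝ) (hR : 0 < R) :
    -- `Φ(R, ·)` maps its domain into `C^{0,α}` and is Fréchet differentiable at `0`
    (∀ χ : Holder 2 α, (R, χ) ∈ domO α → ∀ ω : S2, Phi α R χ ω = PhiFun R χ ω) ∧
    DifferentiableAt ℝ (Phi α R) 0 ∧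
    -- formula for the derivative
    (∀ (u : Holder 2 α) (ω : S2),
      DPhi α R u ω = - lap u ω - 2 * u ω +
        R ^ 3 * ((∫ ω' : S2, u ω' / ‖(ω : E3) - (ω' : E3)‖ ∂surf) - 4 * Real.pi / 3 * u ω)) ∧
    -- it commutes with rotations
    (∀ (g : E3 ≃ₗᵢ[ℝ] E3) (u : Holder 2 α), DPhi α R (rot g u) = rot g (DPhi α R u)) ∧
    -- its eigenvalue on spherical harmonics of degree `l`
    (∀ (l : ℕ) (Y : S2 → ℝ), IsSphericalHarmonic l Y →
      ∃ u : Holder 2 α, (∀ ω : S2, u ω = Y ω) ∧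
        ∀ ω : S2, DPhi α R u ω =
          ((l : ℝ) * (l + 1) - 2 - 4 * Real.pi / 3 * R ^ 3 * (1 - 3 / (2 * (l : ℝ) + 1))) *
            Y ω) := by
  exact ⟨fun χ hχ ω => Phi_apply hα0 hα1 χ hχ ω, differentiableAt_Phi hα0 hα1 hR,
    fun u ω => DPhi_apply hα0 hα1 hR u ω, fun g u => DPhi_rot hα0 hα1 hR g u,
    fun l Y hY => exists_eigenfunction hα0 hα1 hR l Y hY⟩
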